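/- Let $q>0$ be real, $q\neq 1$, $h=\sqrt q-1/\sqrt q$; indices run over $-,0,+$. Let $g_{ij}=g^{ij}$ be the matrix with $g_{-+}=1/\sqrt q$, $g_{00}=1$, $g_{+-}=\sqrt q$ and all other entries $0$. Let $\mathcal P_t{}^{ij}_{kl}=g^{ij}g_{kl}/\sum_{m,n} g_{mn}g^{mn}$, let $\mathcal P_a$ be the orthogonal projector (for the standard bilinear form) of $\mathbb C^3\otimes\mathbb C^3$ onto the span of the coefficient vectors of $x^-x^0-qx^0x^-$, $x^+x^0-q^{-1}x^0x^+$, $x^+x^--x^-x^+-h(x^0)^2$, let $\mathcal P_s=1-\mathcal P_a-\mathcal P_t$, and let $\hat R=q\mathcal P_s-q^{-1}\mathcal P_a+q^{-2}\mathcal P_t$ be the braid matrix of $SO_q(3)$. Let $\mathcal A$ be the algebra over $\mathbb C$ generated by $x^-,x^0,x^+$ with the relations $\mathcal P_a xx=0$ and by the inverse $r^{-2}$ of $r^2=g_{ij}x^ix^j$. Let $\Omega^1$ be the $\mathcal A$-bimodule generated by $\xi^-,\xi^0,\xi^+$, free over them as a left module, with $x^i\xi^j=q\hat R^{ij}_{kl}\xi^kx^l$;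 let $d:\mathcal A\to\Omega^1$ be the derivation with $dx^i=\xi^i$, let $\Omega^2$ be the quotient of $\Omega^1\otimes_{\mathcal A}\Omega^1$ by the sub-bimodule generated by $\mathcal P_s\xi\xi$ and $\mathcal P_t\xi\xi$, with projection $\pi$, and let $d(f_i\xi^i)=\pi(df_i\otimes\xi^i)$ on 1-forms. A linear connection is a linear map $D:\Omega^1\to\Omega^1\otimes_{\mathcal A}\Omega^1$ together with an $\mathcal A$-bilinear map $\sigma$ of $\Omega^1\otimes_{\mathcal A}\Omega^1$ to itself (the generalized flip) such that $D(f\xi)=df\otimes\xi+fD\xi$ and $D(\xi f)=\sigma(\xi\otimes df)+(D\xi)f$; it is torsion-free if $d-\pi\circ D=0$ on $\Omega^1$. Let $\mathrm{Fun}(SO_q(3))$ be the algebra generated by $T^i_j$ with $\hat RTT=TT\hat R$, $g_{ij}T^i_kT^j_l=g_{kl}$, $T^i_kT^j_lg^{kl}=g^{ij}$ and quantum determinant $1$; it coacts on $\mathcal A$, $\Omega^1$, $\Omega^1\otimes_{\mathcal A}\Omega^1$ by $x^i\mapsto T^i_j\otimes x^j$, $\xi^i\mapsto T^i_j\otimes\xi^j$,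 and a connection is called $SO_q(3)$-invariant if $D$ commutes with the coactions. Put $$\theta=(q-1)^{-1}q^2r^{-2}x^i\xi^jg_{ij}.$$ Extend $\mathcal A$ to $\mathcal A_\Lambda$ by an invertible generator $\Lambda$ with $x^i\Lambda=q\Lambda x^i$, and $\Omega^1$ correspondingly by $\xi^i\Lambda=q\Lambda\xi^i$. Let $g:\Omega^1\otimes_{\mathcal A}\Omega^1\to\mathcal A_\Lambda$ be the left $\mathcal A$-linear map with $g(\xi^i\otimes\xi^j)=g^{ij}r^2\Lambda^2$. For a connection put $D_2(\omega\otimes\eta)=D\omega\otimes\eta+\sigma_{12}(\omega\otimes D\eta)$. A connection of the form $D\xi=-\theta\otimes\xi+\sigma(\xi\otimes\theta)$ is called compatible with $g$ up to the conformal factor $c$ if $g_{23}\bigl(D_2(\omega\otimes\eta)\bigr)=-\theta\, g(\omega\otimes\eta)+c\,g(\omega\otimes\eta)\,\theta$ for all $\omega,\eta\in\Omega^1$, where $g_{23}(\alpha\otimes\beta\otimes\gamma)=\alpha\,g(\beta\otimes\gamma)$. (For $c=1$ this is metric compatibility $g_{23}\circ D_2=d\circ g$ with $d=-[\theta,\cdot\,]$.)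 Then $df=-[\theta,f]$ for all $f\in\mathcal A$, $\theta$ is $SO_q(3)$-invariant, $g$ is $\mathcal A$-bilinear, and there are two linear connections, with different $D$, of the form $$D_{(0)}\xi=-\theta\otimes\xi+\sigma_0(\xi\otimes\theta)\qquad(\xi\in\Omega^1),$$ whose flips are given by $\sigma_0(\xi^i\otimes\xi^j)=S^{ij}{}_{hk}\,\xi^h\otimes\xi^k$ with $S=q\hat R$ and $S=(q\hat R)^{-1}$, respectively; in each case $\sigma_0$ is the only $\mathcal A$-bilinear map with these values. Both connections are torsion-free and $SO_q(3)$-invariant, both $\sigma_0$ satisfy the braid equation $\sigma_{12}\sigma_{23}\sigma_{12}=\sigma_{23}\sigma_{12}\sigma_{23}$, and for $S=(q\hat R)^{\pm1}$ the connection is compatible with $g$ up to the conformal factor $q^{\pm2}$ and $S^{ij}{}_{hk}g^{kl}S^{mn}{}_{jl}=q^{\pm2}g^{im}\delta^n_h$. Moreover these are the only two: every torsion-free linear connection of the form $D\xi=-\theta\otimes\xi+\sigma(\xi\otimes\theta)$ whose flip has complex coefficients $S^{ij}{}_{hk}$, and which is compatible with $g$ up to some conformal factor $c>0$, is one of them.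 -/

import Mathlib

open scoped TensorProduct
open MulOpposite (op)

namespace QEuclid
noncomputable section

set_option linter.unusedSimpArgs false
set_option linter.unnecessarySeqFocus false
set_option linter.unreachableTactic false
set_option linter.unusedTactic false

/-- Indices: `0, 1, 2` stand for `-, 0, +`. -/
abbrev Idx := Fin 3
/-- The deformation parameter, a positive real number. -/
abbrev Param := {q : ℝ // 0 < q}
/-- Complex matrices `M^{ij}_{kl}`; the entry is `M (i, j) (k, l)`. -/
abbrev Mat9 := Matrix (Idx × Idx) (Idx × Idx) ℂ

def qval (q : Param) : ℂ := ((q : ℝ) : ℂ)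
def sqrtq (q : Param) : ℂ := ((Real.sqrt (q : ℝ) : ℝ) : ℂ)
/-- `h = √q - 1/√q`. -/
def hpar (q : Param) : ℂ := sqrtq q - (sqrtq q)⁻¹

/-- The covariant metric matrix `g_{ij} = g^{ij}`: `g_{-+} = 1/√q`, `g_{00} = 1`, `g_{+-} = √q`. -/
def gmat (q : Param) : Matrix Idx Idx ℂ :=
  !![0, 0, (sqrtq q)⁻¹; 0, 1, 0; sqrtq q, 0, 0]

/-- The quadratic forms of the defining relations of the quantum space:
`x^- x^0 - q x^0 x^-`, `x^+ x^0 - q⁻¹ x^0 x^+` and `x^+ x^- - x^- x^+ - h (x^0)^2`.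
They span the image of the antisymmetric projector. -/
def avec (q : Param) : Fin 3 → Matrix Idx Idx ℂ :=
  ![!![0, 1, 0; -qval q, 0, 0; 0, 0, 0],
    !![0, 0, 0; 0, 0, -(qval q)⁻¹; 0, 1, 0],
    !![0, 0, -1; 0, -hpar q, 0; 1, 0, 0]]

/-- The orthogonal projector onto the line spanned by `m^{ij}` (for the bilinear form `∑ m^{ij} n^{ij}`). -/
def rankOne (m : Matrix Idx Idx ℂ) : Mat9 :=
  Matrix.of fun p r => m p.1 p.2 * m r.1 r.2 / ∑ i, ∑ j, m i j * m i j

/-- The trace projector, proportional to `g^{ij} g_{kl}`. -/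
def projT (q : Param) : Mat9 := rankOne (gmat q)
/-- The `q`-antisymmetric projector (the three vectors `avec q a` are pairwise orthogonal). -/
def projA (q : Param) : Mat9 := ∑ a, rankOne (avec q a)
/-- The `q`-symmetric trace-free projector. -/
def projS (q : Param) : Mat9 := 1 - projA q - projT q

/-- The braid matrix of `SO_q(3)`: `R̂ = q P_s - q⁻¹ P_a + q⁻² P_t`. -/
def braid (q : Param) : Mat9 :=
  qval q • projS q - (qval q)⁻¹ • projA q + ((qval q) ^ 2)⁻¹ • projT q

/-- The inverse of the braid matrix, see `braid_mul_braidInv`. -/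
def braidInv (q : Param) : Mat9 :=
  (qval q)⁻¹ • projS q - qval q • projA q + (qval q) ^ 2 • projT q

theorem sqrtq_ne_zero (q : Param) : sqrtq q ≠ 0 := by
  have := Real.sqrt_pos.2 q.2
  unfold sqrtq
  exact_mod_cast this.ne'

theorem qval_eq (q : Param) : qval q = sqrtq q ^ 2 := by
  have := Real.sq_sqrt q.2.le
  unfold qval sqrtq
  exact_mod_cast this.symm

theorem one_add_ne_zero (q : Param) : 1 + sqrtq q ^ 4 ≠ 0 := by
  have : 0 < 1 + Real.sqrt (q : ℝ) ^ 4 := by positivity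
  unfold sqrtq
  exact_mod_cast this.ne'

theorem trace_ne_zero (q : Param) : 1 + sqrtq q ^ 2 + sqrtq q ^ 4 ≠ 0 := by
  have : 0 < 1 + Real.sqrt (q : ℝ) ^ 2 + Real.sqrt (q : ℝ) ^ 4 := by positivity
  unfold sqrtq
  exact_mod_cast this.ne'

theorem rankOne_mul (m n : Matrix Idx Idx ℂ) (h : ∑ i, ∑ j, m i j * n i j = 0) :
    rankOne m * rankOne n = 0 := by
  ext p r
  simp only [rankOne, Matrix.mul_apply, Matrix.of_apply, Fintype.sum_prod_type, Matrix.zero_apply]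
  have : ∀ i j, m p.1 p.2 * m i j / (∑ i, ∑ j, m i j * m i j) *
      (n i j * n r.1 r.2 / ∑ i, ∑ j, n i j * n i j) =
      (m p.1 p.2 / (∑ i, ∑ j, m i j * m i j) * (n r.1 r.2 / ∑ i, ∑ j, n i j * n i j)) *
        (m i j * n i j) := by intros; ring
  simp only [this, ← Finset.mul_sum, h, mul_zero]

theorem rankOne_sq (m : Matrix Idx Idx ℂ) (h : ∑ i, ∑ j, m i j * m i j ≠ 0) :
    rankOne m * rankOne m = rankOne m := by
  ext p r
  simp only [rankOne, Matrix.mul_apply, Matrix.of_apply, Fintype.sum_prod_type]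
  generalize hS : ∑ i, ∑ j, m i j * m i j = S at h ⊢
  have : ∀ i j, m p.1 p.2 * m i j / S * (m i j * m r.1 r.2 / S) =
      (m p.1 p.2 / S * (m r.1 r.2 / S)) * (m i j * m i j) := by intros; ring
  simp only [this, ← Finset.mul_sum, hS]
  field_simp

theorem gmat_norm (q : Param) :
    ∑ i, ∑ j, gmat q i j * gmat q i j = (1 + sqrtq q ^ 2 + sqrtq q ^ 4) / sqrtq q ^ 2 := by
  have := sqrtq_ne_zero q
  simp [Fin.sum_univ_three, gmat]
  field_simp

theorem avec_norm (q : Param) (a : Fin 3) :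
    ∑ i, ∑ j, avec q a i j * avec q a i j =
      ![1 + sqrtq q ^ 4, (1 + sqrtq q ^ 4) / sqrtq q ^ 4, (1 + sqrtq q ^ 4) / sqrtq q ^ 2] a := by
  have := sqrtq_ne_zero q
  fin_cases a <;> simp [Fin.sum_univ_three, avec, hpar, qval_eq] <;> field_simp <;> ring

theorem gmat_avec (q : Param) (a : Fin 3) : ∑ i, ∑ j, gmat q i j * avec q a i j = 0 := by
  have := sqrtq_ne_zero q
  fin_cases a <;> simp [Fin.sum_univ_three, gmat, avec, hpar] <;> ring

theorem avec_avec (q : Param) (a b : Fin 3) (h : a ≠ b) :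
    ∑ i, ∑ j, avec q a i j * avec q b i j = 0 := by
  fin_cases a <;> fin_cases b <;> first | exact absurd rfl h | simp [Fin.sum_univ_three, avec]

theorem avec_norm_ne (q : Param) (a : Fin 3) : ∑ i, ∑ j, avec q a i j * avec q a i j ≠ 0 := by
  have h1 := sqrtq_ne_zero q
  have h2 := one_add_ne_zero q
  rw [avec_norm]
  fin_cases a <;> simp [h1, h2]

theorem projT_sq (q : Param) : projT q * projT q = projT q := by
  apply rankOne_sq
  rw [gmat_norm]
  exact div_ne_zero (trace_ne_zero q) (pow_ne_zero _ (sqrtq_ne_zero q))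

theorem projA_sq (q : Param) : projA q * projA q = projA q := by
  unfold projA
  rw [Finset.sum_mul]
  refine Finset.sum_congr rfl fun a _ => ?_
  rw [Finset.mul_sum, Finset.sum_eq_single a]
  · exact rankOne_sq _ (avec_norm_ne q a)
  · intro b _ hb
    exact rankOne_mul _ _ (avec_avec q a b hb.symm)
  · simp

theorem projA_projT (q : Param) : projA q * projT q = 0 := by
  unfold projA projT
  rw [Finset.sum_mul]
  refine Finset.sum_eq_zero fun a _ => rankOne_mul _ _ ?_
  simpa only [mul_comm] using gmat_avec q a

theorem projT_projA (q : Param) : projT q * projA q = 0 := by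
  unfold projA projT
  rw [Finset.mul_sum]
  exact Finset.sum_eq_zero fun a _ => rankOne_mul _ _ (gmat_avec q a)

theorem qval_ne_zero (q : Param) : qval q ≠ 0 := by
  rw [qval_eq]; exact pow_ne_zero _ (sqrtq_ne_zero q)

theorem braid_mul_braidInv (q : Param) : braid q * braidInv q = 1 := by
  have h0 := qval_ne_zero q
  simp only [braid, braidInv, projS, mul_add, add_mul, mul_sub, sub_mul, Matrix.smul_mul,
    Matrix.mul_smul, projA_sq, projT_sq, projA_projT, projT_projA, one_mul, mul_one, smul_sub,
    smul_zero, smul_smul]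
  match_scalars <;> field_simp <;> ring

theorem braidInv_mul_braid (q : Param) : braidInv q * braid q = 1 :=
  mul_eq_one_comm.1 (braid_mul_braidInv q)

/-- Explicit entries of the inverse braid matrix; `s` is `√q`. -/
def binvTable (s : ℂ) : Idx → Idx → Matrix Idx Idx ℂ :=
  ![![!![(s ^ 2)⁻¹, 0, 0; 0, 0, 0; 0, 0, 0],
      !![0, 0, 0; 1, 0, 0; 0, 0, 0],
      !![0, 0, 0; 0, 0, 0; s ^ 2, 0, 0]],
    ![!![0, 1, 0; (s ^ 2)⁻¹ - s ^ 2, 0, 0; 0, 0, 0],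
      !![0, 0, 0; 0, 1, 0; (s ^ 2 - (s ^ 2)⁻¹) * s, 0, 0],
      !![0, 0, 0; 0, 0, 0; 0, 1, 0]],
    ![!![0, 0, s ^ 2; 0, (s ^ 2 - (s ^ 2)⁻¹) * s, 0; (s ^ 2 - (s ^ 2)⁻¹) * (s ^ 2 - 1), 0, 0],
      !![0, 0, 0; 0, 0, 1; 0, (s ^ 2)⁻¹ - s ^ 2, 0],
      !![0, 0, 0; 0, 0, 0; 0, 0, (s ^ 2)⁻¹]]]

theorem binv_key (q : Param) (i j k l : Idx) : braidInv q (i, j) (k, l) =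
    ((qval q)⁻¹ • Matrix.single i j (1 : ℂ)
      - ((qval q + (qval q)⁻¹) * avec q 0 i j / (1 + sqrtq q ^ 4)) • avec q 0
      - ((qval q + (qval q)⁻¹) * avec q 1 i j / ((1 + sqrtq q ^ 4) / sqrtq q ^ 4)) • avec q 1
      - ((qval q + (qval q)⁻¹) * avec q 2 i j / ((1 + sqrtq q ^ 4) / sqrtq q ^ 2)) • avec q 2
      + ((qval q ^ 2 - (qval q)⁻¹) * gmat q i j /
          ((1 + sqrtq q ^ 2 + sqrtq q ^ 4) / sqrtq q ^ 2)) • gmat q) k l := by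
  have e : (1 : Mat9) (i, j) (k, l) = Matrix.single i j (1 : ℂ) k l := by
    simp [Matrix.one_apply, Matrix.single_apply]
  have h0 := avec_norm q 0
  have h1 := avec_norm q 1
  have h2 := avec_norm q 2
  simp only [Matrix.cons_val] at h0 h1 h2
  simp only [braidInv, projS, projA, projT, Matrix.add_apply, Matrix.sub_apply, Matrix.of_apply,
    Matrix.smul_apply, e, Matrix.sum_apply, rankOne, h0, h1, h2,
    gmat_norm, smul_eq_mul, Fin.sum_univ_three (fun a => _ / _)]
  ring

set_option maxHeartbeats 1000000 in
theorem braidInv_eq (q : Param) (i j k l : Idx) :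
    braidInv q (i, j) (k, l) = binvTable (sqrtq q) i j k l := by
  have h1 := sqrtq_ne_zero q
  have h2 := one_add_ne_zero q
  have h3 := trace_ne_zero q
  rw [binv_key]
  have hs : ∀ k l, Matrix.single i j (1 : ℂ) k l = if i = k ∧ j = l then 1 else 0 :=
    fun k l => by rw [Matrix.single_apply]
  simp only [Matrix.add_apply, Matrix.sub_apply, Matrix.smul_apply, hs, smul_eq_mul]
  clear hs
  simp only [qval_eq, hpar, avec, gmat, binvTable]
  generalize sqrtq q = s at *
  fin_cases i <;> fin_cases j <;> fin_cases k <;> fin_cases l <;>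
    simp only [Fin.zero_eta, Fin.mk_one, Fin.reduceFinMk, Matrix.of_apply, Matrix.cons_val,
      Matrix.cons_val', Matrix.cons_val_zero, Matrix.cons_val_one, Fin.reduceEq, and_true,
      and_false, and_self, if_true, if_false, mul_zero, zero_mul, mul_one, sub_zero, zero_sub,
      add_zero, zero_div, sub_self] <;>
    field_simp <;> ring


section Vectors

variable {B : Type} [Ring B] [Algebra ℂ B]

/-- `r² = g_{ij} x^i x^j`. -/
def radiusSq (q : Param) (x : Idx → B) : B := ∑ i, ∑ j, gmat q i j • (x i * x j)

/-- The elements `x^-, x^0, x^+` satisfy the quantum space relations and `ρ` is inverse to `r²`. -/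
structure IsQuantumVector (q : Param) (x : Idx → B) (ρ : B) : Prop where
  comm : ∀ a, ∑ i, ∑ j, avec q a i j • (x i * x j) = 0
  inv_mul : ρ * radiusSq q x = 1
  mul_inv : radiusSq q x * ρ = 1

/-- The matrix `T(x^l)` describing right multiplication of the basic 1-forms by `x^l`:
`ξ^k x^l = ∑ q⁻¹ (R̂⁻¹)^{kl}_{ij} x^i ξ^j`, that is `T(x^l)_{kj} = ∑_i q⁻¹ (R̂⁻¹)^{kl}_{ij} x^i`. -/
def rightMat (q : Param) (x : Idx → B) (l : Idx) : Matrix Idx Idx B :=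
  Matrix.of fun k j => ∑ i, ((qval q)⁻¹ * braidInv q (k, l) (i, j)) • x i

variable {q : Param} {x : Idx → B} {ρ : B}

theorem IsQuantumVector.rel0 (h : IsQuantumVector q x ρ) :
    x 0 * x 1 = sqrtq q ^ 2 • (x 1 * x 0) := by
  have := h.comm 0
  simp [Fin.sum_univ_three, avec, qval_eq] at this
  rw [← sub_eq_zero, sub_eq_add_neg]; simpa using this

theorem IsQuantumVector.rel1 (h : IsQuantumVector q x ρ) :
    x 2 * x 1 = (sqrtq q ^ 2)⁻¹ • (x 1 * x 2) := by
  have := h.comm 1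
  simp [Fin.sum_univ_three, avec, qval_eq] at this
  rw [← sub_eq_zero, ← this]; abel

theorem IsQuantumVector.rel2 (h : IsQuantumVector q x ρ) :
    x 2 * x 0 = x 0 * x 2 + (sqrtq q - (sqrtq q)⁻¹) • (x 1 * x 1) := by
  have := h.comm 2
  simp [Fin.sum_univ_three, avec, hpar] at this
  rw [← sub_eq_zero, ← this]; module

theorem rightMat_zero : rightMat q x 0 =
    !![((sqrtq q ^ 2)⁻¹ ^ 2) • x 0, 0, 0;
       ((sqrtq q ^ 2)⁻¹ ^ 2 - 1) • x 1, (sqrtq q ^ 2)⁻¹ • x 0, 0;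
       ((1 - (sqrtq q ^ 2)⁻¹ ^ 2) * (sqrtq q ^ 2 - 1)) • x 2,
         ((1 - (sqrtq q ^ 2)⁻¹ ^ 2) * sqrtq q) • x 1, x 0] := by
  have h1 := sqrtq_ne_zero q
  ext k j
  simp only [rightMat, braidInv_eq, qval_eq, binvTable, Matrix.of_apply, Fin.sum_univ_three]
  fin_cases k <;> fin_cases j <;>
    simp only [Fin.zero_eta, Fin.mk_one, Fin.reduceFinMk, Matrix.of_apply, Matrix.cons_val,
      Matrix.cons_val', Matrix.cons_val_zero, Matrix.cons_val_one, mul_zero, zero_smul, add_zero,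
      zero_add] <;>
    match_scalars <;> field_simp

theorem rightMat_one : rightMat q x 1 =
    !![(sqrtq q ^ 2)⁻¹ • x 1, 0, 0;
       ((1 - (sqrtq q ^ 2)⁻¹ ^ 2) * sqrtq q) • x 2, (sqrtq q ^ 2)⁻¹ • x 1, 0;
       0, ((sqrtq q ^ 2)⁻¹ ^ 2 - 1) • x 2, (sqrtq q ^ 2)⁻¹ • x 1] := by
  have h1 := sqrtq_ne_zero q
  ext k j
  simp only [rightMat, braidInv_eq, qval_eq, binvTable, Matrix.of_apply, Fin.sum_univ_three]
  fin_cases k <;> fin_cases j <;>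
    simp only [Fin.zero_eta, Fin.mk_one, Fin.reduceFinMk, Matrix.of_apply, Matrix.cons_val,
      Matrix.cons_val', Matrix.cons_val_zero, Matrix.cons_val_one, mul_zero, zero_smul, add_zero,
      zero_add] <;>
    match_scalars <;> field_simp

theorem rightMat_two : rightMat q x 2 =
    !![x 2, 0, 0;
       0, (sqrtq q ^ 2)⁻¹ • x 2, 0;
       0, 0, ((sqrtq q ^ 2)⁻¹ ^ 2) • x 2] := by
  have h1 := sqrtq_ne_zero q
  ext k j
  simp only [rightMat, braidInv_eq, qval_eq, binvTable, Matrix.of_apply, Fin.sum_univ_three]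
  fin_cases k <;> fin_cases j <;>
    simp only [Fin.zero_eta, Fin.mk_one, Fin.reduceFinMk, Matrix.of_apply, Matrix.cons_val,
      Matrix.cons_val', Matrix.cons_val_zero, Matrix.cons_val_one, mul_zero, zero_smul, add_zero,
      zero_add] <;>
    match_scalars <;> field_simp

theorem radiusSq_eq (h : IsQuantumVector q x ρ) : radiusSq q x =
    (sqrtq q + (sqrtq q)⁻¹) • (x 0 * x 2) + (sqrtq q ^ 2) • (x 1 * x 1) := by
  have h1 := sqrtq_ne_zero q
  simp [radiusSq, Fin.sum_univ_three, gmat, h.rel2]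
  match_scalars <;> field_simp <;> ring

set_option maxHeartbeats 4000000 in
theorem radiusSq_rightMat (h : IsQuantumVector q x ρ) :
    radiusSq q (rightMat q x) =
      Matrix.diagonal fun _ => ((qval q) ^ 2)⁻¹ • radiusSq q x := by
  have h1 := sqrtq_ne_zero q
  rw [radiusSq_eq h]
  simp only [radiusSq, rightMat_zero, rightMat_one, rightMat_two, Fin.sum_univ_three, gmat, qval_eq]
  ext k j
  fin_cases k <;> fin_cases j <;>
    simp only [Fin.zero_eta, Fin.mk_one, Fin.reduceFinMk, Matrix.of_apply, Matrix.cons_val,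
      Matrix.cons_val', Matrix.cons_val_zero, Matrix.cons_val_one, Matrix.mul_apply,
      Matrix.add_apply, Matrix.smul_apply, Matrix.zero_apply, Matrix.diagonal_apply,
      Fin.sum_univ_three, Fin.reduceEq, if_true, if_false, mul_zero, zero_mul,
      smul_zero, zero_smul, add_zero, zero_add, smul_mul_assoc, mul_smul_comm, smul_smul,
      smul_add, neg_smul, one_smul, h.rel0, h.rel1, h.rel2] <;>
    match_scalars <;> field_simp <;> ring

theorem comm_of_rels (h0 : x 0 * x 1 = sqrtq q ^ 2 • (x 1 * x 0))
    (h1 : x 2 * x 1 = (sqrtq q ^ 2)⁻¹ • (x 1 * x 2))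
    (h2 : x 2 * x 0 = x 0 * x 2 + (sqrtq q - (sqrtq q)⁻¹) • (x 1 * x 1)) (a : Fin 3) :
    ∑ i, ∑ j, avec q a i j • (x i * x j) = 0 := by
  fin_cases a <;> simp [Fin.sum_univ_three, avec, qval_eq, hpar, h0, h1, h2] <;> module

set_option maxHeartbeats 1000000 in
theorem rightMat_rel0 (h : IsQuantumVector q x ρ) :
    rightMat q x 0 * rightMat q x 1 = sqrtq q ^ 2 • (rightMat q x 1 * rightMat q x 0) := by
  have h1 := sqrtq_ne_zero q
  rw [rightMat_zero, rightMat_one]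
  ext k j
  fin_cases k <;> fin_cases j <;>
    simp only [Fin.zero_eta, Fin.mk_one, Fin.reduceFinMk, Matrix.of_apply, Matrix.cons_val,
      Matrix.cons_val', Matrix.cons_val_zero, Matrix.cons_val_one, Matrix.mul_apply,
      Matrix.add_apply, Matrix.smul_apply, Fin.sum_univ_three, mul_zero, zero_mul,
      smul_zero, zero_smul, add_zero, zero_add, smul_mul_assoc, mul_smul_comm, smul_smul,
      smul_add, h.rel0, h.rel1, h.rel2] <;>
    match_scalars <;> first | done | (field_simp; done) | (field_simp; ring) | ring

set_option maxHeartbeats 1000000 in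
theorem rightMat_rel1 (h : IsQuantumVector q x ρ) :
    rightMat q x 2 * rightMat q x 1 =
      (sqrtq q ^ 2)⁻¹ • (rightMat q x 1 * rightMat q x 2) := by
  have h1 := sqrtq_ne_zero q
  rw [rightMat_two, rightMat_one]
  ext k j
  fin_cases k <;> fin_cases j <;>
    simp only [Fin.zero_eta, Fin.mk_one, Fin.reduceFinMk, Matrix.of_apply, Matrix.cons_val,
      Matrix.cons_val', Matrix.cons_val_zero, Matrix.cons_val_one, Matrix.mul_apply,
      Matrix.add_apply, Matrix.smul_apply, Fin.sum_univ_three, mul_zero, zero_mul,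
      smul_zero, zero_smul, add_zero, zero_add, smul_mul_assoc, mul_smul_comm, smul_smul,
      smul_add, h.rel0, h.rel1, h.rel2] <;>
    match_scalars <;> first | done | (field_simp; done) | (field_simp; ring) | ring

set_option maxHeartbeats 1000000 in
theorem rightMat_rel2 (h : IsQuantumVector q x ρ) :
    rightMat q x 2 * rightMat q x 0 = rightMat q x 0 * rightMat q x 2 +
      (sqrtq q - (sqrtq q)⁻¹) • (rightMat q x 1 * rightMat q x 1) := by
  have h1 := sqrtq_ne_zero q
  rw [rightMat_zero, rightMat_one, rightMat_two]
  ext k j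
  fin_cases k <;> fin_cases j <;>
    simp only [Fin.zero_eta, Fin.mk_one, Fin.reduceFinMk, Matrix.of_apply, Matrix.cons_val,
      Matrix.cons_val', Matrix.cons_val_zero, Matrix.cons_val_one, Matrix.mul_apply,
      Matrix.add_apply, Matrix.smul_apply, Fin.sum_univ_three, mul_zero, zero_mul,
      smul_zero, zero_smul, add_zero, zero_add, smul_mul_assoc, mul_smul_comm, smul_smul,
      smul_add, h.rel0, h.rel1, h.rel2] <;>
    match_scalars <;> first | done | (field_simp; done) | (field_simp; ring) | ring

theorem IsQuantumVector.rightMat (h : IsQuantumVector q x ρ) :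
    IsQuantumVector q (rightMat q x) (Matrix.diagonal fun _ => (qval q) ^ 2 • ρ) where
  comm := comm_of_rels (rightMat_rel0 h) (rightMat_rel1 h) (rightMat_rel2 h)
  inv_mul := by
    have h1 := qval_ne_zero q
    rw [radiusSq_rightMat h, Matrix.diagonal_mul_diagonal]
    simp [h.inv_mul, smul_smul, h1]
  mul_inv := by
    have h1 := qval_ne_zero q
    rw [radiusSq_rightMat h, Matrix.diagonal_mul_diagonal]
    simp [h.mul_inv, smul_smul, h1]

end Vectors

section Algebras

/-- Generators `x^i` and `r⁻²`. -/
inductive Gen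
  | x (i : Idx)
  | rinv

def freeX (i : Idx) : FreeAlgebra ℂ Gen := FreeAlgebra.ι ℂ (Gen.x i)
def freeRinv : FreeAlgebra ℂ Gen := FreeAlgebra.ι ℂ Gen.rinv

inductive SpaceRel (q : Param) : FreeAlgebra ℂ Gen → FreeAlgebra ℂ Gen → Prop
  | comm (a : Fin 3) : SpaceRel q (∑ i, ∑ j, avec q a i j • (freeX i * freeX j)) 0
  | inv_mul : SpaceRel q (freeRinv * radiusSq q freeX) 1
  | mul_inv : SpaceRel q (radiusSq q freeX * freeRinv) 1

/-- The algebra of functions on the quantum Euclidean space: generated over `ℂ` by `x^-, x^0, x^+` and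
the inverse `r⁻²` of the (central) element `r²`, which is needed in the Dirac operator. -/
def Space (q : Param) : Type := RingQuot (SpaceRel q)

instance (q : Param) : Ring (Space q) := inferInstanceAs (Ring (RingQuot (SpaceRel q)))
instance (q : Param) : Algebra ℂ (Space q) :=
  inferInstanceAs (Algebra ℂ (RingQuot (SpaceRel q)))

namespace Space

def mk (q : Param) : FreeAlgebra ℂ Gen →ₐ[ℂ] Space q := RingQuot.mkAlgHom ℂ (SpaceRel q)
def x (q : Param) (i : Idx) : Space q := mk q (freeX i)
def rinv (q : Param) : Space q := mk q freeRinv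

theorem map_radiusSq {B C : Type} [Ring B] [Algebra ℂ B] [Ring C] [Algebra ℂ C] (f : B →ₐ[ℂ] C)
    (q : Param) (y : Idx → B) : f (radiusSq q y) = radiusSq q (fun i => f (y i)) := by
  simp [radiusSq]

theorem isQuantumVector (q : Param) : IsQuantumVector q (x q) (rinv q) where
  comm a := by
    have : mk q _ = mk q 0 := RingQuot.mkAlgHom_rel ℂ (SpaceRel.comm (q := q) a)
    simpa [x] using this
  inv_mul := by
    have := RingQuot.mkAlgHom_rel ℂ (SpaceRel.inv_mul (q := q))
    rw [map_mul, map_radiusSq, map_one] at this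
    exact this
  mul_inv := by
    have := RingQuot.mkAlgHom_rel ℂ (SpaceRel.mul_inv (q := q))
    rw [map_mul, map_radiusSq, map_one] at this
    exact this

variable {B : Type} [Ring B] [Algebra ℂ B] {q : Param} {y : Idx → B} {ρ : B}

/-- Universal property of the quantum space algebra. -/
def lift (h : IsQuantumVector q y ρ) : Space q →ₐ[ℂ] B :=
  RingQuot.liftAlgHom ℂ ⟨FreeAlgebra.lift ℂ fun
    | Gen.x i => y i
    | Gen.rinv => ρ, by
      have hx : ∀ i, FreeAlgebra.lift ℂ (fun | Gen.x i => y i | Gen.rinv => ρ) (freeX i) = y i :=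
        fun i => by simp [freeX]
      have hr : FreeAlgebra.lift ℂ (fun | Gen.x i => y i | Gen.rinv => ρ) freeRinv = ρ := by
        simp [freeRinv]
      rintro _ _ (a | _ | _)
      · simpa [hx] using h.comm a
      · simpa [map_radiusSq, hx, hr] using h.inv_mul
      · simpa [map_radiusSq, hx, hr] using h.mul_inv⟩

theorem lift_x (h : IsQuantumVector q y ρ) (i : Idx) : lift h (x q i) = y i := by
  simp only [lift, x, mk]
  erw [RingQuot.liftAlgHom_mkAlgHom_apply]
  simp [freeX]

theorem lift_rinv (h : IsQuantumVector q y ρ) : lift h (rinv q) = ρ := by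
  simp only [lift, rinv, mk]
  erw [RingQuot.liftAlgHom_mkAlgHom_apply]
  simp [freeRinv]

theorem hom_ext {f g : Space q →ₐ[ℂ] B} (hx : ∀ i, f (x q i) = g (x q i))
    (hr : f (rinv q) = g (rinv q)) : f = g := by
  apply RingQuot.ringQuot_ext'
  apply FreeAlgebra.hom_ext
  funext a
  cases a with
  | x i => exact hx i
  | rinv => exact hr

end Space

/-- Generators `x^i`, `r⁻²`, `Λ`, `Λ⁻¹`. -/
inductive ExtGen
  | x (i : Idx)
  | rinv
  | dil
  | dilInv

def extFreeX (i : Idx) : FreeAlgebra ℂ ExtGen := FreeAlgebra.ι ℂ (ExtGen.x i)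
def extFreeRinv : FreeAlgebra ℂ ExtGen := FreeAlgebra.ι ℂ ExtGen.rinv
def extFreeDil : FreeAlgebra ℂ ExtGen := FreeAlgebra.ι ℂ ExtGen.dil
def extFreeDilInv : FreeAlgebra ℂ ExtGen := FreeAlgebra.ι ℂ ExtGen.dilInv

inductive ExtSpaceRel (q : Param) : FreeAlgebra ℂ ExtGen → FreeAlgebra ℂ ExtGen → Prop
  | comm (a : Fin 3) : ExtSpaceRel q (∑ i, ∑ j, avec q a i j • (extFreeX i * extFreeX j)) 0
  | inv_mul : ExtSpaceRel q (extFreeRinv * radiusSq q extFreeX) 1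
  | mul_inv : ExtSpaceRel q (radiusSq q extFreeX * extFreeRinv) 1
  | x_dil (i : Idx) : ExtSpaceRel q (extFreeX i * extFreeDil) (qval q • (extFreeDil * extFreeX i))
  | dil_mul : ExtSpaceRel q (extFreeDil * extFreeDilInv) 1
  | mul_dil : ExtSpaceRel q (extFreeDilInv * extFreeDil) 1

/-- The quantum space algebra extended by the dilatation `Λ` and its inverse, `x^i Λ = q Λ x^i`. -/
def ExtSpace (q : Param) : Type := RingQuot (ExtSpaceRel q)

instance (q : Param) : Ring (ExtSpace q) := inferInstanceAs (Ring (RingQuot (ExtSpaceRel q)))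
instance (q : Param) : Algebra ℂ (ExtSpace q) :=
  inferInstanceAs (Algebra ℂ (RingQuot (ExtSpaceRel q)))

namespace ExtSpace

def mk (q : Param) : FreeAlgebra ℂ ExtGen →ₐ[ℂ] ExtSpace q :=
  RingQuot.mkAlgHom ℂ (ExtSpaceRel q)
def x (q : Param) (i : Idx) : ExtSpace q := mk q (extFreeX i)
def rinv (q : Param) : ExtSpace q := mk q extFreeRinv
def dil (q : Param) : ExtSpace q := mk q extFreeDil
def dilInv (q : Param) : ExtSpace q := mk q extFreeDilInv

theorem isQuantumVector (q : Param) : IsQuantumVector q (x q) (rinv q) where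
  comm a := by
    have : mk q _ = mk q 0 := RingQuot.mkAlgHom_rel ℂ (ExtSpaceRel.comm (q := q) a)
    simpa [x] using this
  inv_mul := by
    have := RingQuot.mkAlgHom_rel ℂ (ExtSpaceRel.inv_mul (q := q))
    rw [map_mul, Space.map_radiusSq, map_one] at this
    exact this
  mul_inv := by
    have := RingQuot.mkAlgHom_rel ℂ (ExtSpaceRel.mul_inv (q := q))
    rw [map_mul, Space.map_radiusSq, map_one] at this
    exact this

theorem x_mul_dil (q : Param) (i : Idx) : x q i * dil q = qval q • (dil q * x q i) := by
  have := RingQuot.mkAlgHom_rel ℂ (ExtSpaceRel.x_dil (q := q) i)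
  rw [map_mul, map_smul, map_mul] at this
  exact this

theorem dil_mul_dilInv (q : Param) : dil q * dilInv q = 1 := by
  have := RingQuot.mkAlgHom_rel ℂ (ExtSpaceRel.dil_mul (q := q))
  rw [map_mul, map_one] at this
  exact this

theorem dilInv_mul_dil (q : Param) : dilInv q * dil q = 1 := by
  have := RingQuot.mkAlgHom_rel ℂ (ExtSpaceRel.mul_dil (q := q))
  rw [map_mul, map_one] at this
  exact this

variable {B : Type} [Ring B] [Algebra ℂ B] {q : Param} {y : Idx → B} {ρ l l' : B}

def lift (h : IsQuantumVector q y ρ) (hl : ∀ i, y i * l = qval q • (l * y i))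
    (h1 : l * l' = 1) (h2 : l' * l = 1) : ExtSpace q →ₐ[ℂ] B :=
  RingQuot.liftAlgHom ℂ ⟨FreeAlgebra.lift ℂ fun
    | ExtGen.x i => y i
    | ExtGen.rinv => ρ
    | ExtGen.dil => l
    | ExtGen.dilInv => l', by
      rintro _ _ (a | _ | _ | i | _ | _)
      · simpa [extFreeX] using h.comm a
      · simpa [Space.map_radiusSq, extFreeX, extFreeRinv] using h.inv_mul
      · simpa [Space.map_radiusSq, extFreeX, extFreeRinv] using h.mul_inv
      · simpa [extFreeX, extFreeDil] using hl i
      · simpa [extFreeDil, extFreeDilInv] using h1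
      · simpa [extFreeDil, extFreeDilInv] using h2⟩

theorem lift_x (h : IsQuantumVector q y ρ) (hl : ∀ i, y i * l = qval q • (l * y i))
    (h1 : l * l' = 1) (h2 : l' * l = 1) (i : Idx) : lift h hl h1 h2 (x q i) = y i := by
  simp only [lift, x, mk]
  erw [RingQuot.liftAlgHom_mkAlgHom_apply]
  simp [extFreeX]

theorem lift_rinv (h : IsQuantumVector q y ρ) (hl : ∀ i, y i * l = qval q • (l * y i))
    (h1 : l * l' = 1) (h2 : l' * l = 1) : lift h hl h1 h2 (rinv q) = ρ := by
  simp only [lift, rinv, mk]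
  erw [RingQuot.liftAlgHom_mkAlgHom_apply]
  simp [extFreeRinv]

end ExtSpace

/-- The canonical homomorphism from the quantum space algebra to its extension by `Λ`. -/
def toExt (q : Param) : Space q →ₐ[ℂ] ExtSpace q := Space.lift (ExtSpace.isQuantumVector q)

/-- The homomorphism `T` with `ξ^k f = ∑_j T(f)_{kj} ξ^j`. -/
def twist (q : Param) : Space q →ₐ[ℂ] Matrix Idx Idx (Space q) :=
  Space.lift (Space.isQuantumVector q).rightMat

theorem rightMat_mul_dil (q : Param) (l : Idx) :
    rightMat q (ExtSpace.x q) l * (Matrix.diagonal fun _ => qval q • ExtSpace.dil q) =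
      qval q • ((Matrix.diagonal fun _ => qval q • ExtSpace.dil q) *
        rightMat q (ExtSpace.x q) l) := by
  ext k j
  simp [Matrix.mul_diagonal, Matrix.diagonal_mul, rightMat, Finset.sum_mul, Finset.mul_sum,
    ExtSpace.x_mul_dil, Finset.smul_sum, smul_smul]

/-- The same for the extended algebra, with `ξ^k Λ = q Λ ξ^k` (from `dΛ = 0`). -/
def twistExt (q : Param) : ExtSpace q →ₐ[ℂ] Matrix Idx Idx (ExtSpace q) :=
  ExtSpace.lift (ExtSpace.isQuantumVector q).rightMat (rightMat_mul_dil q)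
    (l' := Matrix.diagonal fun _ => (qval q)⁻¹ • ExtSpace.dilInv q)
    (by
      have := qval_ne_zero q
      simp [Matrix.diagonal_mul_diagonal, ExtSpace.dil_mul_dilInv, smul_smul, this])
    (by
      have := qval_ne_zero q
      simp [Matrix.diagonal_mul_diagonal, ExtSpace.dilInv_mul_dil, smul_smul, this])

theorem twistExt_toExt (q : Param) (a : Space q) :
    twistExt q (toExt q a) = (twist q a).map (toExt q) := by
  have : (twistExt q).comp (toExt q) = ((toExt q).mapMatrix).comp (twist q) := by
    apply Space.hom_ext
    · intro i
      simp only [AlgHom.comp_apply, toExt, twist, twistExt, Space.lift_x, ExtSpace.lift_x]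
      ext k j
      simp [rightMat, Space.lift_x]
    · simp only [AlgHom.comp_apply, toExt, twist, twistExt, Space.lift_rinv, ExtSpace.lift_rinv]
      ext k j
      by_cases h : k = j <;> simp [h, Matrix.diagonal, Space.lift_rinv]
  exact DFunLike.congr_fun this a

end Algebras

section Bimodules

set_option linter.unusedSectionVars false

variable (B : Type) [Ring B]

section Balanced

variable (M N : Type) [AddCommGroup M] [Module ℂ M] [Module Bᵐᵒᵖ M]
  [AddCommGroup N] [Module ℂ N] [Module B N]

/-- The subspace spanned by the elements `m b ⊗ n - m ⊗ b n`. -/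
def balanced : Submodule ℂ (M ⊗[ℂ] N) :=
  Submodule.span ℂ {t | ∃ (m : M) (b : B) (n : N), t = (op b • m) ⊗ₜ[ℂ] n - m ⊗ₜ[ℂ] (b • n)}

/-- The tensor product over the noncommutative ring `B` of a right module `M` and a left module `N`.
A right module over `B` is a module over `Bᵐᵒᵖ`, and `m b` is written `op b • m`. -/
def BTensor : Type := (M ⊗[ℂ] N) ⧸ balanced B M N

instance : AddCommGroup (BTensor B M N) :=
  inferInstanceAs (AddCommGroup ((M ⊗[ℂ] N) ⧸ balanced B M N))
instance : Module ℂ (BTensor B M N) :=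
  inferInstanceAs (Module ℂ ((M ⊗[ℂ] N) ⧸ balanced B M N))

namespace BTensor

variable {M N} {Q : Type} [AddCommGroup Q] [Module ℂ Q]

def tmulBil : M →ₗ[ℂ] N →ₗ[ℂ] BTensor B M N :=
  (TensorProduct.mk ℂ M N).compr₂ (balanced B M N).mkQ

def tmul (m : M) (n : N) : BTensor B M N := tmulBil B m n

theorem smul_tmul_eq (m : M) (b : B) (n : N) : tmul B (op b • m) n = tmul B m (b • n) := by
  refine (Submodule.Quotient.eq _).2 ?_
  exact Submodule.subset_span ⟨m, b, n, rfl⟩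

variable {B}

/-- A bilinear map with `f (m b) n = f m (b n)` factors through the tensor product over `B`. -/
def lift (f : M →ₗ[ℂ] N →ₗ[ℂ] Q)
    (hf : ∀ m (b : B) n, f (op b • m) n = f m (b • n)) : BTensor B M N →ₗ[ℂ] Q :=
  (balanced B M N).liftQ (TensorProduct.lift f) (by
    refine Submodule.span_le.2 ?_
    rintro _ ⟨m, b, n, rfl⟩
    simp [hf])

theorem lift_tmul (f : M →ₗ[ℂ] N →ₗ[ℂ] Q)
    (hf : ∀ m (b : B) n, f (op b • m) n = f m (b • n)) (m : M) (n : N) :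
    lift f hf (tmul B m n) = f m n := rfl

theorem hom_ext {f g : BTensor B M N →ₗ[ℂ] Q}
    (h : ∀ m n, f (tmul B m n) = g (tmul B m n)) : f = g := by
  refine Submodule.linearMap_qext _ ?_
  exact TensorProduct.ext' h

end BTensor
end Balanced

variable [Algebra ℂ B]

section Actions

variable (M N : Type)
  [AddCommGroup M] [Module ℂ M] [Module B M] [Module Bᵐᵒᵖ M] [SMulCommClass B Bᵐᵒᵖ M]
  [IsScalarTower ℂ B M] [IsScalarTower ℂ Bᵐᵒᵖ M]
  [AddCommGroup N] [Module ℂ N] [Module B N] [Module Bᵐᵒᵖ N] [SMulCommClass B Bᵐᵒᵖ N]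
  [IsScalarTower ℂ B N] [IsScalarTower ℂ Bᵐᵒᵖ N]

namespace BTensor

def leftAct : B →ₐ[ℂ] Module.End ℂ (BTensor B M N) :=
  AlgHom.ofLinearMap
    { toFun := fun b => lift ((tmulBil B).comp (Algebra.lsmul ℂ ℂ M b)) (by
        intro m c n
        change tmul B (b • op c • m) n = tmul B (b • m) (c • n)
        rw [smul_comm, smul_tmul_eq])
      map_add' := fun b c => hom_ext fun m n => by
        simp [lift_tmul]
      map_smul' := fun b c => hom_ext fun m n => by
        simp [lift_tmul] }
    (hom_ext fun m n => by
      change tmul B ((1 : B) • m) n = tmul B m n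
      rw [one_smul])
    (fun b c => hom_ext fun m n => by
      change tmul B ((b * c) • m) n = tmul B (b • c • m) n
      rw [mul_smul])

def rightAct : Bᵐᵒᵖ →ₐ[ℂ] Module.End ℂ (BTensor B M N) :=
  AlgHom.ofLinearMap
    { toFun := fun b => lift ((tmulBil B).compl₂ (Algebra.lsmul ℂ ℂ N b)) (by
        intro m c n
        change tmul B (op c • m) (b • n) = tmul B m (b • c • n)
        rw [smul_tmul_eq, smul_comm])
      map_add' := fun b c => hom_ext fun m n => by
        simp [lift_tmul]
      map_smul' := fun b c => hom_ext fun m n => by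
        simp [lift_tmul] }
    (hom_ext fun m n => by
      change tmul B m ((1 : Bᵐᵒᵖ) • n) = tmul B m n
      rw [one_smul])
    (fun b c => hom_ext fun m n => by
      change tmul B m ((b * c) • n) = tmul B m (b • c • n)
      rw [mul_smul])

instance : Module B (BTensor B M N) := Module.compHom _ (leftAct B M N).toRingHom
instance : Module Bᵐᵒᵖ (BTensor B M N) := Module.compHom _ (rightAct B M N).toRingHom

variable {M N}

theorem smul_tmul (b : B) (m : M) (n : N) : b • tmul B m n = tmul B (b • m) n := rfl

theorem op_smul_tmul (b : Bᵐᵒᵖ) (m : M) (n : N) : b • tmul B m n = tmul B m (b • n) := rfl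

theorem smul_def (b : B) (t : BTensor B M N) : b • t = leftAct B M N b t := rfl

theorem op_smul_def (b : Bᵐᵒᵖ) (t : BTensor B M N) : b • t = rightAct B M N b t := rfl

instance : SMulCommClass B Bᵐᵒᵖ (BTensor B M N) where
  smul_comm b c t := by
    have : leftAct B M N b ∘ₗ rightAct B M N c = rightAct B M N c ∘ₗ leftAct B M N b :=
      hom_ext fun m n => rfl
    exact LinearMap.congr_fun this t

instance : IsScalarTower ℂ B (BTensor B M N) where
  smul_assoc z b t := by
    rw [smul_def, map_smul]
    rfl

instance : IsScalarTower ℂ Bᵐᵒᵖ (BTensor B M N) where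
  smul_assoc z b t := by
    rw [op_smul_def, map_smul]
    rfl

end BTensor

/-- A homomorphism of `B`-bimodules. -/
structure BimodHom extends M →ₗ[ℂ] N where
  map_left : ∀ (b : B) (m : M), toFun (b • m) = b • toFun m
  map_right : ∀ (b : B) (m : M), toFun (op b • m) = op b • toFun m

end Actions

namespace BTensor

variable {B} {M N P : Type}
  [AddCommGroup M] [Module ℂ M] [Module B M] [Module Bᵐᵒᵖ M] [SMulCommClass B Bᵐᵒᵖ M]
  [IsScalarTower ℂ B M] [IsScalarTower ℂ Bᵐᵒᵖ M]
  [AddCommGroup N] [Module ℂ N] [Module B N] [Module Bᵐᵒᵖ N] [SMulCommClass B Bᵐᵒᵖ N]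
  [IsScalarTower ℂ B N] [IsScalarTower ℂ Bᵐᵒᵖ N]
  [AddCommGroup P] [Module ℂ P] [Module B P] [Module Bᵐᵒᵖ P] [SMulCommClass B Bᵐᵒᵖ P]
  [IsScalarTower ℂ B P] [IsScalarTower ℂ Bᵐᵒᵖ P]

def mapLeft (f : BimodHom B M M) : BTensor B M N →ₗ[ℂ] BTensor B M N :=
  lift ((tmulBil B).comp f.toLinearMap) (by
    intro m b n
    change tmul B (f.toFun (op b • m)) n = tmul B (f.toFun m) (b • n)
    rw [f.map_right, smul_tmul_eq])

def mapRight (f : BimodHom B N N) : BTensor B M N →ₗ[ℂ] BTensor B M N :=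
  lift ((tmulBil B).compl₂ f.toLinearMap) (by
    intro m b n
    change tmul B (op b • m) (f.toFun n) = tmul B m (f.toFun (b • n))
    rw [f.map_left, smul_tmul_eq])

variable (B M N P)

def assoc : BTensor B (BTensor B M N) P →ₗ[ℂ] BTensor B M (BTensor B N P) :=
  lift
    (lift (LinearMap.mk₂ ℂ (fun m n => (tmulBil B m) ∘ₗ (tmulBil B n))
      (by intros; ext; simp) (by intros; ext; simp) (by intros; ext; simp)
      (by intros; ext; simp))
      (by
        intro m b n
        ext p
        change tmul B (op b • m) (tmul B n p) = tmul B m (tmul B (b • n) p)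
        rw [smul_tmul_eq, smul_tmul]))
    (by
      intro t b p
      refine LinearMap.congr_fun (f := (LinearMap.flip _ p) ∘ₗ rightAct B M N (op b))
        (g := LinearMap.flip _ (b • p)) ?_ t
      refine hom_ext fun m n => ?_
      change tmul B m (tmul B (op b • n) p) = tmul B m (tmul B n (b • p))
      rw [smul_tmul_eq])

variable {M} in
def assocInvAux (m : M) : BTensor B N P →ₗ[ℂ] BTensor B (BTensor B M N) P :=
  lift ((tmulBil B).comp (tmulBil B m)) (by
    intro n b p
    change tmul B (tmul B m (op b • n)) p = tmul B (tmul B m n) (b • p)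
    rw [← op_smul_tmul, smul_tmul_eq])

def assocInv : BTensor B M (BTensor B N P) →ₗ[ℂ] BTensor B (BTensor B M N) P :=
  lift
    { toFun := assocInvAux B N P
      map_add' := fun m m' => hom_ext fun n p => by
        change tmulBil B (tmulBil B (m + m') n) p =
          tmulBil B (tmulBil B m n) p + tmulBil B (tmulBil B m' n) p
        simp
      map_smul' := fun z m => hom_ext fun n p => by
        change tmulBil B (tmulBil B (z • m) n) p = z • tmulBil B (tmulBil B m n) p
        simp }
    (by
      intro m b t
      refine LinearMap.congr_fun (f := assocInvAux B N P (op b • m))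
        (g := assocInvAux B N P m ∘ₗ leftAct B N P b) ?_ t
      refine hom_ext fun n p => ?_
      change tmul B (tmul B (op b • m) n) p = tmul B (tmul B m (b • n)) p
      rw [smul_tmul_eq])

variable {B M N P}

theorem assoc_tmul (m : M) (n : N) (p : P) :
    assoc B M N P (tmul B (tmul B m n) p) = tmul B m (tmul B n p) := rfl

theorem assocInv_tmul (m : M) (n : N) (p : P) :
    assocInv B M N P (tmul B m (tmul B n p)) = tmul B (tmul B m n) p := rfl

end BTensor

section Connections

variable {B} {M : Type}
  [AddCommGroup M] [Module ℂ M] [Module B M] [Module Bᵐᵒᵖ M] [SMulCommClass B Bᵐᵒᵖ M]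
  [IsScalarTower ℂ B M] [IsScalarTower ℂ Bᵐᵒᵖ M]

/-- A linear connection for `d : B → Ω¹`: a map `D` together with a bilinear generalized flip `σ`,
satisfying the left and right Leibniz rules. -/
structure LinearConnection (d : B →ₗ[ℂ] M) where
  D : M →ₗ[ℂ] BTensor B M M
  σ : BimodHom B (BTensor B M M) (BTensor B M M)
  leibniz_left : ∀ (f : B) (ω : M), D (f • ω) = BTensor.tmul B (d f) ω + f • D ω
  leibniz_right : ∀ (f : B) (ω : M),
    D (op f • ω) = σ.toLinearMap (BTensor.tmul B ω (d f)) + op f • D ω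

/-- `σ₁₂ = σ ⊗ 1` on the triple tensor product. -/
def flip12 (σ : BimodHom B (BTensor B M M) (BTensor B M M)) :
    BTensor B M (BTensor B M M) →ₗ[ℂ] BTensor B M (BTensor B M M) :=
  BTensor.assoc B M M M ∘ₗ BTensor.mapLeft σ ∘ₗ BTensor.assocInv B M M M

/-- `σ₂₃ = 1 ⊗ σ` on the triple tensor product. -/
def flip23 (σ : BimodHom B (BTensor B M M) (BTensor B M M)) :
    BTensor B M (BTensor B M M) →ₗ[ℂ] BTensor B M (BTensor B M M) :=
  BTensor.mapRight σ

/-- The braid equation. -/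
def IsBraid (σ : BimodHom B (BTensor B M M) (BTensor B M M)) : Prop :=
  flip12 σ ∘ₗ flip23 σ ∘ₗ flip12 σ = flip23 σ ∘ₗ flip12 σ ∘ₗ flip23 σ

/-- `D₂(ω ⊗ η) = Dω ⊗ η + σ₁₂(ω ⊗ Dη)`. -/
def LinearConnection.D₂ {d : B →ₗ[ℂ] M} (C : LinearConnection d) (ω η : M) :
    BTensor B M (BTensor B M M) :=
  BTensor.assoc B M M M (BTensor.tmul B (C.D ω) η) + flip12 C.σ (BTensor.tmul B ω (C.D η))

end Connections
end Bimodules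

section Calculus

section FormsDef

variable {B : Type} [Ring B] [Algebra ℂ B] (T : B →ₐ[ℂ] Matrix Idx Idx B)

/-- The free left module on `ξ^-, ξ^0, ξ^+`, an element `∑ ω_j ξ^j` being stored as `j ↦ ω_j`, with right
multiplication determined by `ξ^k b = ∑_j T(b)_{kj} ξ^j`. -/
def Forms (_T : B →ₐ[ℂ] Matrix Idx Idx B) : Type := Idx → B

instance : AddCommGroup (Forms T) := inferInstanceAs (AddCommGroup (Idx → B))
instance : Module ℂ (Forms T) := inferInstanceAs (Module ℂ (Idx → B))
instance : Module B (Forms T) := inferInstanceAs (Module B (Idx → B))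

def Forms.rightAct (b : B) (ω : Forms T) : Forms T := fun j => ∑ i, ω i * T b i j

instance : Module Bᵐᵒᵖ (Forms T) where
  smul b ω := Forms.rightAct T b.unop ω
  one_smul ω := by
    funext j
    change ∑ i, ω i * T 1 i j = ω j
    simp only [map_one, Matrix.one_apply, mul_ite, mul_one, mul_zero]
    exact (Finset.sum_ite_eq' Finset.univ j ω).trans (if_pos (Finset.mem_univ j))
  mul_smul b c ω := by
    funext j
    change ∑ i, ω i * T (c.unop * b.unop) i j = ∑ i, (∑ k, ω k * T c.unop k i) * T b.unop i j
    simp only [map_mul, Matrix.mul_apply, Finset.mul_sum, Finset.sum_mul, mul_assoc]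
    exact Finset.sum_comm
  smul_zero b := by
    funext j
    change ∑ i, (0 : B) * T b.unop i j = 0
    simp
  smul_add b ω η := by
    funext j
    change ∑ i, (ω i + η i) * T b.unop i j = ∑ i, ω i * T b.unop i j + ∑ i, η i * T b.unop i j
    simp [add_mul, Finset.sum_add_distrib]
  add_smul b c ω := by
    funext j
    change ∑ i, ω i * T (b.unop + c.unop) i j =
      ∑ i, ω i * T b.unop i j + ∑ i, ω i * T c.unop i j
    simp [mul_add, Finset.sum_add_distrib]
  zero_smul ω := by
    funext j
    change ∑ i, ω i * T 0 i j = 0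
    simp

theorem Forms.op_smul_apply (b : B) (ω : Forms T) (j : Idx) :
    (op b • ω) j = ∑ i, ω i * T b i j := rfl

theorem Forms.smul_apply (b : B) (ω : Forms T) (j : Idx) : (b • ω) j = b * ω j := rfl

theorem Forms.complex_smul_apply (z : ℂ) (ω : Forms T) (j : Idx) : (z • ω) j = z • ω j := rfl

theorem Forms.add_apply (ω η : Forms T) (j : Idx) : (ω + η) j = ω j + η j := rfl

theorem Forms.sum_apply {ι : Type} (s : Finset ι) (f : ι → Forms T) (j : Idx) :
    (∑ i ∈ s, f i) j = ∑ i ∈ s, f i j := Finset.sum_apply j s f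

instance : SMulCommClass B Bᵐᵒᵖ (Forms T) where
  smul_comm b c ω := by
    funext j
    change b * ∑ i, ω i * T c.unop i j = ∑ i, (b * ω i) * T c.unop i j
    simp [Finset.mul_sum, mul_assoc]

instance : IsScalarTower ℂ B (Forms T) :=
  inferInstanceAs (IsScalarTower ℂ B (Idx → B))

instance : IsScalarTower ℂ Bᵐᵒᵖ (Forms T) where
  smul_assoc z b ω := by
    funext j
    change ∑ i, ω i * T (z • b.unop) i j = z • ∑ i, ω i * T b.unop i j
    simp [Finset.smul_sum]

def Forms.xi (i : Idx) : Forms T := Pi.single i (1 : B)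

theorem Forms.xi_apply (i j : Idx) : Forms.xi T i j = if j = i then 1 else 0 :=
  Pi.single_apply i (1 : B) j

theorem Forms.op_smul_xi_apply (b : B) (i j : Idx) : (op b • Forms.xi T i) j = T b i j := by
  simp [Forms.op_smul_apply, Forms.xi_apply]

end FormsDef

/-- The bimodule of 1-forms: free as a left module on the `ξ^i`, with commutation relations
`x^i ξ^j = q R̂^{ij}_{kl} ξ^k x^l`, see `x_smul_xi`. -/
abbrev Omega1 (q : Param) : Type := Forms (twist q)

def xi (q : Param) (i : Idx) : Omega1 q := Forms.xi (twist q) i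

theorem twist_x (q : Param) (l k j : Idx) :
    twist q (Space.x q l) k j = ∑ i, ((qval q)⁻¹ * braidInv q (k, l) (i, j)) • Space.x q i := by
  simp [twist, Space.lift_x, rightMat]

/-- The commutation relations `x^i ξ^j = q R̂^{ij}_{kl} ξ^k x^l`. -/
theorem x_smul_xi (q : Param) (i j : Idx) :
    Space.x q i • xi q j =
      ∑ k, ∑ l, (qval q * braid q (i, j) (k, l)) • op (Space.x q l) • xi q k := by
  have h0 := qval_ne_zero q
  have hm : ∀ n m, ∑ k, ∑ l, braid q (i, j) (k, l) * braidInv q (k, l) (n, m) =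
      if i = n ∧ j = m then 1 else 0 := by
    intro n m
    have := congrFun (congrFun (braid_mul_braidInv q) (i, j)) (n, m)
    rw [Matrix.mul_apply, Fintype.sum_prod_type, Matrix.one_apply] at this
    simpa [Prod.ext_iff] using this
  funext m
  simp only [Forms.sum_apply, Forms.complex_smul_apply, Forms.smul_apply, xi,
    Forms.op_smul_xi_apply, Forms.xi_apply, twist_x, Finset.smul_sum, smul_smul]
  have : ∀ k l n, qval q * braid q (i, j) (k, l) * ((qval q)⁻¹ * braidInv q (k, l) (n, m)) =
      braid q (i, j) (k, l) * braidInv q (k, l) (n, m) := by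
    intros; field_simp
  simp only [this]
  have h2 : ∑ k, ∑ l, ∑ n, (braid q (i, j) (k, l) * braidInv q (k, l) (n, m)) • Space.x q n =
      ∑ n, (∑ k, ∑ l, braid q (i, j) (k, l) * braidInv q (k, l) (n, m)) • Space.x q n := by
    simp only [Finset.sum_smul]
    symm
    rw [Finset.sum_comm]
    exact Finset.sum_congr rfl fun k _ => Finset.sum_comm
  rw [h2]
  simp only [hm]
  by_cases h : m = j
  · subst h; simp
  · have h' : ¬ j = m := fun e => h e.symm
    simp [h, h']

theorem op_rinv_smul_xi (q : Param) (i : Idx) :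
    op (Space.rinv q) • xi q i = (qval q ^ 2 • Space.rinv q) • xi q i := by
  funext j
  rw [xi, Forms.op_smul_xi_apply, Forms.smul_apply, Forms.xi_apply, twist, Space.lift_rinv,
    Matrix.diagonal_apply]
  by_cases h : i = j
  · simp [h]
  · have h' : ¬ j = i := fun e => h e.symm
    simp [h, h']

theorem op_smul_xi (q : Param) (b : Space q) (i : Idx) :
    op b • xi q i = ∑ j, twist q b i j • xi q j := by
  funext m
  rw [xi, Forms.op_smul_xi_apply, Forms.sum_apply]
  simp only [Forms.smul_apply, xi, Forms.xi_apply]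
  simp

theorem xi_expand (q : Param) (ω : Omega1 q) : ω = ∑ i, ω i • xi q i := by
  funext m
  rw [Forms.sum_apply]
  simp only [Forms.smul_apply, xi, Forms.xi_apply, mul_ite, mul_one, mul_zero]
  exact ((Finset.sum_ite_eq Finset.univ m ω).trans (if_pos (Finset.mem_univ m))).symm

/-- The pair `(x^i, ξ^i)` in the square-zero extension of the quantum space algebra by the 1-forms. -/
def dGen (q : Param) (i : Idx) : TrivSqZeroExt (Space q) (Omega1 q) :=
  TrivSqZeroExt.inl (Space.x q i) + TrivSqZeroExt.inr (xi q i)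

def dRadiusSq (q : Param) : Omega1 q := (radiusSq q (dGen q)).snd

theorem dGen_radiusSq (q : Param) : radiusSq q (dGen q) =
    TrivSqZeroExt.inl (radiusSq q (Space.x q)) + TrivSqZeroExt.inr (dRadiusSq q) := by
  ext
  · have := Space.map_radiusSq (TrivSqZeroExt.fstHom ℂ (Space q) (Omega1 q)) q (dGen q)
    simpa [dGen] using this
  · simp [dRadiusSq]

theorem avec_rankOne (m n : Matrix Idx Idx ℂ) (p : Idx × Idx) :
    ∑ i, ∑ j, m i j * rankOne n (i, j) p =
      (∑ i, ∑ j, m i j * n i j) * (n p.1 p.2 / ∑ i, ∑ j, n i j * n i j) := by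
  simp only [rankOne, Matrix.of_apply, Finset.sum_mul]
  refine Finset.sum_congr rfl fun i _ => Finset.sum_congr rfl fun j _ => ?_
  ring

theorem sum4_comm {E : Type} [AddCommMonoid E] (F : Idx → Idx → Idx → Idx → E) :
    ∑ i, ∑ j, ∑ k, ∑ l, F i j k l = ∑ k, ∑ l, ∑ i, ∑ j, F i j k l := by
  have e1 := Fintype.sum_prod_type' fun i j => ∑ k, ∑ l, F i j k l
  have e2 := Fintype.sum_prod_type' fun k l => ∑ i, ∑ j, F i j k l
  rw [← e1, ← e2]
  have e3 : ∀ r : Idx × Idx, ∑ k, ∑ l, F r.1 r.2 k l = ∑ s : Idx × Idx, F r.1 r.2 s.1 s.2 :=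
    fun r => (Fintype.sum_prod_type' fun k l => F r.1 r.2 k l).symm
  have e4 : ∀ s : Idx × Idx, ∑ i, ∑ j, F i j s.1 s.2 = ∑ r : Idx × Idx, F r.1 r.2 s.1 s.2 :=
    fun s => (Fintype.sum_prod_type' fun i j => F i j s.1 s.2).symm
  simp only [e3, e4]
  exact Finset.sum_comm

theorem avec_projA (q : Param) (a : Fin 3) (p : Idx × Idx) :
    ∑ i, ∑ j, avec q a i j * projA q (i, j) p = avec q a p.1 p.2 := by
  have : ∀ i j, avec q a i j * projA q (i, j) p =
      ∑ b, avec q a i j * rankOne (avec q b) (i, j) p := by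
    intro i j
    rw [projA, Matrix.sum_apply, Finset.mul_sum]
  simp only [this]
  have h2 : ∑ i, ∑ j, ∑ b, avec q a i j * rankOne (avec q b) (i, j) p =
      ∑ b, ∑ i, ∑ j, avec q a i j * rankOne (avec q b) (i, j) p := by
    symm
    rw [Finset.sum_comm]
    exact Finset.sum_congr rfl fun k _ => Finset.sum_comm
  rw [h2, Finset.sum_eq_single a]
  · rw [avec_rankOne, mul_div_cancel₀ _ (avec_norm_ne q a)]
  · intro b _ hb
    rw [avec_rankOne, avec_avec q a b hb.symm, zero_mul]
  · simp

theorem avec_braid (q : Param) (a : Fin 3) (p : Idx × Idx) :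
    ∑ i, ∑ j, avec q a i j * braid q (i, j) p = -(qval q)⁻¹ * avec q a p.1 p.2 := by
  have hT : ∑ i, ∑ j, avec q a i j * projT q (i, j) p = 0 := by
    have h := gmat_avec q a
    simp only [mul_comm (gmat q _ _)] at h
    rw [projT, avec_rankOne, h, zero_mul]
  have hA := avec_projA q a p
  have h1 : ∑ i, ∑ j, avec q a i j * (1 : Mat9) (i, j) p = avec q a p.1 p.2 := by
    have := Fintype.sum_prod_type fun r : Idx × Idx => avec q a r.1 r.2 * (1 : Mat9) r p
    rw [← this]
    simp [Matrix.one_apply]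
  have key : ∀ i j, avec q a i j * braid q (i, j) p =
      qval q * (avec q a i j * (1 : Mat9) (i, j) p) -
      (qval q + (qval q)⁻¹) * (avec q a i j * projA q (i, j) p) +
      ((qval q ^ 2)⁻¹ - qval q) * (avec q a i j * projT q (i, j) p) := by
    intro i j
    simp only [braid, projS, Matrix.add_apply, Matrix.sub_apply, Matrix.smul_apply, smul_eq_mul]
    ring
  simp only [key, Finset.sum_add_distrib, Finset.sum_sub_distrib, ← Finset.mul_sum, hT, hA, h1]
  ring

theorem xi_antisymm (q : Param) (a : Fin 3) :
    ∑ i, ∑ j, avec q a i j • (Space.x q i • xi q j + op (Space.x q j) • xi q i) = 0 := by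
  have h0 := qval_ne_zero q
  simp only [smul_add, Finset.sum_add_distrib]
  rw [add_eq_zero_iff_eq_neg]
  have key : ∀ k l, ∑ i, ∑ j, avec q a i j * (qval q * braid q (i, j) (k, l)) =
      -avec q a k l := by
    intro k l
    have h := avec_braid q a (k, l)
    have : ∀ i j, avec q a i j * (qval q * braid q (i, j) (k, l)) =
        qval q * (avec q a i j * braid q (i, j) (k, l)) := by intros; ring
    simp only [this, ← Finset.mul_sum, h]
    field_simp
  rw [← Finset.sum_neg_distrib]
  simp only [← Finset.sum_neg_distrib, ← neg_smul, ← key, x_smul_xi, Finset.sum_smul,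
    Finset.smul_sum, smul_smul]
  exact sum4_comm _

theorem dGen_isQuantumVector (q : Param) : IsQuantumVector q (dGen q)
    (TrivSqZeroExt.inl (Space.rinv q) -
      TrivSqZeroExt.inr (Space.rinv q • op (Space.rinv q) • dRadiusSq q)) where
  comm a := by
    ext
    · have := (Space.isQuantumVector q).comm a
      have h2 := map_zero (TrivSqZeroExt.fstHom ℂ (Space q) (Omega1 q))
      rw [← this] at h2
      simpa [dGen, TrivSqZeroExt.fst_sum] using this
    · simpa [dGen, TrivSqZeroExt.snd_sum] using xi_antisymm q a
  inv_mul := by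
    rw [dGen_radiusSq]
    have h1 := (Space.isQuantumVector q).inv_mul
    have h2 := (Space.isQuantumVector q).mul_inv
    ext
    · simpa using h1
    · simp only [TrivSqZeroExt.snd_mul, TrivSqZeroExt.fst_add, TrivSqZeroExt.fst_sub,
        TrivSqZeroExt.fst_inl, TrivSqZeroExt.fst_inr, TrivSqZeroExt.snd_add,
        TrivSqZeroExt.snd_sub, TrivSqZeroExt.snd_inl, TrivSqZeroExt.snd_inr,
        TrivSqZeroExt.snd_one, add_zero, sub_zero, zero_add, zero_sub, smul_neg]
      rw [← smul_comm (Space.rinv q) (op (radiusSq q (Space.x q))), smul_smul (op _),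
        ← MulOpposite.op_mul, h1]
      simp
  mul_inv := by
    rw [dGen_radiusSq]
    have h1 := (Space.isQuantumVector q).inv_mul
    have h2 := (Space.isQuantumVector q).mul_inv
    ext
    · simpa using h2
    · simp only [TrivSqZeroExt.snd_mul, TrivSqZeroExt.fst_add, TrivSqZeroExt.fst_sub,
        TrivSqZeroExt.fst_inl, TrivSqZeroExt.fst_inr, TrivSqZeroExt.snd_add,
        TrivSqZeroExt.snd_sub, TrivSqZeroExt.snd_inl, TrivSqZeroExt.snd_inr,
        TrivSqZeroExt.snd_one, add_zero, sub_zero, zero_add, zero_sub, smul_neg]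
      rw [smul_smul, h2]
      simp

/-- The homomorphism `f ↦ (f, df)` to the square-zero extension. -/
def dHom (q : Param) : Space q →ₐ[ℂ] TrivSqZeroExt (Space q) (Omega1 q) :=
  Space.lift (dGen_isQuantumVector q)

/-- The exterior derivative on functions: the derivation with `d x^i = ξ^i`, see `d_mul` and `d_x`. -/
def d (q : Param) : Space q →ₗ[ℂ] Omega1 q :=
  (TrivSqZeroExt.sndHom (Space q) (Omega1 q)).restrictScalars ℂ ∘ₗ (dHom q).toLinearMap

theorem dHom_fst (q : Param) (a : Space q) : (dHom q a).fst = a := by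
  have : (TrivSqZeroExt.fstHom ℂ (Space q) (Omega1 q)).comp (dHom q) = AlgHom.id ℂ _ := by
    apply Space.hom_ext
    · intro i; simp [dHom, Space.lift_x, dGen]
    · simp [dHom, Space.lift_rinv]
  exact DFunLike.congr_fun this a

theorem d_mul (q : Param) (a b : Space q) : d q (a * b) = a • d q b + op b • d q a := by
  have : d q (a * b) = (dHom q a * dHom q b).snd := by
    rw [← map_mul]; rfl
  rw [this, TrivSqZeroExt.snd_mul, dHom_fst, dHom_fst]
  rfl

theorem d_x (q : Param) (i : Idx) : d q (Space.x q i) = xi q i := by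
  change (dHom q (Space.x q i)).snd = _
  simp [dHom, Space.lift_x, dGen]

/-- The Dirac operator `θ = (q - 1)⁻¹ q² r⁻² x^i ξ^j g_{ij}`. -/
def theta (q : Param) : Omega1 q :=
  ((qval q - 1)⁻¹ * qval q ^ 2) •
    (Space.rinv q • ∑ i, ∑ j, gmat q i j • (Space.x q i • xi q j))

abbrev Omega11 (q : Param) : Type := BTensor (Space q) (Omega1 q) (Omega1 q)

/-- `ξ^i ⊗ ξ^j`. -/
def xixi (q : Param) (i j : Idx) : Omega11 q := BTensor.tmul (Space q) (xi q i) (xi q j)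

/-- `∑ P^{ij}_{kl} ξ^k ⊗ ξ^l`, where `p = (i, j)`. -/
def wedgeRel (q : Param) (p : Idx × Idx) (Pr : Mat9) : Omega11 q :=
  ∑ k, ∑ l, Pr p (k, l) • xixi q k l

/-- The sub-bimodule generated by the relations `P_s ξξ = 0` and `P_t ξξ = 0`. -/
def wedgeSub (q : Param) : Submodule ℂ (Omega11 q) :=
  Submodule.span ℂ {t | ∃ (a b : Space q) (p : Idx × Idx),
    t = a • op b • wedgeRel q p (projS q) ∨ t = a • op b • wedgeRel q p (projT q)}

/-- The 2-forms. -/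
abbrev Omega2 (q : Param) : Type := Omega11 q ⧸ wedgeSub q

/-- The projection `π` from the tensor square of the 1-forms to the 2-forms. -/
def wedge (q : Param) : Omega11 q →ₗ[ℂ] Omega2 q := (wedgeSub q).mkQ

/-- The exterior derivative on 1-forms: `d(∑ f_i ξ^i) = ∑ df_i ∧ ξ^i`, see `d₁_smul_xi`. -/
def d₁ (q : Param) : Omega1 q →ₗ[ℂ] Omega2 q :=
  ∑ i, wedge q ∘ₗ (BTensor.tmulBil (Space q)).flip (xi q i) ∘ₗ d q ∘ₗ
    (LinearMap.proj i : (Idx → Space q) →ₗ[ℂ] Space q)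

theorem d₁_smul_xi (q : Param) (f : Space q) (i : Idx) :
    d₁ q (f • xi q i) = wedge q (BTensor.tmul (Space q) (d q f) (xi q i)) := by
  simp only [d₁, LinearMap.sum_apply]
  rw [Finset.sum_eq_single i]
  · change wedge q (BTensor.tmul (Space q) (d q ((f • xi q i) i)) (xi q i)) = _
    simp [Forms.smul_apply, xi, Forms.xi_apply]
  · intro j _ hj
    change wedge q (BTensor.tmulBil (Space q) (d q ((f • xi q i) j)) (xi q j)) = _
    simp [Forms.smul_apply, xi, Forms.xi_apply, hj]
  · simp

end Calculus

section QuantumGroup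

/-- The `q`-epsilon tensor: up to a factor the only tensor fixed by the antisymmetric projector
both in its first two and in its last two indices. -/
def epsTensor (q : Param) : Idx → Idx → Idx → ℂ
  | 0, 1, 2 => 1
  | 0, 2, 1 => -qval q
  | 1, 0, 2 => -qval q
  | 1, 1, 1 => -(qval q * hpar q)
  | 1, 2, 0 => qval q
  | 2, 0, 1 => qval q
  | 2, 1, 0 => -qval q ^ 2
  | _, _, _ => 0

def freeT (i j : Idx) : FreeAlgebra ℂ (Idx × Idx) := FreeAlgebra.ι ℂ (i, j)

/-- The relations of the coordinate algebra of `SO_q(3)`: `R̂ T T = T T R̂`, orthogonality with respect to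
`g`, and unit quantum determinant. -/
inductive GroupRel (q : Param) :
    FreeAlgebra ℂ (Idx × Idx) → FreeAlgebra ℂ (Idx × Idx) → Prop
  | rtt (i j m n : Idx) : GroupRel q
      (∑ k, ∑ l, braid q (i, j) (k, l) • (freeT k m * freeT l n))
      (∑ k, ∑ l, braid q (k, l) (m, n) • (freeT i k * freeT j l))
  | metric_left (k l : Idx) : GroupRel q
      (∑ i, ∑ j, gmat q i j • (freeT i k * freeT j l)) (algebraMap ℂ _ (gmat q k l))
  | metric_right (i j : Idx) : GroupRel q
      (∑ k, ∑ l, gmat q k l • (freeT i k * freeT j l)) (algebraMap ℂ _ (gmat q i j))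
  | det (i j k : Idx) : GroupRel q
      (∑ l, ∑ m, ∑ n, epsTensor q l m n • (freeT i l * freeT j m * freeT k n))
      (algebraMap ℂ _ (epsTensor q i j k))

/-- The coordinate algebra of the quantum group `SO_q(3)`. -/
def FunSO (q : Param) : Type := RingQuot (GroupRel q)

instance (q : Param) : Ring (FunSO q) := inferInstanceAs (Ring (RingQuot (GroupRel q)))
instance (q : Param) : Algebra ℂ (FunSO q) :=
  inferInstanceAs (Algebra ℂ (RingQuot (GroupRel q)))

def mkSO (q : Param) : FreeAlgebra ℂ (Idx × Idx) →ₐ[ℂ] FunSO q :=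
  RingQuot.mkAlgHom ℂ (GroupRel q)

/-- The generator `T^i_j`. -/
def gen (q : Param) (i j : Idx) : FunSO q := mkSO q (freeT i j)

theorem gen_rtt (q : Param) (i j m n : Idx) :
    ∑ k, ∑ l, braid q (i, j) (k, l) • (gen q k m * gen q l n) =
      ∑ k, ∑ l, braid q (k, l) (m, n) • (gen q i k * gen q j l) := by
  have : mkSO q _ = mkSO q _ := RingQuot.mkAlgHom_rel ℂ (GroupRel.rtt (q := q) i j m n)
  simpa [gen] using this

theorem gen_metric_left (q : Param) (k l : Idx) :
    ∑ i, ∑ j, gmat q i j • (gen q i k * gen q j l) = algebraMap ℂ _ (gmat q k l) := by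
  have : mkSO q _ = mkSO q _ := RingQuot.mkAlgHom_rel ℂ (GroupRel.metric_left (q := q) k l)
  simpa [gen] using this

theorem gen_metric_right (q : Param) (i j : Idx) :
    ∑ k, ∑ l, gmat q k l • (gen q i k * gen q j l) = algebraMap ℂ _ (gmat q i j) := by
  have : mkSO q _ = mkSO q _ := RingQuot.mkAlgHom_rel ℂ (GroupRel.metric_right (q := q) i j)
  simpa [gen] using this

/-- The matrix `T^i_k T^j_l`. -/
def genTwo (q : Param) : Matrix (Idx × Idx) (Idx × Idx) (FunSO q) :=
  Matrix.of fun p r => gen q p.1 r.1 * gen q p.2 r.2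

/-- `M T T = T T M`. -/
def Intertwines (q : Param) (m : Mat9) : Prop :=
  m.map (algebraMap ℂ (FunSO q)) * genTwo q = genTwo q * m.map (algebraMap ℂ (FunSO q))

theorem Intertwines.add {q : Param} {m n : Mat9} (hm : Intertwines q m) (hn : Intertwines q n) :
    Intertwines q (m + n) := by
  unfold Intertwines at *
  rw [Matrix.map_add _ (map_add _), add_mul, mul_add, hm, hn]

theorem Intertwines.smul {q : Param} {m : Mat9} (hm : Intertwines q m) (z : ℂ) :
    Intertwines q (z • m) := by
  unfold Intertwines at *
  have : (z • m).map (algebraMap ℂ (FunSO q)) = z • m.map (algebraMap ℂ (FunSO q)) := by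
    ext p r
    simp only [Matrix.map_apply, Matrix.smul_apply, smul_eq_mul, map_mul]
    rw [Algebra.smul_def]
  rw [this, Matrix.smul_mul, hm, Matrix.mul_smul]

theorem intertwines_one (q : Param) : Intertwines q 1 := by
  simp [Intertwines, Matrix.map_one]

theorem intertwines_iff {q : Param} {m : Mat9} : Intertwines q m ↔ ∀ i j k l,
    ∑ a, ∑ b, m (i, j) (a, b) • (gen q a k * gen q b l) =
      ∑ a, ∑ b, m (a, b) (k, l) • (gen q i a * gen q j b) := by
  constructor
  · intro h i j k l
    have := congrFun (congrFun h (i, j)) (k, l)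
    simpa [Matrix.mul_apply, Fintype.sum_prod_type, genTwo, Algebra.smul_def,
      ← Algebra.commutes (R := ℂ)] using this
  · intro h
    ext ⟨i, j⟩ ⟨k, l⟩
    have := h i j k l
    simpa [Matrix.mul_apply, Fintype.sum_prod_type, genTwo, Algebra.smul_def,
      ← Algebra.commutes (R := ℂ)] using this

theorem intertwines_braid (q : Param) : Intertwines q (braid q) :=
  intertwines_iff.2 (gen_rtt q)

theorem intertwines_projT (q : Param) : Intertwines q (projT q) := by
  rw [intertwines_iff]
  intro i j k l
  have h1 := gen_metric_left q k l
  have h2 := gen_metric_right q i j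
  simp only [projT, rankOne, Matrix.of_apply]
  generalize (∑ i, ∑ j, gmat q i j * gmat q i j) = D
  have e1 : ∀ a b, (gmat q i j * gmat q a b / D) • (gen q a k * gen q b l) =
      (gmat q i j / D) • (gmat q a b • (gen q a k * gen q b l)) := by
    intro a b; rw [smul_smul]; congr 1; ring
  have e2 : ∀ a b, (gmat q a b * gmat q k l / D) • (gen q i a * gen q j b) =
      (gmat q k l / D) • (gmat q a b • (gen q i a * gen q j b)) := by
    intro a b; rw [smul_smul]; congr 1; ring
  simp only [e1, e2, ← Finset.smul_sum, h1, h2]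
  simp only [Algebra.smul_def, ← map_mul]
  congr 1
  ring

theorem intertwines_projA (q : Param) : Intertwines q (projA q) := by
  have h0 := sqrtq_ne_zero q
  have h1 := one_add_ne_zero q
  have h2 : qval q + (qval q)⁻¹ ≠ 0 := by
    rw [qval_eq]
    have : sqrtq q ^ 2 + (sqrtq q ^ 2)⁻¹ = (1 + sqrtq q ^ 4) / sqrtq q ^ 2 := by
      field_simp
      ring
    rw [this]
    exact div_ne_zero h1 (pow_ne_zero _ h0)
  have : projA q = (qval q + (qval q)⁻¹)⁻¹ •
      ((qval q • (1 : Mat9) + ((qval q ^ 2)⁻¹ - qval q) • projT q) + (-1 : ℂ) • braid q) := by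
    rw [eq_inv_smul_iff₀ h2]
    simp only [braid, projS]
    module
  rw [this]
  exact (((intertwines_one q).smul _).add ((intertwines_projT q).smul _)).add
    ((intertwines_braid q).smul _) |>.smul _

theorem intertwines_braidInv (q : Param) : Intertwines q (braidInv q) := by
  have : braidInv q = ((qval q)⁻¹ • (1 : Mat9) + (-(qval q)⁻¹ - qval q) • projA q) +
      (qval q ^ 2 - (qval q)⁻¹) • projT q := by
    simp only [braidInv, projS]
    module
  rw [this]
  exact (((intertwines_one q).smul _).add ((intertwines_projA q).smul _)).add
    ((intertwines_projT q).smul _)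

theorem avec_gen (q : Param) (a : Fin 3) (k l : Idx) :
    ∑ i, ∑ j, avec q a i j • (gen q i k * gen q j l) =
      ∑ m, ∑ n, projA q (m, n) (k, l) •
        ∑ i, ∑ j, avec q a i j • (gen q i m * gen q j n) := by
  have h := intertwines_iff.1 (intertwines_projA q)
  have e : ∀ i j, avec q a i j = ∑ b, ∑ c, avec q a b c * projA q (b, c) (i, j) :=
    fun i j => (avec_projA q a (i, j)).symm
  calc ∑ i, ∑ j, avec q a i j • (gen q i k * gen q j l)
      = ∑ b, ∑ c, avec q a b c • ∑ i, ∑ j, projA q (b, c) (i, j) • (gen q i k * gen q j l) := by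
        rw [Finset.sum_congr rfl fun i _ => Finset.sum_congr rfl fun j _ =>
          congrArg (fun z => z • (gen q i k * gen q j l)) (e i j)]
        simp only [Finset.sum_smul, Finset.smul_sum, smul_smul]
        exact sum4_comm _
    _ = _ := by
        simp only [h, Finset.smul_sum]
        rw [sum4_comm]
        simp only [smul_comm (avec q a _ _)]

/-- `T^i_j ⊗ x^j`. -/
def coX (q : Param) (i : Idx) : FunSO q ⊗[ℂ] Space q := ∑ j, gen q i j ⊗ₜ[ℂ] Space.x q j

theorem coX_mul (q : Param) (m : Matrix Idx Idx ℂ) :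
    ∑ i, ∑ j, m i j • (coX q i * coX q j) =
      ∑ k, ∑ l, (∑ i, ∑ j, m i j • (gen q i k * gen q j l)) ⊗ₜ[ℂ]
        (Space.x q k * Space.x q l) := by
  simp only [coX, Finset.sum_mul, Finset.mul_sum, Algebra.TensorProduct.tmul_mul_tmul,
    TensorProduct.sum_tmul, Finset.smul_sum, TensorProduct.smul_tmul']
  simp only [Fin.sum_univ_three]
  abel

theorem coX_isQuantumVector (q : Param) :
    IsQuantumVector q (coX q) ((1 : FunSO q) ⊗ₜ[ℂ] Space.rinv q) where
  comm a := by
    have hS := (Space.isQuantumVector q).comm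
    have hP : ∀ m n, ∑ k, ∑ l, projA q (m, n) (k, l) • (Space.x q k * Space.x q l) = 0 := by
      intro m n
      have : ∀ k l, projA q (m, n) (k, l) • (Space.x q k * Space.x q l) =
          ∑ b, (avec q b m n / ∑ i, ∑ j, avec q b i j * avec q b i j) •
            (avec q b k l • (Space.x q k * Space.x q l)) := by
        intro k l
        simp only [projA, Matrix.sum_apply, rankOne, Matrix.of_apply, Finset.sum_smul, smul_smul]
        refine Finset.sum_congr rfl fun b _ => ?_
        congr 1
        ring
      simp only [this]
      rw [Finset.sum_congr rfl fun k _ => Finset.sum_comm, Finset.sum_comm]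
      simp only [← Finset.smul_sum, hS, smul_zero, Finset.sum_const_zero]
    obtain ⟨W, hW⟩ : ∃ W : Idx → Idx → FunSO q, ∀ k l,
        ∑ i, ∑ j, avec q a i j • (gen q i k * gen q j l) =
          ∑ m, ∑ n, projA q (m, n) (k, l) • W m n := ⟨_, avec_gen q a⟩
    rw [coX_mul]
    simp only [hW, TensorProduct.sum_tmul, TensorProduct.smul_tmul]
    rw [sum4_comm]
    simp only [← TensorProduct.tmul_sum, hP, TensorProduct.tmul_zero, Finset.sum_const_zero]
  inv_mul := by
    have : radiusSq q (coX q) = (1 : FunSO q) ⊗ₜ[ℂ] radiusSq q (Space.x q) := by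
      rw [radiusSq, coX_mul]
      simp only [gen_metric_left, radiusSq, TensorProduct.tmul_sum, Algebra.algebraMap_eq_smul_one,
        TensorProduct.smul_tmul]
    rw [this, Algebra.TensorProduct.tmul_mul_tmul, (Space.isQuantumVector q).inv_mul]
    simp [Algebra.TensorProduct.one_def]
  mul_inv := by
    have : radiusSq q (coX q) = (1 : FunSO q) ⊗ₜ[ℂ] radiusSq q (Space.x q) := by
      rw [radiusSq, coX_mul]
      simp only [gen_metric_left, radiusSq, TensorProduct.tmul_sum, Algebra.algebraMap_eq_smul_one,
        TensorProduct.smul_tmul]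
    rw [this, Algebra.TensorProduct.tmul_mul_tmul, (Space.isQuantumVector q).mul_inv]
    simp [Algebra.TensorProduct.one_def]

/-- The left coaction of `SO_q(3)` on the quantum space algebra, the algebra homomorphism with
`x^i ↦ T^i_j ⊗ x^j`. -/
def coSpace (q : Param) : Space q →ₐ[ℂ] FunSO q ⊗[ℂ] Space q := Space.lift (coX_isQuantumVector q)

/-- Left multiplication, `(h ⊗ a)(h' ⊗ ω) = h h' ⊗ a ω`. -/
abbrev coSmul (q : Param) : (FunSO q ⊗[ℂ] Space q) →ₗ[ℂ] (FunSO q ⊗[ℂ] Omega1 q) →ₗ[ℂ]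
    FunSO q ⊗[ℂ] Omega1 q :=
  TensorProduct.map₂ (LinearMap.mul ℂ (FunSO q))
    (Algebra.lsmul ℂ ℂ (Omega1 q) : Space q →ₐ[ℂ] Module.End ℂ (Omega1 q)).toLinearMap

/-- `T^i_j ⊗ ξ^j`. -/
def coXi (q : Param) (i : Idx) : FunSO q ⊗[ℂ] Omega1 q := ∑ j, gen q i j ⊗ₜ[ℂ] xi q j

/-- The coaction on 1-forms, `f ξ^i ↦ φ(f) (T^i_j ⊗ ξ^j)` with `φ` the coaction on functions. -/
def coOmega1 (q : Param) : Omega1 q →ₗ[ℂ] FunSO q ⊗[ℂ] Omega1 q :=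
  ∑ i, (coSmul q).flip (coXi q i) ∘ₗ (coSpace q).toLinearMap ∘ₗ
    (LinearMap.proj i : (Idx → Space q) →ₗ[ℂ] Space q)

theorem Space.induction {q : Param} {C : Space q → Prop} (hx : ∀ i, C (Space.x q i))
    (hr : C (Space.rinv q)) (hc : ∀ z : ℂ, C (algebraMap ℂ _ z))
    (hadd : ∀ a b, C a → C b → C (a + b)) (hmul : ∀ a b, C a → C b → C (a * b))
    (a : Space q) : C a := by
  obtain ⟨f, rfl⟩ := RingQuot.mkAlgHom_surjective ℂ (SpaceRel q) a
  change C (Space.mk q f)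
  induction f using FreeAlgebra.induction with
  | grade0 z => rw [AlgHom.commutes]; exact hc z
  | grade1 g =>
    cases g with
    | x i => exact hx i
    | rinv => exact hr
  | mul a b ha hb => rw [map_mul]; exact hmul _ _ ha hb
  | add a b ha hb => rw [map_add]; exact hadd _ _ ha hb

/-- Right multiplication, `(h ⊗ ω)(h' ⊗ a) = h h' ⊗ ω a`. -/
abbrev coSmulRight (q : Param) : (FunSO q ⊗[ℂ] Omega1 q) →ₗ[ℂ] (FunSO q ⊗[ℂ] Space q) →ₗ[ℂ]
    FunSO q ⊗[ℂ] Omega1 q :=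
  TensorProduct.map₂ (LinearMap.mul ℂ (FunSO q))
    ((Algebra.lsmul ℂ ℂ (Omega1 q) : (Space q)ᵐᵒᵖ →ₐ[ℂ] Module.End ℂ (Omega1 q)).toLinearMap ∘ₗ
      (MulOpposite.opLinearEquiv ℂ).toLinearMap).flip

theorem coSmul_tmul (q : Param) (h h' : FunSO q) (a : Space q) (ω : Omega1 q) :
    coSmul q (h ⊗ₜ a) (h' ⊗ₜ ω) = (h * h') ⊗ₜ (a • ω) := rfl

theorem coSmulRight_tmul (q : Param) (h h' : FunSO q) (a : Space q) (ω : Omega1 q) :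
    coSmulRight q (h ⊗ₜ ω) (h' ⊗ₜ a) = (h * h') ⊗ₜ (op a • ω) := rfl

theorem coSmul_mul (q : Param) (u v : FunSO q ⊗[ℂ] Space q) (t : FunSO q ⊗[ℂ] Omega1 q) :
    coSmul q (u * v) t = coSmul q u (coSmul q v t) := by
  induction u with
  | zero => simp
  | add u u' hu hu' => simp [add_mul, hu, hu']
  | tmul h a =>
    induction v with
    | zero => simp
    | add u u' hu hu' => simp [mul_add, hu, hu']
    | tmul h' b =>
      induction t with
      | zero => simp
      | add u u' hu hu' => rw [map_add, map_add, map_add, hu, hu']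
      | tmul k ω =>
        rw [Algebra.TensorProduct.tmul_mul_tmul, coSmul_tmul, coSmul_tmul, coSmul_tmul, mul_smul,
          mul_assoc]

theorem coSmulRight_mul (q : Param) (u v : FunSO q ⊗[ℂ] Space q) (t : FunSO q ⊗[ℂ] Omega1 q) :
    coSmulRight q t (u * v) = coSmulRight q (coSmulRight q t u) v := by
  induction u with
  | zero => simp
  | add u u' hu hu' => rw [add_mul, map_add, map_add, map_add, LinearMap.add_apply, hu, hu']
  | tmul h a =>
    induction v with
    | zero => simp
    | add u u' hu hu' => rw [mul_add, map_add, map_add, hu, hu']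
    | tmul h' b =>
      induction t with
      | zero => simp
      | add u u' hu hu' => simp only [map_add, LinearMap.add_apply, hu, hu']
      | tmul k ω =>
        rw [Algebra.TensorProduct.tmul_mul_tmul, coSmulRight_tmul, coSmulRight_tmul,
          coSmulRight_tmul, MulOpposite.op_mul, mul_smul, mul_assoc]

theorem coSmul_coSmulRight (q : Param) (u v : FunSO q ⊗[ℂ] Space q)
    (t : FunSO q ⊗[ℂ] Omega1 q) :
    coSmulRight q (coSmul q u t) v = coSmul q u (coSmulRight q t v) := by
  induction u with
  | zero => simp
  | add u u' hu hu' => simp only [map_add, LinearMap.add_apply, hu, hu']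
  | tmul h a =>
    induction v with
    | zero => simp
    | add u u' hu hu' => simp only [map_add, hu, hu']
    | tmul h' b =>
      induction t with
      | zero => simp
      | add u u' hu hu' => simp only [map_add, LinearMap.add_apply, hu, hu']
      | tmul k ω =>
        rw [coSmul_tmul, coSmulRight_tmul, coSmulRight_tmul, coSmul_tmul, mul_assoc,
          ← smul_comm a (op b) ω]

theorem coOmega1_apply (q : Param) (ω : Omega1 q) :
    coOmega1 q ω = ∑ i, coSmul q (coSpace q (ω i)) (coXi q i) := by
  simp only [coOmega1, LinearMap.sum_apply]
  rfl

theorem coOmega1_smul (q : Param) (a : Space q) (ω : Omega1 q) :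
    coOmega1 q (a • ω) = coSmul q (coSpace q a) (coOmega1 q ω) := by
  simp only [coOmega1_apply, Forms.smul_apply, map_mul, coSmul_mul, map_sum]

theorem coSmul_one (q : Param) (t : FunSO q ⊗[ℂ] Omega1 q) : coSmul q 1 t = t := by
  induction t with
  | zero => simp
  | add u u' hu hu' => rw [map_add, hu, hu']
  | tmul k ω => rw [Algebra.TensorProduct.one_def, coSmul_tmul, one_mul, one_smul]

theorem coSmulRight_one (q : Param) (t : FunSO q ⊗[ℂ] Omega1 q) : coSmulRight q t 1 = t := by
  induction t with
  | zero => simp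
  | add u u' hu hu' => rw [map_add, LinearMap.add_apply, hu, hu']
  | tmul k ω =>
    rw [Algebra.TensorProduct.one_def, coSmulRight_tmul, mul_one, MulOpposite.op_one, one_smul]

theorem coOmega1_xi (q : Param) (i : Idx) : coOmega1 q (xi q i) = coXi q i := by
  rw [coOmega1_apply, Finset.sum_eq_single i]
  · simp only [xi, Forms.xi_apply, if_true, map_one, coSmul_one]
  · intro j _ hj
    simp [xi, Forms.xi_apply, hj]
  · simp

theorem coSpace_x (q : Param) (i : Idx) : coSpace q (Space.x q i) = coX q i :=
  Space.lift_x _ i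

theorem coSpace_rinv (q : Param) : coSpace q (Space.rinv q) = 1 ⊗ₜ Space.rinv q :=
  Space.lift_rinv _

theorem coOmega1_op_smul_xi (q : Param) (b : Space q) : ∀ i,
    coOmega1 q (op b • xi q i) = coSmulRight q (coXi q i) (coSpace q b) := by
  induction b using Space.induction with
  | hx l =>
    intro k
    have h := intertwines_iff.1 (intertwines_braidInv q)
    have hl : ∀ k l, op (Space.x q l) • xi q k = ∑ i, ∑ j,
        ((qval q)⁻¹ * braidInv q (k, l) (i, j)) • Space.x q i • xi q j := by
      intro k l
      rw [op_smul_xi, Finset.sum_comm]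
      simp only [twist_x, Finset.sum_smul, smul_assoc]
    have hc : ∀ i j, coSmul q (coX q i) (coXi q j) =
        ∑ m, ∑ n, (gen q i m * gen q j n) ⊗ₜ[ℂ] (Space.x q m • xi q n) := by
      intro i j
      simp only [coX, coXi, map_sum, LinearMap.sum_apply, coSmul_tmul]
      exact Finset.sum_comm
    have hR : coSmulRight q (coXi q k) (coX q l) =
        ∑ a, ∑ b, (gen q k a * gen q l b) ⊗ₜ[ℂ] (op (Space.x q b) • xi q a) := by
      simp only [coX, coXi, map_sum, LinearMap.sum_apply, coSmulRight_tmul]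
      exact Finset.sum_comm
    rw [coSpace_x, hR, hl]
    simp only [map_sum, map_smul, coOmega1_smul, coOmega1_xi, coSpace_x, hc, hl]
    have e1 : ∑ i, ∑ j, ((qval q)⁻¹ * braidInv q (k, l) (i, j)) •
          ∑ m, ∑ n, (gen q i m * gen q j n) ⊗ₜ[ℂ] (Space.x q m • xi q n) =
        ∑ m, ∑ n, ((qval q)⁻¹ • ∑ i, ∑ j, braidInv q (k, l) (i, j) •
          (gen q i m * gen q j n)) ⊗ₜ[ℂ] (Space.x q m • xi q n) := by
      simp only [Finset.smul_sum, TensorProduct.sum_tmul, smul_smul, TensorProduct.smul_tmul']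
      exact sum4_comm _
    rw [e1]
    simp only [h, Finset.smul_sum, TensorProduct.sum_tmul, TensorProduct.tmul_sum, smul_smul,
      TensorProduct.tmul_smul, TensorProduct.smul_tmul']
    exact sum4_comm _
  | hr =>
    intro i
    rw [op_rinv_smul_xi, coOmega1_smul, coOmega1_xi, map_smul, coSpace_rinv, coXi]
    simp only [map_sum, LinearMap.sum_apply, map_smul, LinearMap.smul_apply, coSmul_tmul,
      coSmulRight_tmul, op_rinv_smul_xi, one_mul, mul_one, smul_assoc, TensorProduct.tmul_smul]
  | hc z =>
    intro i
    have : op (algebraMap ℂ (Space q) z) • xi q i = z • xi q i := by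
      rw [Algebra.algebraMap_eq_smul_one, MulOpposite.op_smul, smul_assoc, MulOpposite.op_one,
        one_smul]
    rw [this, map_smul, AlgHom.commutes, Algebra.algebraMap_eq_smul_one, map_smul,
      coSmulRight_one, coOmega1_xi]
  | hadd a b ha hb =>
    intro i
    rw [MulOpposite.op_add, add_smul, map_add, ha, hb, map_add, map_add]
  | hmul a b ha hb =>
    intro i
    rw [MulOpposite.op_mul, mul_smul, op_smul_xi q a, Finset.smul_sum, map_sum, map_mul,
      coSmulRight_mul, ← ha, op_smul_xi q a, map_sum]
    simp only [map_sum, LinearMap.sum_apply]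
    refine Finset.sum_congr rfl fun j _ => ?_
    rw [← smul_comm, coOmega1_smul, hb, coOmega1_smul, coSmul_coSmulRight, coOmega1_xi]

theorem coOmega1_op_smul (q : Param) (b : Space q) (ω : Omega1 q) :
    coOmega1 q (op b • ω) = coSmulRight q (coOmega1 q ω) (coSpace q b) := by
  rw [xi_expand q ω, Finset.smul_sum, map_sum, map_sum, map_sum, LinearMap.sum_apply]
  refine Finset.sum_congr rfl fun i _ => ?_
  rw [← smul_comm, coOmega1_smul, coOmega1_op_smul_xi, coOmega1_smul, coSmul_coSmulRight,
    coOmega1_xi]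

/-- `(h ⊗ ω, h' ⊗ η) ↦ h h' ⊗ (ω ⊗ η)`. -/
abbrev coPair (q : Param) : (FunSO q ⊗[ℂ] Omega1 q) →ₗ[ℂ] (FunSO q ⊗[ℂ] Omega1 q) →ₗ[ℂ]
    FunSO q ⊗[ℂ] Omega11 q :=
  TensorProduct.map₂ (LinearMap.mul ℂ (FunSO q)) (BTensor.tmulBil (Space q))

theorem coPair_balanced (q : Param) (t s : FunSO q ⊗[ℂ] Omega1 q)
    (u : FunSO q ⊗[ℂ] Space q) :
    coPair q (coSmulRight q t u) s = coPair q t (coSmul q u s) := by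
  induction u with
  | zero => simp
  | add u u' hu hu' => simp only [map_add, LinearMap.add_apply, hu, hu']
  | tmul h a =>
    induction t with
    | zero => simp
    | add u u' hu hu' => simp only [map_add, LinearMap.add_apply, hu, hu']
    | tmul h' ω =>
      induction s with
      | zero => simp
      | add u u' hu hu' => simp only [map_add, hu, hu']
      | tmul k η =>
        change (h' * h * k) ⊗ₜ[ℂ] BTensor.tmul (Space q) (op a • ω) η =
          (h' * (h * k)) ⊗ₜ[ℂ] BTensor.tmul (Space q) ω (a • η)
        rw [BTensor.smul_tmul_eq, mul_assoc]

/-- The coaction on the tensor square of the 1-forms, `ω ⊗ η ↦ φ(ω) φ(η)`. -/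
def coOmega11 (q : Param) : Omega11 q →ₗ[ℂ] FunSO q ⊗[ℂ] Omega11 q :=
  BTensor.lift ((coPair q).compl₁₂ (coOmega1 q) (coOmega1 q)) (by
    intro ω b η
    change coPair q (coOmega1 q (op b • ω)) (coOmega1 q η) =
      coPair q (coOmega1 q ω) (coOmega1 q (b • η))
    rw [coOmega1_op_smul, coOmega1_smul, coPair_balanced])

end QuantumGroup

section Metric

/-- The 1-forms over the algebra extended by `Λ`. -/
abbrev ExtOmega1 (q : Param) : Type := Forms (twistExt q)

def toExtOmega1 (q : Param) (ω : Omega1 q) : ExtOmega1 q := fun i => toExt q (ω i)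

/-- `r² Λ²`. -/
def metricFactor (q : Param) : ExtSpace q := radiusSq q (ExtSpace.x q) * ExtSpace.dil q ^ 2

/-- The metric with `g(ξ^i ⊗ ξ^j) = g^{ij} r² Λ²`, with values in the algebra extended by `Λ`:
`ω ⊗ η = ∑ ω_i T(η_j)_{ik} ξ^k ⊗ ξ^j` is sent to `∑ ω_i T(η_j)_{ik} g^{kj} r² Λ²`. -/
def metric (q : Param) : Omega11 q →ₗ[ℂ] ExtSpace q :=
  BTensor.lift
    (LinearMap.mk₂ ℂ (fun ω η : Omega1 q => ∑ i, ∑ k, ∑ j,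
        gmat q k j • (toExt q (ω i * twist q (η j) i k) * metricFactor q))
      (by intros; simp [Forms.add_apply, add_mul, Finset.sum_add_distrib])
      (by intros; simp [Forms.complex_smul_apply, Finset.smul_sum, smul_comm (gmat q _ _)])
      (by intros; simp [Forms.add_apply, mul_add, add_mul, Finset.sum_add_distrib])
      (by intros; simp [Forms.complex_smul_apply, Finset.smul_sum, smul_comm (gmat q _ _)]))
    (by
      intro ω b η
      change ∑ i, ∑ k, ∑ j, gmat q k j •
          (toExt q ((op b • ω) i * twist q (η j) i k) * metricFactor q) =
        ∑ i, ∑ k, ∑ j, gmat q k j •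
          (toExt q (ω i * twist q (b * η j) i k) * metricFactor q)
      simp only [Forms.op_smul_apply, map_mul, Matrix.mul_apply, map_sum, Finset.sum_mul,
        Finset.mul_sum, Finset.smul_sum, mul_assoc]
      simp only [Fin.sum_univ_three]
      abel)

theorem metric_xixi (q : Param) (i j : Idx) :
    metric q (xixi q i j) = gmat q i j • metricFactor q := by
  have h1 : metric q (xixi q i j) = ∑ a, ∑ k, ∑ b,
      gmat q k b • (toExt q (xi q i a * twist q (xi q j b) a k) * metricFactor q) := rfl
  rw [h1]
  simp only [xi, Forms.xi_apply]
  fin_cases i <;> fin_cases j <;> simp [Fin.sum_univ_three, gmat]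

end Metric
section Metric23

theorem metric_smul (q : Param) (b : Space q) (t : Omega11 q) :
    metric q (b • t) = toExt q b * metric q t := by
  refine LinearMap.congr_fun (f := metric q ∘ₗ BTensor.leftAct (Space q) _ _ b)
    (g := LinearMap.mulLeft ℂ (toExt q b) ∘ₗ metric q) ?_ t
  refine BTensor.hom_ext fun ω η => ?_
  change ∑ i, ∑ k, ∑ j, gmat q k j •
      (toExt q ((b * ω i) * twist q (η j) i k) * metricFactor q) =
    toExt q b * ∑ i, ∑ k, ∑ j, gmat q k j •
      (toExt q (ω i * twist q (η j) i k) * metricFactor q)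
  simp [Finset.mul_sum, mul_assoc]

theorem toExtOmega1_op_smul (q : Param) (b : Space q) (ω : Omega1 q) :
    toExtOmega1 q (op b • ω) = op (toExt q b) • toExtOmega1 q ω := by
  funext j
  rw [Forms.op_smul_apply, twistExt_toExt]
  simp [toExtOmega1, Forms.op_smul_apply]

/-- `g₂₃(ω ⊗ t) = ω g(t)`. -/
def metric23 (q : Param) : BTensor (Space q) (Omega1 q) (Omega11 q) →ₗ[ℂ] ExtOmega1 q :=
  BTensor.lift
    (LinearMap.mk₂ ℂ (fun (ω : Omega1 q) (t : Omega11 q) => op (metric q t) • toExtOmega1 q ω)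
      (by
        intro ω ω' t
        rw [← smul_add]
        congr 1
        funext j
        simp [toExtOmega1, Forms.add_apply])
      (by
        intro z ω t
        rw [smul_comm z]
        congr 1
        funext j
        simp [toExtOmega1, Forms.complex_smul_apply])
      (by
        intro ω t t'
        rw [map_add, MulOpposite.op_add, add_smul])
      (by
        intro z ω t
        rw [map_smul, MulOpposite.op_smul, smul_assoc]))
    (by
      intro ω b t
      change op (metric q t) • toExtOmega1 q (op b • ω) = op (metric q (b • t)) • toExtOmega1 q ω
      rw [toExtOmega1_op_smul, metric_smul, MulOpposite.op_mul, mul_smul])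

end Metric23

section Statements

variable {q : Param}

/-- The bilinear maps from the tensor square of the 1-forms to itself. -/
abbrev Flip (q : Param) : Type := BimodHom (Space q) (Omega11 q) (Omega11 q)

/-- The linear connections on the quantum Euclidean space. -/
abbrev Connection (q : Param) : Type := LinearConnection (d q)

/-- `σ(ξ^i ⊗ ξ^j) = S^{ij}_{hk} ξ^h ⊗ ξ^k`. -/
def HasCoeff (σ : Flip q) (S : Mat9) : Prop :=
  ∀ i j, σ.toLinearMap (xixi q i j) = ∑ h, ∑ k, S (i, j) (h, k) • xixi q h k

/-- `D ω = - θ ⊗ ω + σ(ω ⊗ θ)`. -/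
def IsDiracForm (C : Connection q) : Prop :=
  ∀ ω, C.D ω = -BTensor.tmul (Space q) (theta q) ω +
    C.σ.toLinearMap (BTensor.tmul (Space q) ω (theta q))

/-- The torsion `d - π ∘ D` vanishes. -/
def IsTorsionFree (C : Connection q) : Prop :=
  d₁ q - wedge q ∘ₗ C.D = 0

/-- `D` commutes with the coactions of `SO_q(3)`. -/
def IsSOInvariant (C : Connection q) : Prop :=
  coOmega11 q ∘ₗ C.D = LinearMap.lTensor (FunSO q) C.D ∘ₗ coOmega1 q

/-- Compatibility with the metric up to the conformal factor `c`:
`g₂₃ ∘ D₂ = - θ g + c g θ`. For `c = 1` the right side is `- [θ, g] = d ∘ g`, and this is metric compatibility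
`g₂₃ ∘ D₂ = d ∘ g`. For `D` of the form `- θ ⊗ ω + σ(ω ⊗ θ)` it says that
`g₂₃ ∘ σ₁₂ ∘ σ₂₃` is `c` times `g₁₂`. -/
def IsMetricCompatibleUpTo (C : Connection q) (c : ℂ) : Prop :=
  ∀ ω η : Omega1 q, metric23 q (C.D₂ ω η) =
    -(op (metric q (BTensor.tmul (Space q) ω η)) • toExtOmega1 q (theta q)) +
      c • (metric q (BTensor.tmul (Space q) ω η) • toExtOmega1 q (theta q))

/-- The identity `S^{ij}_{hk} g^{kl} S^{mn}_{jl} = c g^{im} δ^n_h`, compatibility with the metric up to the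
factor `c` in terms of the coefficients of the flip. -/
def IsCoeffCompatible (q : Param) (S : Mat9) (c : ℂ) : Prop :=
  ∀ i h m n, ∑ j, ∑ k, ∑ l, S (i, j) (h, k) * gmat q k l * S (m, n) (j, l) =
    c * (gmat q i m * if n = h then 1 else 0)

end Statements

end

end QEuclid

open QEuclid

/-!
Coefficients of tensors are handled as functions of their indices with values in a complex vector
space, on which a matrix `S` acts by `contr S`, and by `contr12 S` and `contr23 S` in the first or
last two of three indices. The identities between `R̂^{±1}` and `g` behind the theorem are the
Yang-Baxter equation (`braidInv_yangBaxter`), the sliding of `g` through a crossing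
(`crossing_braid`, `crossing_braidInv`) and the relation `R̂ - R̂⁻¹ = (q - q⁻¹) (1 - g g)`
(`braid_eq`). The first two are checked by components.

*Existence.* `θ` is a multiple of `r⁻² g_{ij} x^i ξ^j` with `r²` central, and a computation with the
matrices of right multiplication gives `[x^l, θ] = ξ^l`, hence `df = -[θ, f]` (`d_eq_commutator`).
For this reason `D ω = -θ ⊗ ω + σ(ω ⊗ θ)` satisfies both Leibniz rules for every bimodule map `σ`
(`diracConnection`). The tensor square of the 1-forms is free as a left module on the `ξ^i ⊗ ξ^j`
(`coord`), so a matrix `S` defines a left linear map; the Yang-Baxter equation makes it right linear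
for `S = R̂^{±1}` (`flipOf`), and gives the braid equation. The torsion vanishes because `σ` is `-1`
on antisymmetric tensors while `θ` anticommutes with the `ξ^i` in the 2-forms, and invariance
follows from `R̂ T T = T T R̂` and the invariance of `θ`. For a connection of this form `g₂₃ D₂` is
`-θ g` plus `g₂₃ σ₁₂ σ₂₃` applied to `ω ⊗ η ⊗ θ` (`metric23_D₂`), so compatibility with the metric
comes down to sliding `g` through two crossings.

*Uniqueness.* Let `σ` have coefficients `S`. Characters of the quantum space algebra with `x^0 = 0`
turn right linearity of `σ` into the statement that `S` commutes with certain `9 × 9` matrices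
(`contr_rightMul`). One of them measures the weight, another raises it, and this forces `S` to act
by scalars on the symmetric trace-free tensors and on `g` (`exists_contr_spinVec_eq`). Vanishing
torsion forces `S = -1` on the antisymmetric tensors (`contr_avec_of_isTorsionFree`). Hence `S` has
the form `x + y R̂⁻¹ + z g g` with `x = q y - 1`. Because `ξ^l = [x^l, θ]`, compatibility with the
metric yields `S^{ij}_{hk} g^{kl} S^{mn}_{jl} = c g^{im} δ^n_h`, and three of these equations leave,
for `c > 0`, only `S = q R̂` and `S = q⁻¹ R̂⁻¹` (`eq_of_isCoeffCompatible`).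
-/

namespace QEuclid
noncomputable section

set_option linter.unusedSimpArgs false

/-! ### Contractions with matrices `M^{ij}_{kl}` -/

theorem forall_idx {p : Idx → Prop} (h0 : p 0) (h1 : p 1) (h2 : p 2) : ∀ i, p i := by
  intro i
  fin_cases i
  exacts [h0, h1, h2]

section Contraction

variable {E F : Type} [AddCommGroup E] [Module ℂ E] [AddCommGroup F] [Module ℂ F]

/-- `∑ S^{ij}_{ab} f^{ab}` for a tensor `f` with values in a vector space. -/
def contr (S : Mat9) (f : Idx → Idx → E) (i j : Idx) : E := ∑ a, ∑ b, S (i, j) (a, b) • f a b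

/-- `∑ S^{ij}_{ab} f^{abk}`. -/
def contr12 (S : Mat9) (f : Idx → Idx → Idx → E) (i j k : Idx) : E :=
  contr S (fun a b => f a b k) i j

/-- `∑ S^{jk}_{bc} f^{ibc}`. -/
def contr23 (S : Mat9) (f : Idx → Idx → Idx → E) (i j k : Idx) : E := contr S (f i) j k

theorem contr_mul (S S' : Mat9) (f : Idx → Idx → E) : contr S (contr S' f) = contr (S * S') f := by
  funext i j
  simp only [contr, Matrix.mul_apply, Fintype.sum_prod_type, Finset.smul_sum, smul_smul,
    Finset.sum_smul]
  exact sum4_comm _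

theorem contr_one (f : Idx → Idx → E) : contr 1 f = f := by
  funext i j
  simp only [contr, Matrix.one_apply, Prod.mk.injEq, ite_smul, one_smul, zero_smul]
  rw [Finset.sum_eq_single i (by intro b _ hb; simp [hb.symm]) (by simp)]
  simp only [true_and, Finset.sum_ite_eq, Finset.mem_univ, if_true]

theorem contr_smul_left (z : ℂ) (S : Mat9) (f : Idx → Idx → E) (i j : Idx) :
    contr (z • S) f i j = z • contr S f i j := by
  simp only [contr, Finset.smul_sum, smul_smul, Matrix.smul_apply, smul_eq_mul]

theorem contr_smul_right (z : ℂ) (S : Mat9) (f : Idx → Idx → E) (i j : Idx) :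
    contr S (fun a b => z • f a b) i j = z • contr S f i j := by
  simp only [contr, Finset.smul_sum, smul_comm z]

theorem contr_add_left (S S' : Mat9) (f : Idx → Idx → E) (i j : Idx) :
    contr (S + S') f i j = contr S f i j + contr S' f i j := by
  simp only [contr, add_smul, Matrix.add_apply, Finset.sum_add_distrib]

theorem map_contr (φ : E →ₗ[ℂ] F) (S : Mat9) (f : Idx → Idx → E) (i j : Idx) :
    φ (contr S f i j) = contr S (fun a b => φ (f a b)) i j := by
  simp only [contr, map_sum, map_smul]

theorem contr12_mul (S S' : Mat9) (f : Idx → Idx → Idx → E) :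
    contr12 S (contr12 S' f) = contr12 (S * S') f := by
  funext i j k
  simp only [contr12, ← contr_mul]

theorem contr23_mul (S S' : Mat9) (f : Idx → Idx → Idx → E) :
    contr23 S (contr23 S' f) = contr23 (S * S') f := by
  funext i j k
  simp only [contr23, ← contr_mul]
  rfl

theorem contr12_one (f : Idx → Idx → Idx → E) : contr12 1 f = f := by
  funext i j k
  simp only [contr12, contr_one]

theorem contr23_one (f : Idx → Idx → Idx → E) : contr23 1 f = f := by
  funext i j k
  simp only [contr23, contr_one]

theorem contr12_smul (z : ℂ) (S : Mat9) (f : Idx → Idx → Idx → E) :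
    contr12 (z • S) f = z • contr12 S f := by
  funext i j k
  exact contr_smul_left _ _ _ _ _

theorem contr23_smul (z : ℂ) (S : Mat9) (f : Idx → Idx → Idx → E) :
    contr23 (z • S) f = z • contr23 S f := by
  funext i j k
  exact contr_smul_left _ _ _ _ _

theorem contr12_smul_right (z : ℂ) (S : Mat9) (f : Idx → Idx → Idx → E) :
    contr12 S (z • f) = z • contr12 S f := by
  funext i j k
  exact contr_smul_right _ _ _ _ _

theorem contr23_smul_right (z : ℂ) (S : Mat9) (f : Idx → Idx → Idx → E) :
    contr23 S (z • f) = z • contr23 S f := by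
  funext i j k
  exact contr_smul_right _ _ _ _ _

end Contraction

/-! ### The braid matrix -/

section Braid

variable {E : Type} [AddCommGroup E] [Module ℂ E] {q : Param}

/-- The action of the inverse braid matrix, row by row. -/
theorem contr_braidInv (f : Idx → Idx → E) :
    contr (braidInv q) f 0 0 = (sqrtq q ^ 2)⁻¹ • f 0 0 ∧
    contr (braidInv q) f 0 1 = f 1 0 ∧
    contr (braidInv q) f 0 2 = sqrtq q ^ 2 • f 2 0 ∧
    contr (braidInv q) f 1 0 = f 0 1 + ((sqrtq q ^ 2)⁻¹ - sqrtq q ^ 2) • f 1 0 ∧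
    contr (braidInv q) f 1 1 = f 1 1 + ((sqrtq q ^ 2 - (sqrtq q ^ 2)⁻¹) * sqrtq q) • f 2 0 ∧
    contr (braidInv q) f 1 2 = f 2 1 ∧
    contr (braidInv q) f 2 0 = sqrtq q ^ 2 • f 0 2 +
        ((sqrtq q ^ 2 - (sqrtq q ^ 2)⁻¹) * sqrtq q) • f 1 1 +
        ((sqrtq q ^ 2 - (sqrtq q ^ 2)⁻¹) * (sqrtq q ^ 2 - 1)) • f 2 0 ∧
    contr (braidInv q) f 2 1 = f 1 2 + ((sqrtq q ^ 2)⁻¹ - sqrtq q ^ 2) • f 2 1 ∧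
    contr (braidInv q) f 2 2 = (sqrtq q ^ 2)⁻¹ • f 2 2 := by
  simp only [contr, braidInv_eq, Fin.sum_univ_three]
  generalize sqrtq q = s
  refine ⟨?_, ?_, ?_, ?_, ?_, ?_, ?_, ?_, ?_⟩
  · change (((s ^ 2)⁻¹ : ℂ) • f 0 0 + (0 : ℂ) • f 0 1 + (0 : ℂ) • f 0 2) +
      ((0 : ℂ) • f 1 0 + (0 : ℂ) • f 1 1 + (0 : ℂ) • f 1 2) +
      ((0 : ℂ) • f 2 0 + (0 : ℂ) • f 2 1 + (0 : ℂ) • f 2 2) = _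
    simp only [zero_smul, one_smul, add_zero, zero_add]
  · change ((0 : ℂ) • f 0 0 + (0 : ℂ) • f 0 1 + (0 : ℂ) • f 0 2) +
      ((1 : ℂ) • f 1 0 + (0 : ℂ) • f 1 1 + (0 : ℂ) • f 1 2) +
      ((0 : ℂ) • f 2 0 + (0 : ℂ) • f 2 1 + (0 : ℂ) • f 2 2) = _
    simp only [zero_smul, one_smul, add_zero, zero_add]
  · change ((0 : ℂ) • f 0 0 + (0 : ℂ) • f 0 1 + (0 : ℂ) • f 0 2) +
      ((0 : ℂ) • f 1 0 + (0 : ℂ) • f 1 1 + (0 : ℂ) • f 1 2) +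
      ((s ^ 2 : ℂ) • f 2 0 + (0 : ℂ) • f 2 1 + (0 : ℂ) • f 2 2) = _
    simp only [zero_smul, one_smul, add_zero, zero_add]
  · change ((0 : ℂ) • f 0 0 + (1 : ℂ) • f 0 1 + (0 : ℂ) • f 0 2) +
      ((((s ^ 2)⁻¹ - s ^ 2) : ℂ) • f 1 0 + (0 : ℂ) • f 1 1 + (0 : ℂ) • f 1 2) +
      ((0 : ℂ) • f 2 0 + (0 : ℂ) • f 2 1 + (0 : ℂ) • f 2 2) = _
    simp only [zero_smul, one_smul, add_zero, zero_add]
  · change ((0 : ℂ) • f 0 0 + (0 : ℂ) • f 0 1 + (0 : ℂ) • f 0 2) +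
      ((0 : ℂ) • f 1 0 + (1 : ℂ) • f 1 1 + (0 : ℂ) • f 1 2) +
      ((((s ^ 2 - (s ^ 2)⁻¹) * s) : ℂ) • f 2 0 + (0 : ℂ) • f 2 1 + (0 : ℂ) • f 2 2) = _
    simp only [zero_smul, one_smul, add_zero, zero_add]
  · change ((0 : ℂ) • f 0 0 + (0 : ℂ) • f 0 1 + (0 : ℂ) • f 0 2) +
      ((0 : ℂ) • f 1 0 + (0 : ℂ) • f 1 1 + (0 : ℂ) • f 1 2) +
      ((0 : ℂ) • f 2 0 + (1 : ℂ) • f 2 1 + (0 : ℂ) • f 2 2) = _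
    simp only [zero_smul, one_smul, add_zero, zero_add]
  · change ((0 : ℂ) • f 0 0 + (0 : ℂ) • f 0 1 + (s ^ 2 : ℂ) • f 0 2) +
      ((0 : ℂ) • f 1 0 + (((s ^ 2 - (s ^ 2)⁻¹) * s) : ℂ) • f 1 1 + (0 : ℂ) • f 1 2) +
      ((((s ^ 2 - (s ^ 2)⁻¹) * (s ^ 2 - 1)) : ℂ) • f 2 0 + (0 : ℂ) • f 2 1 + (0 : ℂ) • f 2 2) = _
    simp only [zero_smul, one_smul, add_zero, zero_add]
  · change ((0 : ℂ) • f 0 0 + (0 : ℂ) • f 0 1 + (0 : ℂ) • f 0 2) +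
      ((0 : ℂ) • f 1 0 + (0 : ℂ) • f 1 1 + (1 : ℂ) • f 1 2) +
      ((0 : ℂ) • f 2 0 + (((s ^ 2)⁻¹ - s ^ 2) : ℂ) • f 2 1 + (0 : ℂ) • f 2 2) = _
    simp only [zero_smul, one_smul, add_zero, zero_add]
  · change ((0 : ℂ) • f 0 0 + (0 : ℂ) • f 0 1 + (0 : ℂ) • f 0 2) +
      ((0 : ℂ) • f 1 0 + (0 : ℂ) • f 1 1 + (0 : ℂ) • f 1 2) +
      ((0 : ℂ) • f 2 0 + (0 : ℂ) • f 2 1 + ((s ^ 2)⁻¹ : ℂ) • f 2 2) = _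
    simp only [zero_smul, one_smul, add_zero, zero_add]

/-- The Yang-Baxter equation, checked on the 27 components of a tensor. -/
theorem braidInv_yangBaxter (f : Idx → Idx → Idx → E) :
    contr12 (braidInv q) (contr23 (braidInv q) (contr12 (braidInv q) f)) =
      contr23 (braidInv q) (contr12 (braidInv q) (contr23 (braidInv q) f)) := by
  have h1 := sqrtq_ne_zero q
  have h := @contr_braidInv E _ _ q
  simp only [forall_and] at h
  obtain ⟨r00, r01, r02, r10, r11, r12, r20, r21, r22⟩ := h
  generalize braidInv q = R at *
  generalize sqrtq q = s at *
  funext i j k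
  revert i j k
  refine forall_idx ?_ ?_ ?_ <;> refine forall_idx ?_ ?_ ?_ <;> refine forall_idx ?_ ?_ ?_ <;>
    simp only [contr12, contr23, r00, r01, r02, r10, r11, r12, r20, r21, r22] <;>
    first | done | (match_scalars <;> field_simp <;> ring)

/-- The matrix `g^{ij} g_{kl}`, a multiple of the trace projector. -/
def capCup (q : Param) : Mat9 := Matrix.of fun p r => gmat q p.1 p.2 * gmat q r.1 r.2

theorem capCup_eq (q : Param) :
    capCup q = ((1 + sqrtq q ^ 2 + sqrtq q ^ 4) / sqrtq q ^ 2) • projT q := by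
  have h1 := sqrtq_ne_zero q
  have h3 := trace_ne_zero q
  ext p r
  simp only [capCup, projT, rankOne, Matrix.of_apply, Matrix.smul_apply, gmat_norm, smul_eq_mul]
  field_simp

/-- A skein relation: `R̂ - R̂⁻¹` is a combination of `1` and `g^{ij} g_{kl}`. -/
theorem braid_eq (q : Param) :
    braid q = braidInv q + (qval q - (qval q)⁻¹) • (1 - capCup q) := by
  have h1 := sqrtq_ne_zero q
  rw [capCup_eq]
  simp only [braid, braidInv, projS, qval_eq]
  match_scalars <;> field_simp <;> ring

theorem gmat_apply (q : Param) : gmat q 0 0 = 0 ∧ gmat q 0 1 = 0 ∧ gmat q 0 2 = (sqrtq q)⁻¹ ∧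
    gmat q 1 0 = 0 ∧ gmat q 1 1 = 1 ∧ gmat q 1 2 = 0 ∧
    gmat q 2 0 = sqrtq q ∧ gmat q 2 1 = 0 ∧ gmat q 2 2 = 0 :=
  ⟨rfl, rfl, rfl, rfl, rfl, rfl, rfl, rfl, rfl⟩

theorem contr_capCup (f : Idx → Idx → E) (i j : Idx) :
    contr (capCup q) f i j = gmat q i j • ∑ a, ∑ b, gmat q a b • f a b := by
  simp only [contr, capCup, Matrix.of_apply, Finset.smul_sum, smul_smul]

theorem sum_gmat_smul (f : Idx → Idx → E) :
    ∑ a, ∑ b, gmat q a b • f a b = (sqrtq q)⁻¹ • f 0 2 + f 1 1 + sqrtq q • f 2 0 := by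
  obtain ⟨g00, g01, g02, g10, g11, g12, g20, g21, g22⟩ := gmat_apply q
  simp only [Fin.sum_univ_three, g00, g01, g02, g10, g11, g12, g20, g21, g22, zero_smul, one_smul,
    zero_add, add_zero]

theorem contr_braid (f : Idx → Idx → E) (i j : Idx) :
    contr (braid q) f i j = contr (braidInv q) f i j +
      (sqrtq q ^ 2 - (sqrtq q ^ 2)⁻¹) • (f i j - gmat q i j •
        ((sqrtq q)⁻¹ • f 0 2 + f 1 1 + sqrtq q • f 2 0)) := by
  rw [braid_eq, contr_add_left, contr_smul_left, sub_eq_add_neg (1 : Mat9),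
    ← neg_one_smul ℂ (capCup q), contr_add_left, contr_one, contr_smul_left, contr_capCup,
    sum_gmat_smul, qval_eq, neg_one_smul, ← sub_eq_add_neg]

/-- The left side of the identity in `IsCoeffCompatible`, as an operation on tensors. -/
theorem contr23_contr12_gmat (S : Mat9) (u : Idx → E) (i m n : Idx) :
    contr23 S (contr12 S fun h k l => gmat q k l • u h) i m n =
      ∑ h, (∑ j, ∑ k, ∑ l, S (i, j) (h, k) * gmat q k l * S (m, n) (j, l)) • u h := by
  simp only [contr23, contr12, contr, Fin.sum_univ_three]
  module

theorem IsCoeffCompatible.contr {S : Mat9} {c : ℂ} (hS : IsCoeffCompatible q S c) (u : Idx → E)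
    (i m n : Idx) : contr23 S (contr12 S fun h k l => gmat q k l • u h) i m n =
      (c * gmat q i m) • u n := by
  rw [contr23_contr12_gmat]
  simp only [hS i _ m n]
  rw [Finset.sum_eq_single n]
  · simp
  · intro b _ hb
    simp [hb.symm]
  · simp

theorem isCoeffCompatible_of_contr {S : Mat9} {c : ℂ} (h : ∀ (u : Idx → ℂ) (i m n : Idx),
    contr23 S (contr12 S fun h k l => gmat q k l • u h) i m n = (c * gmat q i m) • u n) :
    IsCoeffCompatible q S c := by
  intro i a m n
  have := h (Pi.single a 1) i m n
  rw [contr23_contr12_gmat, Finset.sum_eq_single a] at this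
  · simpa [Pi.single_apply, mul_assoc] using this
  · intro b _ hb
    simp [hb]
  · simp

/-- The metric can be slid through a crossing: `R̂⁻¹` satisfies the identity of `IsCoeffCompatible`
with factor `1`. -/
theorem crossing_braidInv (u : Idx → E) (i m n : Idx) :
    contr23 (braidInv q) (contr12 (braidInv q) fun h k l => gmat q k l • u h) i m n =
      gmat q i m • u n := by
  have h1 := sqrtq_ne_zero q
  have h := @contr_braidInv E _ _ q
  simp only [forall_and] at h
  obtain ⟨r00, r01, r02, r10, r11, r12, r20, r21, r22⟩ := h
  obtain ⟨g00, g01, g02, g10, g11, g12, g20, g21, g22⟩ := gmat_apply q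
  generalize braidInv q = R at *
  generalize gmat q = g at *
  generalize sqrtq q = s at *
  revert i m n
  refine forall_idx ?_ ?_ ?_ <;> refine forall_idx ?_ ?_ ?_ <;> refine forall_idx ?_ ?_ ?_ <;>
    simp only [contr12, contr23, r00, r01, r02, r10, r11, r12, r20, r21, r22, g00, g01, g02, g10,
      g11, g12, g20, g21, g22, zero_smul, one_smul, smul_zero, add_zero, zero_add] <;>
    (match_scalars <;> field_simp <;> ring)

theorem crossing_braid (u : Idx → E) (i m n : Idx) :
    contr23 (braid q) (contr12 (braid q) fun h k l => gmat q k l • u h) i m n =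
      gmat q i m • u n := by
  have h1 := sqrtq_ne_zero q
  have h := @contr_braidInv E _ _ q
  simp only [forall_and] at h
  obtain ⟨r00, r01, r02, r10, r11, r12, r20, r21, r22⟩ := h
  obtain ⟨g00, g01, g02, g10, g11, g12, g20, g21, g22⟩ := gmat_apply q
  have hb := @contr_braid E _ _ q
  generalize braid q = B at *
  generalize braidInv q = R at *
  generalize gmat q = g at *
  generalize sqrtq q = s at *
  revert i m n
  refine forall_idx ?_ ?_ ?_ <;> refine forall_idx ?_ ?_ ?_ <;> refine forall_idx ?_ ?_ ?_ <;>
    simp only [contr12, contr23, hb, r00, r01, r02, r10, r11, r12, r20, r21, r22, g00, g01, g02,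
      g10, g11, g12, g20, g21, g22, zero_smul, one_smul, smul_zero, add_zero, zero_add] <;>
    first | done | (match_scalars <;> field_simp <;> ring)

/-- Moving the metric through the braid matrix:
`(R̂⁻¹)^{ia}_{kl} g_{ab} = g_{kc} R̂^{ci}_{lb}`, contracted with `f^{klb}`. -/
theorem sum_gmat_contr_braidInv (f : Idx → Idx → Idx → E) (i : Idx) :
    ∑ a, ∑ b, gmat q a b • contr (braidInv q) (fun k l => f k l b) i a =
      ∑ k, ∑ c, gmat q k c • contr (braid q) (f k) c i := by
  have h1 := sqrtq_ne_zero q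
  have h := @contr_braidInv E _ _ q
  simp only [forall_and] at h
  obtain ⟨r00, r01, r02, r10, r11, r12, r20, r21, r22⟩ := h
  obtain ⟨g00, g01, g02, g10, g11, g12, g20, g21, g22⟩ := gmat_apply q
  simp only [sum_gmat_smul, contr_braid]
  generalize braidInv q = R at *
  generalize gmat q = g at *
  generalize sqrtq q = s at *
  revert i
  refine forall_idx ?_ ?_ ?_ <;>
    simp only [r00, r01, r02, r10, r11, r12, r20, r21, r22, g00, g01, g02, g10,
      g11, g12, g20, g21, g22, zero_smul, one_smul, smul_zero, add_zero, zero_add] <;>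
    match_scalars <;> field_simp <;> ring

/-- The Yang-Baxter equation for `R̂⁻¹` with one factor `R̂⁻¹` moved to the other side. It says that
`R̂` commutes with passing an `x^m` through `ξ^i ⊗ ξ^j`. -/
theorem braid_braidInv_yangBaxter (f : Idx → Idx → Idx → E) :
    contr12 (braid q) (contr23 (braidInv q) (contr12 (braidInv q) f)) =
      contr23 (braidInv q) (contr12 (braidInv q) (contr23 (braid q) f)) := by
  have h := braidInv_yangBaxter (q := q) (contr23 (braid q) f)
  rw [contr23_mul (braidInv q) (braid q), braidInv_mul_braid, contr23_one] at h
  rw [← h, contr12_mul, braid_mul_braidInv, contr12_one]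

theorem braid_yangBaxter (f : Idx → Idx → Idx → E) :
    contr12 (braid q) (contr23 (braid q) (contr12 (braid q) f)) =
      contr23 (braid q) (contr12 (braid q) (contr23 (braid q) f)) := by
  have h := braid_braidInv_yangBaxter (q := q) (contr12 (braid q) (contr23 (braid q) f))
  rw [contr12_mul (braidInv q) (braid q), braidInv_mul_braid, contr12_one,
    contr23_mul (braidInv q) (braid q), braidInv_mul_braid, contr23_one] at h
  rw [h, contr23_mul (braid q) (braidInv q), braid_mul_braidInv, contr23_one,
    contr12_mul (braid q) (braidInv q), braid_mul_braidInv, contr12_one]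

end Braid

/-! ### The differential as a commutator -/

section Commutator

variable {B : Type} [Ring B] [Algebra ℂ B] {q : Param} {x : Idx → B} {ρ : B}

theorem IsQuantumVector.radiusSq_mul (h : IsQuantumVector q x ρ) (l : Idx) :
    radiusSq q x * x l = x l * radiusSq q x := by
  have h1 := sqrtq_ne_zero q
  have r0 := h.rel0
  have r1 := h.rel1
  have r2 := h.rel2
  have r0' : ∀ y, x 0 * (x 1 * y) = sqrtq q ^ 2 • (x 1 * (x 0 * y)) := fun y => by
    rw [← mul_assoc, r0, smul_mul_assoc, mul_assoc]
  have r1' : ∀ y, x 2 * (x 1 * y) = (sqrtq q ^ 2)⁻¹ • (x 1 * (x 2 * y)) := fun y => by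
    rw [← mul_assoc, r1, smul_mul_assoc, mul_assoc]
  have r2' : ∀ y, x 2 * (x 0 * y) =
      x 0 * (x 2 * y) + (sqrtq q - (sqrtq q)⁻¹) • (x 1 * (x 1 * y)) := fun y => by
    rw [← mul_assoc, r2, add_mul, smul_mul_assoc, mul_assoc, mul_assoc]
  rw [radiusSq_eq h]
  revert l
  refine forall_idx ?_ ?_ ?_ <;>
    simp only [mul_assoc, add_mul, mul_add, smul_mul_assoc, mul_smul_comm, r0, r1, r2, r0', r1',
      r2', smul_smul, smul_add] <;>
    match_scalars <;> field_simp <;> ring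

theorem IsQuantumVector.inv_mul_comm (h : IsQuantumVector q x ρ) (l : Idx) :
    ρ * x l = x l * ρ := by
  calc ρ * x l = ρ * (x l * radiusSq q x) * ρ := by
        rw [mul_assoc, mul_assoc, h.mul_inv, mul_one]
    _ = x l * ρ := by rw [← h.radiusSq_mul, ← mul_assoc, h.inv_mul, one_mul]

/-- The coefficients `g_{ij} x^i` of the 1-form `g_{ij} x^i ξ^j`. -/
def lowered (q : Param) (x : Idx → B) (j : Idx) : B := ∑ i, gmat q i j • x i

theorem lowered_apply : lowered q x 0 = sqrtq q • x 2 ∧ lowered q x 1 = x 1 ∧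
    lowered q x 2 = (sqrtq q)⁻¹ • x 0 := by
  obtain ⟨g00, g01, g02, g10, g11, g12, g20, g21, g22⟩ := gmat_apply q
  simp only [lowered, Fin.sum_univ_three, g00, g01, g02, g10, g11, g12, g20, g21, g22, zero_smul,
    one_smul, zero_add, add_zero, and_self]

set_option maxHeartbeats 1000000 in
/-- The commutator of `x^l` with the 1-form `g_{ij} x^i ξ^j` is `q⁻² (q - 1) r² ξ^l`. -/
theorem commutator_lowered (h : IsQuantumVector q x ρ) (l k : Idx) :
    x l * lowered q x k - ∑ i, lowered q x i * rightMat q x l i k =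
      ((qval q - 1) * (qval q ^ 2)⁻¹) • (if k = l then radiusSq q x else 0) := by
  have h1 := sqrtq_ne_zero q
  have r0 := h.rel0
  have r1 := h.rel1
  have r2 := h.rel2
  obtain ⟨v0, v1, v2⟩ := lowered_apply (q := q) (x := x)
  rw [radiusSq_eq h]
  simp only [Fin.sum_univ_three, v0, v1, v2, qval_eq]
  revert l k
  refine forall_idx ?_ ?_ ?_ <;> refine forall_idx ?_ ?_ ?_ <;>
    simp only [rightMat_zero, rightMat_one, rightMat_two, Matrix.of_apply, Matrix.cons_val,
      Fin.reduceEq, if_true, if_false, mul_zero, zero_mul, smul_zero, zero_smul, add_zero, zero_add,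
      v0, v1, v2, smul_mul_assoc, mul_smul_comm, smul_smul, smul_add, r0, r1, r2] <;>
    match_scalars <;> field_simp <;> ring

end Commutator

section Theta

variable (q : Param)

/-- The 1-form `g_{ij} x^i ξ^j`. -/
def radial : Omega1 q := ∑ i, ∑ j, gmat q i j • (Space.x q i • xi q j)

theorem theta_eq : theta q =
    ((qval q - 1)⁻¹ * qval q ^ 2) • (Space.rinv q • radial q) := rfl

theorem radial_apply (k : Idx) : radial q k = lowered q (Space.x q) k := by
  simp only [radial, lowered, Forms.sum_apply, Forms.complex_smul_apply, Forms.smul_apply, xi,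
    Forms.xi_apply, mul_ite, mul_one, mul_zero, smul_ite, smul_zero]
  refine Finset.sum_congr rfl fun i _ => ?_
  rw [Finset.sum_ite_eq, if_pos (Finset.mem_univ _)]

theorem commutator_radial (l : Idx) :
    Space.x q l • radial q - op (Space.x q l) • radial q =
      ((qval q - 1) * (qval q ^ 2)⁻¹) • (radiusSq q (Space.x q) • xi q l) := by
  have h := Space.isQuantumVector q
  funext k
  have := commutator_lowered h l k
  have e : (Space.x q l • radial q - op (Space.x q l) • radial q) k =
      Space.x q l * radial q k - ∑ i, radial q i * twist q (Space.x q l) i k := rfl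
  rw [e, Forms.complex_smul_apply, Forms.smul_apply, xi, Forms.xi_apply, mul_ite, mul_one,
    mul_zero, ← this]
  simp only [radial_apply, twist, Space.lift_x]

theorem rinv_mul_comm (l : Idx) : Space.rinv q * Space.x q l = Space.x q l * Space.rinv q :=
  (Space.isQuantumVector q).inv_mul_comm l

variable {q}

theorem qval_sub_one_ne_zero (hq : (q : ℝ) ≠ 1) : qval q - 1 ≠ 0 := by
  rw [sub_ne_zero]
  unfold qval
  exact_mod_cast hq

/-- `ξ^l = [x^l, θ]`: the commutator of `x^l` with `g_{ij} x^i ξ^j` is a multiple of `r² ξ^l`, and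
`r⁻²` is central. -/
theorem xi_eq_commutator (hq : (q : ℝ) ≠ 1) (l : Idx) :
    xi q l = Space.x q l • theta q - op (Space.x q l) • theta q := by
  have h := Space.isQuantumVector q
  have h0 := qval_ne_zero q
  have h1 := qval_sub_one_ne_zero hq
  rw [theta_eq, smul_comm (Space.x q l), smul_comm (op (Space.x q l)), ← smul_sub,
    ← smul_comm (Space.rinv q) (op (Space.x q l)), smul_smul (Space.x q l), ← rinv_mul_comm,
    mul_smul (Space.rinv q), ← smul_sub, commutator_radial, smul_comm (Space.rinv q), smul_smul,
    smul_smul, h.inv_mul, one_smul]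
  have : (qval q - 1)⁻¹ * qval q ^ 2 * ((qval q - 1) * (qval q ^ 2)⁻¹) = 1 := by field_simp
  rw [this, one_smul]

theorem d_one : d q 1 = 0 := by
  have := d_mul q 1 1
  rw [mul_one, one_smul, MulOpposite.op_one, one_smul] at this
  simpa using this

/-- `df = -[θ, f]`. -/
theorem d_eq_commutator (hq : (q : ℝ) ≠ 1) (f : Space q) :
    d q f = f • theta q - op f • theta q := by
  have hadd : ∀ a b : Space q, d q a = a • theta q - op a • theta q →
      d q b = b • theta q - op b • theta q →
      d q (a + b) = (a + b) • theta q - op (a + b) • theta q := by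
    intro a b ha hb
    rw [map_add, ha, hb, MulOpposite.op_add, add_smul, add_smul]
    abel
  have hmul : ∀ a b : Space q, d q a = a • theta q - op a • theta q →
      d q b = b • theta q - op b • theta q →
      d q (a * b) = (a * b) • theta q - op (a * b) • theta q := by
    intro a b ha hb
    rw [d_mul, ha, hb, MulOpposite.op_mul, smul_sub, smul_sub, mul_smul, mul_smul,
      smul_comm a (op b)]
    abel
  have hx : ∀ l, d q (Space.x q l) = Space.x q l • theta q - op (Space.x q l) • theta q :=
    fun l => by rw [d_x, xi_eq_commutator hq]
  have hsmul : ∀ (z : ℂ) (a : Space q), d q a = a • theta q - op a • theta q →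
      d q (z • a) = (z • a) • theta q - op (z • a) • theta q := by
    intro z a ha
    rw [map_smul, ha, MulOpposite.op_smul, smul_assoc, smul_assoc, smul_sub]
  have h1 : d q 1 = (1 : Space q) • theta q - op (1 : Space q) • theta q := by
    rw [d_one, MulOpposite.op_one, one_smul, one_smul, sub_self]
  induction f using Space.induction with
  | hx l => exact hx l
  | hc z => rw [Algebra.algebraMap_eq_smul_one]; exact hsmul z 1 h1
  | hadd a b ha hb => exact hadd a b ha hb
  | hmul a b ha hb => exact hmul a b ha hb
  | hr =>
    have h := Space.isQuantumVector q
    have hr : d q (radiusSq q (Space.x q)) = radiusSq q (Space.x q) • theta q -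
        op (radiusSq q (Space.x q)) • theta q := by
      rw [radiusSq]
      refine Finset.sum_induction _
        (fun a => d q a = a • theta q - op a • theta q) hadd (by simp) fun i _ => ?_
      refine Finset.sum_induction _
        (fun a => d q a = a • theta q - op a • theta q) hadd (by simp) fun j _ => ?_
      exact hsmul _ _ (hmul _ _ (hx i) (hx j))
    -- both derivations vanish on `r⁻² r² = 1`, and right multiplication by `r²` is injective
    have e1 := d_mul q (Space.rinv q) (radiusSq q (Space.x q))
    rw [h.inv_mul, d_one, hr, smul_sub, smul_smul, h.inv_mul, one_smul] at e1
    have e2 : op (radiusSq q (Space.x q)) • d q (Space.rinv q) =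
        op (radiusSq q (Space.x q)) • (Space.rinv q • theta q - op (Space.rinv q) • theta q) := by
      rw [smul_sub, smul_smul (op _) (op _), ← MulOpposite.op_mul, h.inv_mul, MulOpposite.op_one,
        one_smul, ← smul_comm (Space.rinv q) (op (radiusSq q (Space.x q)))]
      rw [eq_comm, add_comm, ← eq_neg_iff_add_eq_zero] at e1
      rw [e1]
      abel
    have e3 := congrArg (fun ω => op (Space.rinv q) • ω) e2
    simpa only [smul_smul, ← MulOpposite.op_mul, h.mul_inv, MulOpposite.op_one, one_smul] using e3

end Theta

/-! ### The tensor square and cube of the 1-forms as free left modules -/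

section Coordinates

variable {q : Param}

theorem BTensor.induction {B M N : Type} [Ring B] [AddCommGroup M] [Module ℂ M] [Module Bᵐᵒᵖ M]
    [AddCommGroup N] [Module ℂ N] [Module B N] {C : BTensor B M N → Prop}
    (htmul : ∀ m n, C (BTensor.tmul B m n)) (hadd : ∀ s t, C s → C t → C (s + t))
    (t : BTensor B M N) : C t := by
  obtain ⟨t, rfl⟩ := Submodule.mkQ_surjective (balanced B M N) t
  induction t with
  | zero =>
    have e : BTensor.tmul B (0 : M) (0 : N) = (balanced B M N).mkQ 0 :=
      congrArg (balanced B M N).mkQ (TensorProduct.zero_tmul _ _)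
    exact e ▸ htmul 0 0
  | tmul m n => exact htmul m n
  | add s t hs ht => rw [map_add]; exact hadd _ _ hs ht

theorem tmul_add {B M N : Type} [Ring B] [AddCommGroup M] [Module ℂ M] [Module Bᵐᵒᵖ M]
    [AddCommGroup N] [Module ℂ N] [Module B N] (m : M) (n n' : N) :
    BTensor.tmul B m (n + n') = BTensor.tmul B m n + BTensor.tmul B m n' :=
  map_add (BTensor.tmulBil B m) n n'

theorem add_tmul {B M N : Type} [Ring B] [AddCommGroup M] [Module ℂ M] [Module Bᵐᵒᵖ M]
    [AddCommGroup N] [Module ℂ N] [Module B N] (m m' : M) (n : N) :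
    BTensor.tmul B (m + m') n = BTensor.tmul B m n + BTensor.tmul B m' n := by
  simp only [BTensor.tmul, map_add, LinearMap.add_apply]

theorem tmul_sum {B M N : Type} [Ring B] [AddCommGroup M] [Module ℂ M] [Module Bᵐᵒᵖ M]
    [AddCommGroup N] [Module ℂ N] [Module B N] (m : M) (f : Idx → N) :
    BTensor.tmul B m (∑ i, f i) = ∑ i, BTensor.tmul B m (f i) :=
  map_sum (BTensor.tmulBil B m) f _

theorem sum_tmul {B M N : Type} [Ring B] [AddCommGroup M] [Module ℂ M] [Module Bᵐᵒᵖ M]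
    [AddCommGroup N] [Module ℂ N] [Module B N] (f : Idx → M) (n : N) :
    BTensor.tmul B (∑ i, f i) n = ∑ i, BTensor.tmul B (f i) n := by
  simp only [BTensor.tmul, map_sum, LinearMap.sum_apply]

theorem op_x_smul_xi (m j : Idx) : op (Space.x q m) • xi q j =
    (qval q)⁻¹ • contr (braidInv q) (fun n k => Space.x q n • xi q k) j m := by
  rw [op_smul_xi]
  simp only [twist_x, contr, Finset.smul_sum, Finset.sum_smul, smul_smul, smul_assoc]
  exact Finset.sum_comm

theorem op_x_smul_xixi (m i j : Idx) : op (Space.x q m) • xixi q i j =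
    (qval q ^ 2)⁻¹ • contr23 (braidInv q) (contr12 (braidInv q)
      fun p l k => Space.x q p • xixi q l k) i j m := by
  have h : ∀ n k, BTensor.tmul (Space q) (xi q i) (Space.x q n • xi q k) = (qval q)⁻¹ •
      contr (braidInv q) (fun p l => Space.x q p • xixi q l k) i n := by
    intro n k
    rw [← BTensor.smul_tmul_eq, op_x_smul_xi]
    change (BTensor.tmulBil (Space q)).flip (xi q k) _ = _
    rw [map_smul, map_contr]
    rfl
  change BTensor.tmulBil (Space q) (xi q i) (op (Space.x q m) • xi q j) = _
  rw [op_x_smul_xi, map_smul, map_contr]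
  change (qval q)⁻¹ • contr (braidInv q) (fun n k => BTensor.tmul (Space q) (xi q i)
    (Space.x q n • xi q k)) j m = _
  simp only [h, contr_smul_right, smul_smul]
  rw [sq, mul_inv]
  rfl

theorem op_rinv_smul_xixi (i j : Idx) : op (Space.rinv q) • xixi q i j =
    qval q ^ 4 • Space.rinv q • xixi q i j := by
  change BTensor.tmulBil (Space q) (xi q i) (op (Space.rinv q) • xi q j) = _
  rw [op_rinv_smul_xi, smul_assoc, map_smul]
  change qval q ^ 2 • BTensor.tmul (Space q) (xi q i) (Space.rinv q • xi q j) = _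
  rw [← BTensor.smul_tmul_eq, op_rinv_smul_xi, smul_assoc]
  change qval q ^ 2 • (BTensor.tmulBil (Space q)).flip (xi q j) _ = _
  rw [map_smul, smul_smul, ← pow_add]
  rfl

/-- The coordinates `t_{kj}` of `∑ t_{kj} ξ^k ⊗ ξ^j`: since `η_j` is moved to the left through
`ξ^i`, those of `ω ⊗ η` are `∑ ω_i T(η_j)_{ik}`. -/
def coord (q : Param) : Omega11 q →ₗ[ℂ] Idx → Idx → Space q :=
  BTensor.lift
    (LinearMap.mk₂ ℂ (fun ω η : Omega1 q => fun k j => ∑ i, ω i * twist q (η j) i k)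
      (by intros; funext k j; simp [Forms.add_apply, add_mul, Finset.sum_add_distrib])
      (by intros; funext k j; simp [Forms.complex_smul_apply, Finset.smul_sum])
      (by intros; funext k j; simp [Forms.add_apply, mul_add, Finset.sum_add_distrib])
      (by intros; funext k j; simp [Forms.complex_smul_apply, Finset.smul_sum]))
    (by
      intro ω b η
      funext k j
      change ∑ i, (op b • ω) i * twist q (η j) i k = ∑ i, ω i * twist q (b * η j) i k
      simp only [Forms.op_smul_apply, map_mul, Matrix.mul_apply, Finset.sum_mul,
        Finset.mul_sum, mul_assoc]
      exact Finset.sum_comm)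

theorem coord_smul (b : Space q) (t : Omega11 q) (k j : Idx) :
    coord q (b • t) k j = b * coord q t k j := by
  induction t using BTensor.induction with
  | htmul ω η =>
    change ∑ i, (b * ω i) * twist q (η j) i k = b * ∑ i, ω i * twist q (η j) i k
    simp only [Finset.mul_sum, mul_assoc]
  | hadd s t hs ht =>
    rw [smul_add, map_add, map_add, Pi.add_apply, Pi.add_apply, hs, ht, ← mul_add]
    rfl

theorem coord_xixi (i j k l : Idx) :
    coord q (xixi q i j) k l = if k = i ∧ l = j then 1 else 0 := by
  change ∑ a, xi q i a * twist q (xi q j l) a k = _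
  simp only [xi, Forms.xi_apply, ite_mul, one_mul, zero_mul]
  rw [Finset.sum_ite_eq' Finset.univ i, if_pos (Finset.mem_univ _)]
  by_cases h : l = j
  · simp [h, Matrix.one_apply, eq_comm]
  · simp [h]

theorem tmul_xi (ω : Omega1 q) (j : Idx) :
    BTensor.tmul (Space q) ω (xi q j) = ∑ k, ω k • xixi q k j := by
  conv_lhs => rw [xi_expand q ω, sum_tmul]
  rfl

/-- The tensor square is spanned by the `ξ^k ⊗ ξ^j` as a left module. -/
theorem coord_expand (t : Omega11 q) : t = ∑ k, ∑ j, coord q t k j • xixi q k j := by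
  induction t using BTensor.induction with
  | htmul ω η =>
    conv_lhs => rw [xi_expand q η, tmul_sum]
    rw [Finset.sum_comm]
    refine Finset.sum_congr rfl fun j _ => ?_
    rw [← BTensor.smul_tmul_eq, tmul_xi]
    rfl
  | hadd s t hs ht =>
    conv_lhs => rw [hs, ht]
    simp only [map_add, Pi.add_apply, add_smul, Finset.sum_add_distrib]

theorem Omega1.induction {C : Omega1 q → Prop} (hxi : ∀ i, C (xi q i))
    (hadd : ∀ s t, C s → C t → C (s + t)) (hsmul : ∀ (a : Space q) t, C t → C (a • t))
    (ω : Omega1 q) : C ω := by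
  have h0 : C 0 := by simpa using hsmul 0 _ (hxi 0)
  rw [xi_expand q ω]
  exact Finset.sum_induction _ C hadd h0 fun i _ => hsmul _ _ (hxi i)

theorem Omega11.induction {C : Omega11 q → Prop} (hxi : ∀ i j, C (xixi q i j))
    (hadd : ∀ s t, C s → C t → C (s + t)) (hsmul : ∀ (a : Space q) t, C t → C (a • t))
    (t : Omega11 q) : C t := by
  have h0 : C 0 := by simpa using hsmul 0 _ (hxi 0 0)
  rw [coord_expand t]
  exact Finset.sum_induction _ C hadd h0 fun i _ =>
    Finset.sum_induction _ C hadd h0 fun j _ => hsmul _ _ (hxi i j)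

/-- The tensor cube of the 1-forms. -/
abbrev Omega111 (q : Param) : Type := BTensor (Space q) (Omega1 q) (Omega11 q)

/-- `ξ^i ⊗ ξ^j ⊗ ξ^k`. -/
def xixixi (q : Param) (i j k : Idx) : Omega111 q :=
  BTensor.tmul (Space q) (xi q i) (xixi q j k)

theorem Omega111.induction {C : Omega111 q → Prop} (hxi : ∀ i j k, C (xixixi q i j k))
    (hadd : ∀ s t, C s → C t → C (s + t)) (hsmul : ∀ (a : Space q) t, C t → C (a • t))
    (t : Omega111 q) : C t := by
  induction t using BTensor.induction with
  | hadd s t hs ht => exact hadd s t hs ht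
  | htmul ω t =>
    revert ω
    induction t using Omega11.induction with
    | hxi j k =>
      intro ω
      induction ω using Omega1.induction with
      | hxi i => exact hxi i j k
      | hadd ω η hω hη => rw [add_tmul]; exact hadd _ _ hω hη
      | hsmul a ω hω => exact hsmul a _ hω
    | hadd s t hs ht => intro ω; rw [tmul_add]; exact hadd _ _ (hs ω) (ht ω)
    | hsmul a t ht => intro ω; rw [← BTensor.smul_tmul_eq]; exact ht _

end Coordinates

/-! ### Flips and connections with prescribed coefficients -/

section Flips

variable {q : Param}

theorem hasCoeff_iff {σ : Flip q} {S : Mat9} :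
    HasCoeff σ S ↔ ∀ i j, σ.toLinearMap (xixi q i j) = contr S (xixi q) i j := Iff.rfl

/-- The commutation relations of `x^m` with `ξ^i ⊗ ξ^j` are compatible with `S`: this is what makes
the left linear map with coefficients `S` right linear. -/
def IsCentralizing (q : Param) (S : Mat9) : Prop :=
  ∀ f : Idx → Idx → Idx → Omega11 q,
    contr12 S (contr23 (braidInv q) (contr12 (braidInv q) f)) =
      contr23 (braidInv q) (contr12 (braidInv q) (contr23 S f))

/-- The left linear map with `ξ^i ⊗ ξ^j ↦ ∑ S^{ij}_{hk} ξ^h ⊗ ξ^k`. -/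
def leftFlip (q : Param) (S : Mat9) : Omega11 q →ₗ[ℂ] Omega11 q where
  toFun t := ∑ k, ∑ j, coord q t k j • contr S (xixi q) k j
  map_add' s t := by
    simp only [map_add, Pi.add_apply, add_smul, Finset.sum_add_distrib]
  map_smul' z t := by
    simp only [map_smul, Pi.smul_apply, smul_assoc, Finset.smul_sum, RingHom.id_apply]

theorem leftFlip_smul (S : Mat9) (b : Space q) (t : Omega11 q) :
    leftFlip q S (b • t) = b • leftFlip q S t := by
  change ∑ k, ∑ j, coord q (b • t) k j • contr S (xixi q) k j =
    b • ∑ k, ∑ j, coord q t k j • contr S (xixi q) k j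
  simp only [coord_smul, mul_smul, Finset.smul_sum]

theorem leftFlip_xixi (S : Mat9) (i j : Idx) :
    leftFlip q S (xixi q i j) = contr S (xixi q) i j := by
  change ∑ k, ∑ l, coord q (xixi q i j) k l • contr S (xixi q) k l = _
  rw [Finset.sum_eq_single i, Finset.sum_eq_single j]
  · rw [coord_xixi, if_pos ⟨rfl, rfl⟩, one_smul]
  · intro l _ hl
    rw [coord_xixi, if_neg fun h => hl h.2, zero_smul]
  · simp
  · intro k _ hk
    refine Finset.sum_eq_zero fun l _ => ?_
    rw [coord_xixi, if_neg fun h => hk h.1, zero_smul]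
  · simp

/-- Left multiplication by an element of the algebra as a linear map. -/
abbrev lmulOmega (b : Space q) : Omega11 q →ₗ[ℂ] Omega11 q := BTensor.leftAct (Space q) _ _ b
/-- Right multiplication by an element of the algebra as a linear map. -/
abbrev rmulOmega (b : Space q) : Omega11 q →ₗ[ℂ] Omega11 q :=
  BTensor.rightAct (Space q) _ _ (op b)

theorem smul_contr (b : Space q) (S : Mat9) (f : Idx → Idx → Omega11 q) (i j : Idx) :
    b • contr S f i j = contr S (fun k l => b • f k l) i j :=
  map_contr (lmulOmega b) S f i j

theorem op_smul_contr (b : Space q) (S : Mat9) (f : Idx → Idx → Omega11 q) (i j : Idx) :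
    op b • contr S f i j = contr S (fun k l => op b • f k l) i j :=
  map_contr (rmulOmega b) S f i j

theorem leftFlip_op_x_smul {S : Mat9} (hS : IsCentralizing q S) (m i j : Idx) :
    leftFlip q S (op (Space.x q m) • xixi q i j) =
      op (Space.x q m) • leftFlip q S (xixi q i j) := by
  have h1 : ∀ f : Idx → Idx → Idx → Omega11 q, leftFlip q S (contr23 (braidInv q)
      (contr12 (braidInv q) f) i j m) = contr23 (braidInv q)
      (contr12 (braidInv q) fun p l k => leftFlip q S (f p l k)) i j m := by
    intro f
    simp only [contr23, contr12, map_contr]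
    rfl
  have h2 : (fun p l k => leftFlip q S (Space.x q p • xixi q l k)) =
      contr23 S fun p l k => Space.x q p • xixi q l k := by
    funext p l k
    rw [leftFlip_smul, leftFlip_xixi, smul_contr]
    rfl
  rw [op_x_smul_xixi, map_smul, h1, h2, leftFlip_xixi, op_smul_contr, ← hS]
  simp only [op_x_smul_xixi, contr_smul_right, contr12]

theorem leftFlip_op_smul {S : Mat9} (hS : IsCentralizing q S) (b : Space q) :
    ∀ t : Omega11 q, leftFlip q S (op b • t) = op b • leftFlip q S t := by
  have ext : ∀ b : Space q, (∀ i j, leftFlip q S (op b • xixi q i j) =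
      op b • leftFlip q S (xixi q i j)) → ∀ t : Omega11 q,
      leftFlip q S (op b • t) = op b • leftFlip q S t := by
    intro b hb t
    induction t using Omega11.induction with
    | hxi i j => exact hb i j
    | hadd s t hs ht => rw [smul_add, map_add, map_add, hs, ht, smul_add]
    | hsmul a t ht =>
      rw [← smul_comm a (op b), leftFlip_smul, ht, leftFlip_smul, smul_comm a (op b)]
  induction b using Space.induction with
  | hx m => exact ext _ (leftFlip_op_x_smul hS m)
  | hr =>
    refine ext _ fun i j => ?_
    rw [op_rinv_smul_xixi, map_smul, leftFlip_smul, leftFlip_xixi, op_smul_contr]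
    simp only [op_rinv_smul_xixi]
    rw [contr_smul_right, smul_contr]
  | hc z =>
    intro t
    rw [Algebra.algebraMap_eq_smul_one, MulOpposite.op_smul, MulOpposite.op_one, smul_assoc,
      smul_assoc, one_smul, one_smul, map_smul]
  | hadd a b ha hb => intro t; rw [MulOpposite.op_add, add_smul, map_add, ha, hb, add_smul]
  | hmul a b ha hb => intro t; rw [MulOpposite.op_mul, mul_smul, hb, ha, mul_smul]

/-- The bimodule map with coefficients `S`. -/
def flipOf {S : Mat9} (hS : IsCentralizing q S) : Flip q where
  toLinearMap := leftFlip q S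
  map_left := leftFlip_smul S
  map_right := leftFlip_op_smul hS

theorem flipOf_hasCoeff {S : Mat9} (hS : IsCentralizing q S) : HasCoeff (flipOf hS) S :=
  leftFlip_xixi S

theorem Flip.map_smul (σ : Flip q) (b : Space q) (t : Omega11 q) :
    σ.toLinearMap (b • t) = b • σ.toLinearMap t := σ.map_left b t

theorem Flip.map_op_smul (σ : Flip q) (b : Space q) (t : Omega11 q) :
    σ.toLinearMap (op b • t) = op b • σ.toLinearMap t := σ.map_right b t

theorem Flip.ext_xixi {σ τ : Flip q}
    (h : ∀ i j, σ.toLinearMap (xixi q i j) = τ.toLinearMap (xixi q i j)) : σ = τ := by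
  have : σ.toLinearMap = τ.toLinearMap := by
    ext t
    induction t using Omega11.induction with
    | hxi i j => exact h i j
    | hadd s t hs ht => rw [map_add, map_add, hs, ht]
    | hsmul a t ht => rw [Flip.map_smul, Flip.map_smul, ht]
  cases σ
  cases τ
  congr

/-- The linear connection `D ω = -θ ⊗ ω + σ(ω ⊗ θ)`. -/
def diracConnection (hq : (q : ℝ) ≠ 1) (σ : Flip q) : Connection q where
  D := -(BTensor.tmulBil (Space q) (theta q)) +
    σ.toLinearMap ∘ₗ (BTensor.tmulBil (Space q)).flip (theta q)
  σ := σ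
  leibniz_left f ω := by
    change -BTensor.tmul (Space q) (theta q) (f • ω) +
        σ.toLinearMap (f • BTensor.tmul (Space q) ω (theta q)) =
      BTensor.tmul (Space q) (d q f) ω + f • (-BTensor.tmul (Space q) (theta q) ω +
        σ.toLinearMap (BTensor.tmul (Space q) ω (theta q)))
    rw [← BTensor.smul_tmul_eq, Flip.map_smul, d_eq_commutator hq, smul_add, smul_neg,
      BTensor.smul_tmul]
    have : BTensor.tmul (Space q) (f • theta q - op f • theta q) ω =
        BTensor.tmul (Space q) (f • theta q) ω - BTensor.tmul (Space q) (op f • theta q) ω := by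
      simp only [BTensor.tmul, map_sub, LinearMap.sub_apply]
    rw [this]
    abel
  leibniz_right f ω := by
    change -(op f • BTensor.tmul (Space q) (theta q) ω) +
        σ.toLinearMap (BTensor.tmul (Space q) (op f • ω) (theta q)) =
      σ.toLinearMap (BTensor.tmul (Space q) ω (d q f)) +
        op f • (-BTensor.tmul (Space q) (theta q) ω +
          σ.toLinearMap (BTensor.tmul (Space q) ω (theta q)))
    have : BTensor.tmul (Space q) ω (f • theta q - op f • theta q) =
        BTensor.tmul (Space q) ω (f • theta q) - op f • BTensor.tmul (Space q) ω (theta q) := by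
      rw [BTensor.op_smul_tmul]
      simp only [BTensor.tmul, map_sub]
    rw [BTensor.smul_tmul_eq, d_eq_commutator hq, this, map_sub, Flip.map_op_smul, smul_add,
      smul_neg]
    abel

theorem diracConnection_isDiracForm (hq : (q : ℝ) ≠ 1) (σ : Flip q) :
    IsDiracForm (diracConnection hq σ) := fun _ => rfl

theorem connection_ext_of_isDiracForm {C C' : Connection q} (h : IsDiracForm C)
    (h' : IsDiracForm C') (hσ : C.σ = C'.σ) : C = C' := by
  have hD : C.D = C'.D := by
    ext ω
    rw [h, h', hσ]
  cases C
  cases C'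
  simp only [LinearConnection.mk.injEq]
  exact ⟨hD, hσ⟩

end Flips

/-! ### Invariance under the quantum group -/

section Invariance

variable {q : Param}

theorem coOmega1_x_smul_xi (i j : Idx) : coOmega1 q (Space.x q i • xi q j) =
    ∑ m, ∑ n, (gen q i m * gen q j n) ⊗ₜ[ℂ] (Space.x q m • xi q n) := by
  rw [coOmega1_smul, coOmega1_xi, coSpace_x]
  simp only [coX, coXi, map_sum, LinearMap.sum_apply, coSmul_tmul]
  exact Finset.sum_comm

theorem coOmega1_radial : coOmega1 q (radial q) = (1 : FunSO q) ⊗ₜ[ℂ] radial q := by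
  simp only [radial, map_sum, map_smul, coOmega1_x_smul_xi, TensorProduct.tmul_sum,
    Finset.smul_sum]
  rw [sum4_comm]
  refine Finset.sum_congr rfl fun m _ => Finset.sum_congr rfl fun n _ => ?_
  simp only [TensorProduct.smul_tmul', ← TensorProduct.sum_tmul]
  rw [gen_metric_left, Algebra.algebraMap_eq_smul_one, TensorProduct.smul_tmul]

theorem coOmega1_theta : coOmega1 q (theta q) = (1 : FunSO q) ⊗ₜ[ℂ] theta q := by
  rw [theta_eq, map_smul, coOmega1_smul, coOmega1_radial, coSpace_rinv, coSmul_tmul, one_mul,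
    ← TensorProduct.tmul_smul]

/-- Left multiplication on the tensor square, `(h ⊗ a)(h' ⊗ t) = h h' ⊗ a t`. -/
abbrev coSmul11 (q : Param) : (FunSO q ⊗[ℂ] Space q) →ₗ[ℂ] (FunSO q ⊗[ℂ] Omega11 q) →ₗ[ℂ]
    FunSO q ⊗[ℂ] Omega11 q :=
  TensorProduct.map₂ (LinearMap.mul ℂ (FunSO q))
    (Algebra.lsmul ℂ ℂ (Omega11 q) : Space q →ₐ[ℂ] Module.End ℂ (Omega11 q)).toLinearMap

theorem coPair_coSmul (u : FunSO q ⊗[ℂ] Space q) (s t : FunSO q ⊗[ℂ] Omega1 q) :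
    coPair q (coSmul q u s) t = coSmul11 q u (coPair q s t) := by
  induction u with
  | zero => simp
  | add u u' hu hu' => simp only [map_add, LinearMap.add_apply, hu, hu']
  | tmul h a =>
    induction s with
    | zero => simp
    | add u u' hu hu' => simp only [map_add, LinearMap.add_apply, hu, hu']
    | tmul h' ω =>
      induction t with
      | zero => simp
      | add u u' hu hu' => simp only [map_add, hu, hu']
      | tmul k η =>
        change (h * h' * k) ⊗ₜ[ℂ] BTensor.tmul (Space q) (a • ω) η =
          (h * (h' * k)) ⊗ₜ[ℂ] BTensor.tmul (Space q) (a • ω) η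
        rw [mul_assoc]

theorem coOmega11_tmul (ω η : Omega1 q) : coOmega11 q (BTensor.tmul (Space q) ω η) =
    coPair q (coOmega1 q ω) (coOmega1 q η) := rfl

theorem coOmega11_smul (b : Space q) (t : Omega11 q) :
    coOmega11 q (b • t) = coSmul11 q (coSpace q b) (coOmega11 q t) := by
  induction t using BTensor.induction with
  | htmul ω η =>
    rw [BTensor.smul_tmul, coOmega11_tmul, coOmega1_smul, coPair_coSmul, coOmega11_tmul]
  | hadd s t hs ht => rw [smul_add, map_add, map_add, map_add, hs, ht]

theorem coOmega11_xixi (i j : Idx) : coOmega11 q (xixi q i j) =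
    ∑ m, ∑ n, (gen q i m * gen q j n) ⊗ₜ[ℂ] xixi q m n := by
  rw [xixi, coOmega11_tmul, coOmega1_xi, coOmega1_xi]
  simp only [coXi, map_sum, LinearMap.sum_apply]
  exact Finset.sum_comm

/-- A flip whose coefficients intertwine the coaction commutes with it. -/
theorem coOmega11_flip {σ : Flip q} {S : Mat9} (hσ : HasCoeff σ S) (hS : Intertwines q S)
    (t : Omega11 q) : coOmega11 q (σ.toLinearMap t) =
      LinearMap.lTensor (FunSO q) σ.toLinearMap (coOmega11 q t) := by
  induction t using Omega11.induction with
  | hxi i j =>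
    have h := intertwines_iff.1 hS
    rw [hσ]
    simp only [map_sum, map_smul, coOmega11_xixi, LinearMap.lTensor_tmul, hσ _ _,
      Finset.smul_sum, TensorProduct.tmul_sum, TensorProduct.tmul_smul]
    rw [sum4_comm]
    simp only [TensorProduct.smul_tmul', ← TensorProduct.sum_tmul, h]
    simp only [TensorProduct.sum_tmul]
    exact sum4_comm _
  | hadd s t hs ht => simp only [map_add, hs, ht]
  | hsmul a t ht =>
    have : ∀ (u : FunSO q ⊗[ℂ] Space q) (s : FunSO q ⊗[ℂ] Omega11 q),
        LinearMap.lTensor (FunSO q) σ.toLinearMap (coSmul11 q u s) =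
          coSmul11 q u (LinearMap.lTensor (FunSO q) σ.toLinearMap s) := by
      intro u s
      induction u with
      | zero => simp
      | add u u' hu hu' => simp only [map_add, LinearMap.add_apply, hu, hu']
      | tmul h a =>
        induction s with
        | zero => simp
        | add u u' hu hu' => simp only [map_add, hu, hu']
        | tmul h' t =>
          change (h * h') ⊗ₜ[ℂ] σ.toLinearMap (a • t) = (h * h') ⊗ₜ[ℂ] (a • σ.toLinearMap t)
          rw [Flip.map_smul]
    rw [Flip.map_smul, coOmega11_smul, ht, coOmega11_smul, this]

theorem isSOInvariant_of_intertwines {C : Connection q} (hC : IsDiracForm C) {S : Mat9}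
    (hσ : HasCoeff C.σ S) (hS : Intertwines q S) : IsSOInvariant C := by
  have hD : C.D = -(BTensor.tmulBil (Space q) (theta q)) +
      C.σ.toLinearMap ∘ₗ (BTensor.tmulBil (Space q)).flip (theta q) := LinearMap.ext hC
  have hl : ∀ s : FunSO q ⊗[ℂ] Omega1 q, coPair q ((1 : FunSO q) ⊗ₜ[ℂ] theta q) s =
      LinearMap.lTensor (FunSO q) (BTensor.tmulBil (Space q) (theta q)) s := by
    intro s
    induction s with
    | zero => simp
    | add s s' hs hs' => simp only [map_add, hs, hs']
    | tmul h ω =>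
      change (1 * h) ⊗ₜ[ℂ] BTensor.tmul (Space q) (theta q) ω =
        h ⊗ₜ[ℂ] BTensor.tmul (Space q) (theta q) ω
      rw [one_mul]
  have hr : ∀ s : FunSO q ⊗[ℂ] Omega1 q, coPair q s ((1 : FunSO q) ⊗ₜ[ℂ] theta q) =
      LinearMap.lTensor (FunSO q) ((BTensor.tmulBil (Space q)).flip (theta q)) s := by
    intro s
    induction s with
    | zero => simp
    | add s s' hs hs' => simp only [map_add, LinearMap.add_apply, hs, hs']
    | tmul h ω =>
      change (h * 1) ⊗ₜ[ℂ] BTensor.tmul (Space q) ω (theta q) =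
        h ⊗ₜ[ℂ] BTensor.tmul (Space q) ω (theta q)
      rw [mul_one]
  refine LinearMap.ext fun ω => ?_
  rw [LinearMap.comp_apply, LinearMap.comp_apply, hC, map_add, map_neg, coOmega11_flip hσ hS,
    coOmega11_tmul, coOmega11_tmul, coOmega1_theta, hl, hr, hD, LinearMap.lTensor_add,
    LinearMap.lTensor_neg, LinearMap.lTensor_comp]
  rfl

end Invariance

/-! ### Torsion -/

section Torsion

variable {q : Param}

theorem smul_mem_wedgeSub (b : Space q) {t : Omega11 q} (ht : t ∈ wedgeSub q) :
    b • t ∈ wedgeSub q := by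
  have e : ∀ (a c : Space q) (w : Omega11 q), b • a • op c • w = (b * a) • op c • w :=
    fun a c w => (mul_smul b a (op c • w)).symm
  have : wedgeSub q ≤ (wedgeSub q).comap (lmulOmega b) := by
    refine Submodule.span_le.2 ?_
    rintro _ ⟨a, c, p, rfl | rfl⟩
    · exact Submodule.subset_span ⟨b * a, c, p, Or.inl (e a c _)⟩
    · exact Submodule.subset_span ⟨b * a, c, p, Or.inr (e a c _)⟩
  exact this ht

theorem op_smul_mem_wedgeSub (b : Space q) {t : Omega11 q} (ht : t ∈ wedgeSub q) :
    op b • t ∈ wedgeSub q := by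
  have e : ∀ (a c : Space q) (w : Omega11 q), op b • a • op c • w = a • op (c * b) • w := by
    intro a c w
    rw [← smul_comm a (op b), smul_smul (op b), ← MulOpposite.op_mul]
  have : wedgeSub q ≤ (wedgeSub q).comap (rmulOmega b) := by
    refine Submodule.span_le.2 ?_
    rintro _ ⟨a, c, p, rfl | rfl⟩
    · exact Submodule.subset_span ⟨a, c * b, p, Or.inl (e a c _)⟩
    · exact Submodule.subset_span ⟨a, c * b, p, Or.inr (e a c _)⟩
  exact this ht

theorem contr_projS_mem_wedgeSub (i j : Idx) : contr (projS q) (xixi q) i j ∈ wedgeSub q :=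
  Submodule.subset_span ⟨1, 1, (i, j), Or.inl (by
    rw [one_smul, MulOpposite.op_one, one_smul]; rfl)⟩

theorem contr_projT_mem_wedgeSub (i j : Idx) : contr (projT q) (xixi q) i j ∈ wedgeSub q :=
  Submodule.subset_span ⟨1, 1, (i, j), Or.inr (by
    rw [one_smul, MulOpposite.op_one, one_smul]; rfl)⟩

/-- `S` is a combination of the three projectors with coefficient `-1` at the antisymmetric one. -/
def IsMinusOneOnWedge (q : Param) (S : Mat9) : Prop :=
  ∃ a b : ℂ, S + 1 = a • projS q + b • projT q

theorem IsMinusOneOnWedge.contr_add_mem {S : Mat9} (hS : IsMinusOneOnWedge q S) (i j : Idx) :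
    contr S (xixi q) i j + xixi q i j ∈ wedgeSub q := by
  obtain ⟨a, b, hab⟩ := hS
  have : contr S (xixi q) i j + xixi q i j = a • contr (projS q) (xixi q) i j +
      b • contr (projT q) (xixi q) i j := by
    rw [← contr_smul_left, ← contr_smul_left, ← contr_add_left, ← hab, contr_add_left, contr_one]
  rw [this]
  exact add_mem (Submodule.smul_mem _ _ (contr_projS_mem_wedgeSub i j))
    (Submodule.smul_mem _ _ (contr_projT_mem_wedgeSub i j))

theorem isMinusOneOnWedge_braid : IsMinusOneOnWedge q (qval q • braid q) := by
  have h0 := qval_ne_zero q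
  refine ⟨qval q ^ 2 + 1, (qval q)⁻¹ + 1, ?_⟩
  simp only [braid, projS]
  match_scalars <;> field_simp <;> ring

theorem isMinusOneOnWedge_braidInv : IsMinusOneOnWedge q ((qval q)⁻¹ • braidInv q) := by
  have h0 := qval_ne_zero q
  refine ⟨(qval q ^ 2)⁻¹ + 1, qval q + 1, ?_⟩
  simp only [braidInv, projS]
  match_scalars <;> field_simp <;> ring

theorem flip_add_self_mem_wedgeSub {σ : Flip q} {S : Mat9} (hσ : HasCoeff σ S)
    (hS : IsMinusOneOnWedge q S) (t : Omega11 q) : σ.toLinearMap t + t ∈ wedgeSub q := by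
  induction t using Omega11.induction with
  | hxi i j => rw [hσ]; exact hS.contr_add_mem i j
  | hadd s t hs ht =>
    rw [map_add, add_add_add_comm]
    exact add_mem hs ht
  | hsmul a t ht =>
    rw [Flip.map_smul, ← smul_add]
    exact smul_mem_wedgeSub a ht

theorem tmul_radial_xi (i : Idx) : BTensor.tmul (Space q) (radial q) (xi q i) =
    ∑ k, ∑ c, gmat q k c • Space.x q k • xixi q c i := by
  rw [radial, sum_tmul]
  refine Finset.sum_congr rfl fun k _ => ?_
  rw [sum_tmul]
  refine Finset.sum_congr rfl fun c _ => ?_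
  change (BTensor.tmulBil (Space q)).flip (xi q i) _ = _
  rw [map_smul]
  rfl

theorem tmul_xi_radial (i : Idx) : BTensor.tmul (Space q) (xi q i) (radial q) =
    ∑ k, ∑ c, gmat q k c • Space.x q k • (qval q)⁻¹ • contr (braid q) (xixi q) c i := by
  have h : ∀ a b, BTensor.tmul (Space q) (xi q i) (Space.x q a • xi q b) =
      (qval q)⁻¹ • contr (braidInv q) (fun k l => Space.x q k • xixi q l b) i a := by
    intro a b
    rw [← BTensor.smul_tmul_eq, op_x_smul_xi]
    change (BTensor.tmulBil (Space q)).flip (xi q b) _ = _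
    rw [map_smul, map_contr]
    rfl
  have e : BTensor.tmul (Space q) (xi q i) (radial q) = ∑ a, ∑ b, gmat q a b •
      BTensor.tmul (Space q) (xi q i) (Space.x q a • xi q b) := by
    simp only [radial, tmul_sum]
    refine Finset.sum_congr rfl fun a _ => Finset.sum_congr rfl fun b _ => ?_
    exact map_smul (BTensor.tmulBil (Space q) (xi q i)) _ _
  rw [e]
  simp only [h, smul_comm (gmat q _ _) (qval q)⁻¹, ← Finset.smul_sum]
  rw [sum_gmat_contr_braidInv fun k l b => Space.x q k • xixi q l b]
  simp only [Finset.smul_sum]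
  refine Finset.sum_congr rfl fun k _ => Finset.sum_congr rfl fun c _ => ?_
  rw [← smul_contr, smul_comm (qval q)⁻¹ (gmat q k c), smul_comm (qval q)⁻¹ (Space.x q k)]

/-- In the 2-forms `θ` anticommutes with every `ξ^i`. -/
theorem tmul_theta_add_mem_wedgeSub (i : Idx) : BTensor.tmul (Space q) (theta q) (xi q i) +
    BTensor.tmul (Space q) (xi q i) (theta q) ∈ wedgeSub q := by
  have h0 := qval_ne_zero q
  have e1 : BTensor.tmul (Space q) (theta q) (xi q i) = ((qval q - 1)⁻¹ * qval q ^ 2) •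
      Space.rinv q • BTensor.tmul (Space q) (radial q) (xi q i) :=
    map_smul ((BTensor.tmulBil (Space q)).flip (xi q i)) _ _
  have e2 : BTensor.tmul (Space q) (xi q i) (theta q) = ((qval q - 1)⁻¹ * qval q ^ 2) •
      Space.rinv q • qval q ^ 2 • BTensor.tmul (Space q) (xi q i) (radial q) := by
    have : BTensor.tmul (Space q) (xi q i) (theta q) = ((qval q - 1)⁻¹ * qval q ^ 2) •
        BTensor.tmul (Space q) (xi q i) (Space.rinv q • radial q) :=
      map_smul (BTensor.tmulBil (Space q) (xi q i)) _ _
    rw [this, ← BTensor.smul_tmul_eq, op_rinv_smul_xi, smul_assoc, smul_comm (Space.rinv q)]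
    congr 1
  have e3 : BTensor.tmul (Space q) (radial q) (xi q i) +
      qval q ^ 2 • BTensor.tmul (Space q) (xi q i) (radial q) ∈ wedgeSub q := by
    have : BTensor.tmul (Space q) (radial q) (xi q i) +
        qval q ^ 2 • BTensor.tmul (Space q) (xi q i) (radial q) = ∑ k, ∑ c, gmat q k c •
          Space.x q k • (contr (qval q • braid q) (xixi q) c i + xixi q c i) := by
      rw [tmul_radial_xi, tmul_xi_radial]
      simp only [Finset.smul_sum, ← Finset.sum_add_distrib]
      refine Finset.sum_congr rfl fun k _ => Finset.sum_congr rfl fun c _ => ?_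
      rw [smul_comm (qval q ^ 2), smul_comm (qval q ^ 2), smul_smul (qval q ^ 2), ← smul_add,
        ← smul_add, add_comm, contr_smul_left]
      have : qval q ^ 2 * (qval q)⁻¹ = qval q := by field_simp
      rw [this]
    rw [this]
    exact sum_mem fun k _ => sum_mem fun c _ => Submodule.smul_mem _ _
      (smul_mem_wedgeSub _ (isMinusOneOnWedge_braid.contr_add_mem c i))
  rw [e1, e2, ← smul_add, ← smul_add]
  exact Submodule.smul_mem _ _ (smul_mem_wedgeSub _ e3)

/-- Modulo the relations of the 2-forms `σ = -1`, so `D ξ^i` becomes `-(θ ξ^i + ξ^i θ) = 0 = d ξ^i`.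
-/
theorem isTorsionFree_of_isMinusOneOnWedge {C : Connection q} (hC : IsDiracForm C) {S : Mat9}
    (hσ : HasCoeff C.σ S) (hS : IsMinusOneOnWedge q S) : IsTorsionFree C := by
  have hxi : ∀ i, C.D (xi q i) ∈ wedgeSub q := by
    intro i
    have h1 := flip_add_self_mem_wedgeSub hσ hS (BTensor.tmul (Space q) (xi q i) (theta q))
    have h2 := sub_mem h1 (tmul_theta_add_mem_wedgeSub (q := q) i)
    have : C.D (xi q i) = C.σ.toLinearMap (BTensor.tmul (Space q) (xi q i) (theta q)) +
        BTensor.tmul (Space q) (xi q i) (theta q) -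
        (BTensor.tmul (Space q) (theta q) (xi q i) +
          BTensor.tmul (Space q) (xi q i) (theta q)) := by
      rw [hC]
      abel
    rwa [this]
  refine LinearMap.ext fun ω => ?_
  change d₁ q ω - wedge q (C.D ω) = 0
  rw [xi_expand q ω]
  simp only [map_sum, d₁_smul_xi, C.leibniz_left, map_add, Finset.sum_add_distrib]
  rw [sub_add_cancel_left, neg_eq_zero]
  exact Finset.sum_eq_zero fun i _ =>
    (Submodule.Quotient.mk_eq_zero _).2 (smul_mem_wedgeSub _ (hxi i))

end Torsion

/-! ### The braid equation -/

section BraidEquation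

variable {q : Param}

theorem assoc_smul (b : Space q) (t : BTensor (Space q) (Omega11 q) (Omega1 q)) :
    BTensor.assoc (Space q) _ _ _ (b • t) = b • BTensor.assoc (Space q) _ _ _ t := by
  induction t using BTensor.induction with
  | htmul u η =>
    induction u using BTensor.induction with
    | htmul ω ζ => rfl
    | hadd s t hs ht => rw [add_tmul, smul_add, map_add, hs, ht, map_add, smul_add]
  | hadd s t hs ht => rw [smul_add, map_add, hs, ht, map_add, smul_add]

theorem assoc_op_smul (b : Space q) (t : BTensor (Space q) (Omega11 q) (Omega1 q)) :
    BTensor.assoc (Space q) _ _ _ (op b • t) = op b • BTensor.assoc (Space q) _ _ _ t := by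
  induction t using BTensor.induction with
  | htmul u η =>
    induction u using BTensor.induction with
    | htmul ω ζ => rfl
    | hadd s t hs ht => rw [add_tmul, smul_add, map_add, hs, ht, map_add, smul_add]
  | hadd s t hs ht => rw [smul_add, map_add, hs, ht, map_add, smul_add]

theorem flip12_tmul (σ : Flip q) (ω η ζ : Omega1 q) :
    flip12 σ (BTensor.tmul (Space q) ω (BTensor.tmul (Space q) η ζ)) =
      BTensor.assoc (Space q) _ _ _
        (BTensor.tmul (Space q) (σ.toLinearMap (BTensor.tmul (Space q) ω η)) ζ) := rfl

theorem flip23_tmul (σ : Flip q) (ω : Omega1 q) (t : Omega11 q) :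
    flip23 σ (BTensor.tmul (Space q) ω t) = BTensor.tmul (Space q) ω (σ.toLinearMap t) := rfl

theorem flip12_smul (σ : Flip q) (b : Space q) (t : Omega111 q) :
    flip12 σ (b • t) = b • flip12 σ t := by
  induction t using BTensor.induction with
  | htmul ω u =>
    induction u using BTensor.induction with
    | htmul η ζ =>
      rw [BTensor.smul_tmul, flip12_tmul, flip12_tmul, ← BTensor.smul_tmul, Flip.map_smul,
        ← BTensor.smul_tmul, assoc_smul]
    | hadd s t hs ht => rw [tmul_add, smul_add, map_add, hs, ht, map_add, smul_add]
  | hadd s t hs ht => rw [smul_add, map_add, hs, ht, map_add, smul_add]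

theorem flip12_op_smul (σ : Flip q) (b : Space q) (t : Omega111 q) :
    flip12 σ (op b • t) = op b • flip12 σ t := by
  induction t using BTensor.induction with
  | htmul ω u =>
    induction u using BTensor.induction with
    | htmul η ζ =>
      rw [BTensor.op_smul_tmul, BTensor.op_smul_tmul, flip12_tmul, flip12_tmul,
        ← BTensor.op_smul_tmul, assoc_op_smul]
    | hadd s t hs ht => rw [tmul_add, smul_add, map_add, hs, ht, map_add, smul_add]
  | hadd s t hs ht => rw [smul_add, map_add, hs, ht, map_add, smul_add]

theorem flip23_smul (σ : Flip q) (b : Space q) (t : Omega111 q) :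
    flip23 σ (b • t) = b • flip23 σ t := by
  induction t using BTensor.induction with
  | htmul ω u => rfl
  | hadd s t hs ht => rw [smul_add, map_add, hs, ht, map_add, smul_add]

theorem flip23_op_smul (σ : Flip q) (b : Space q) (t : Omega111 q) :
    flip23 σ (op b • t) = op b • flip23 σ t := by
  induction t using BTensor.induction with
  | htmul ω u =>
    rw [BTensor.op_smul_tmul, flip23_tmul, flip23_tmul, Flip.map_op_smul, BTensor.op_smul_tmul]
  | hadd s t hs ht => rw [smul_add, map_add, hs, ht, map_add, smul_add]

theorem flip12_xixixi {σ : Flip q} {S : Mat9} (hσ : HasCoeff σ S) (i j k : Idx) :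
    flip12 σ (xixixi q i j k) = contr12 S (xixixi q) i j k := by
  rw [xixixi, xixi, flip12_tmul]
  change (BTensor.assoc (Space q) _ _ _ ∘ₗ (BTensor.tmulBil (Space q)).flip (xi q k))
    (σ.toLinearMap (xixi q i j)) = _
  rw [hasCoeff_iff.1 hσ, map_contr]
  rfl

theorem flip23_xixixi {σ : Flip q} {S : Mat9} (hσ : HasCoeff σ S) (i j k : Idx) :
    flip23 σ (xixixi q i j k) = contr23 S (xixixi q) i j k := by
  rw [xixixi, flip23_tmul]
  change BTensor.tmulBil (Space q) (xi q i) (σ.toLinearMap (xixi q j k)) = _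
  rw [hasCoeff_iff.1 hσ, map_contr]
  rfl

theorem map_contr12 {E F : Type} [AddCommGroup E] [Module ℂ E] [AddCommGroup F] [Module ℂ F]
    (φ : E →ₗ[ℂ] F) (S : Mat9) (f : Idx → Idx → Idx → E) (i j k : Idx) :
    φ (contr12 S f i j k) = contr12 S (fun a b c => φ (f a b c)) i j k :=
  map_contr φ S _ i j

theorem map_contr23 {E F : Type} [AddCommGroup E] [Module ℂ E] [AddCommGroup F] [Module ℂ F]
    (φ : E →ₗ[ℂ] F) (S : Mat9) (f : Idx → Idx → Idx → E) (i j k : Idx) :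
    φ (contr23 S f i j k) = contr23 S (fun a b c => φ (f a b c)) i j k :=
  map_contr φ S _ j k

theorem isBraid_of_yangBaxter {σ : Flip q} {S : Mat9} (hσ : HasCoeff σ S)
    (hS : ∀ f : Idx → Idx → Idx → Omega111 q,
      contr12 S (contr23 S (contr12 S f)) = contr23 S (contr12 S (contr23 S f))) :
    IsBraid σ := by
  have h12 : (fun i j k => flip12 σ (xixixi q i j k)) = contr12 S (xixixi q) := by
    funext i j k
    exact flip12_xixixi hσ i j k
  have h23 : (fun i j k => flip23 σ (xixixi q i j k)) = contr23 S (xixixi q) := by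
    funext i j k
    exact flip23_xixixi hσ i j k
  refine LinearMap.ext fun t => ?_
  induction t using Omega111.induction with
  | hxi i j k =>
    have e1 : ∀ f : Idx → Idx → Idx → Omega111 q, (fun i j k => flip23 σ (contr12 S f i j k)) =
        contr12 S (fun i j k => flip23 σ (f i j k)) := fun f => by
      funext i j k
      exact map_contr12 _ _ _ _ _ _
    have e2 : ∀ f : Idx → Idx → Idx → Omega111 q, (fun i j k => flip12 σ (contr23 S f i j k)) =
        contr23 S (fun i j k => flip12 σ (f i j k)) := fun f => by
      funext i j k
      exact map_contr23 _ _ _ _ _ _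
    simp only [LinearMap.comp_apply]
    rw [flip12_xixixi hσ, flip23_xixixi hσ, map_contr12, h23, map_contr12, e2, h12, map_contr23,
      h12, map_contr23, e1, h23, hS]
  | hadd s t hs ht => rw [map_add, map_add, hs, ht]
  | hsmul a t ht =>
    simp only [LinearMap.comp_apply, flip12_smul, flip23_smul] at ht ⊢
    rw [ht]

end BraidEquation

/-! ### The metric -/

section Metric

variable {q : Param}

theorem toExt_x (i : Idx) : toExt q (Space.x q i) = ExtSpace.x q i := Space.lift_x _ i

theorem toExt_rinv : toExt q (Space.rinv q) = ExtSpace.rinv q := Space.lift_rinv _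

theorem metricFactor_mul_x (i : Idx) :
    metricFactor q * ExtSpace.x q i = (qval q ^ 2)⁻¹ • (ExtSpace.x q i * metricFactor q) := by
  have h0 := qval_ne_zero q
  have h1 : ExtSpace.dil q * ExtSpace.x q i = (qval q)⁻¹ • (ExtSpace.x q i * ExtSpace.dil q) := by
    rw [ExtSpace.x_mul_dil, inv_smul_smul₀ h0]
  have h2 := (ExtSpace.isQuantumVector q).radiusSq_mul i
  have h3 : ExtSpace.dil q ^ 2 * ExtSpace.x q i =
      (qval q ^ 2)⁻¹ • (ExtSpace.x q i * ExtSpace.dil q ^ 2) := by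
    rw [sq, mul_assoc, h1, mul_smul_comm, ← mul_assoc, h1, smul_mul_assoc, smul_smul, mul_assoc,
      sq (qval q), mul_inv]
  rw [metricFactor, mul_assoc, h3, mul_smul_comm, ← mul_assoc, h2, mul_assoc]

theorem metricFactor_mul_radiusSq : metricFactor q * radiusSq q (ExtSpace.x q) =
    (qval q ^ 4)⁻¹ • (radiusSq q (ExtSpace.x q) * metricFactor q) := by
  have h : ∀ i j, metricFactor q * (ExtSpace.x q i * ExtSpace.x q j) =
      (qval q ^ 4)⁻¹ • (ExtSpace.x q i * ExtSpace.x q j * metricFactor q) := by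
    intro i j
    rw [← mul_assoc, metricFactor_mul_x, smul_mul_assoc, mul_assoc, metricFactor_mul_x,
      mul_smul_comm, smul_smul, mul_assoc]
    congr 1
    ring
  simp only [radiusSq, Finset.mul_sum, Finset.sum_mul, Finset.smul_sum, mul_smul_comm,
    smul_mul_assoc, h, smul_comm (gmat q _ _)]

theorem metricFactor_mul_rinv : metricFactor q * ExtSpace.rinv q =
    qval q ^ 4 • (ExtSpace.rinv q * metricFactor q) := by
  have h0 := pow_ne_zero 4 (qval_ne_zero q)
  have hv := ExtSpace.isQuantumVector q
  calc metricFactor q * ExtSpace.rinv q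
      = ExtSpace.rinv q * (radiusSq q (ExtSpace.x q) * metricFactor q) * ExtSpace.rinv q := by
        rw [← mul_assoc, hv.inv_mul, one_mul]
    _ = _ := by
        rw [← smul_inv_smul₀ h0 (radiusSq q (ExtSpace.x q) * metricFactor q),
          ← metricFactor_mul_radiusSq, mul_smul_comm, smul_mul_assoc, mul_assoc, mul_assoc,
          hv.mul_inv, mul_one]

/-- The metric is right linear. On the generators `x^m` this is the crossing relation
between `g` and the braid matrix. -/
theorem metric_op_smul (b : Space q) :
    ∀ t : Omega11 q, metric q (op b • t) = metric q t * toExt q b := by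
  have ext : ∀ b : Space q, (∀ i j, metric q (op b • xixi q i j) =
      metric q (xixi q i j) * toExt q b) → ∀ t : Omega11 q,
      metric q (op b • t) = metric q t * toExt q b := by
    intro b hb t
    induction t using Omega11.induction with
    | hxi i j => exact hb i j
    | hadd s t hs ht => rw [smul_add, map_add, map_add, hs, ht, add_mul]
    | hsmul a t ht => rw [← smul_comm a (op b), metric_smul, ht, metric_smul, mul_assoc]
  induction b using Space.induction with
  | hx m =>
    refine ext _ fun i j => ?_
    have h : (fun p l k => metric q (Space.x q p • xixi q l k)) =
        fun p l k => gmat q l k • (ExtSpace.x q p * metricFactor q) := by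
      funext p l k
      rw [metric_smul, metric_xixi, toExt_x, mul_smul_comm]
    rw [op_x_smul_xixi, map_smul, map_contr23]
    have h' : ∀ a b c, metric q (contr12 (braidInv q)
        (fun p l k => Space.x q p • xixi q l k) a b c) = contr12 (braidInv q)
        (fun p l k => gmat q l k • (ExtSpace.x q p * metricFactor q)) a b c := by
      intro a b c
      rw [map_contr12, h]
    simp only [h']
    rw [crossing_braidInv fun p => ExtSpace.x q p * metricFactor q, metric_xixi, toExt_x,
      smul_mul_assoc, metricFactor_mul_x, smul_comm]
  | hr =>
    refine ext _ fun i j => ?_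
    rw [op_rinv_smul_xixi, map_smul, metric_smul, metric_xixi, toExt_rinv, smul_mul_assoc,
      metricFactor_mul_rinv, mul_smul_comm, smul_comm]
  | hc z =>
    intro t
    rw [AlgHom.commutes, ← Algebra.commutes, ← Algebra.smul_def, Algebra.algebraMap_eq_smul_one,
      MulOpposite.op_smul, MulOpposite.op_one, smul_assoc, one_smul, map_smul]
  | hadd a b ha hb =>
    intro t
    rw [MulOpposite.op_add, add_smul, map_add, ha, hb, map_add, mul_add]
  | hmul a b ha hb =>
    intro t
    rw [MulOpposite.op_mul, mul_smul, hb, ha, map_mul, mul_assoc]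

theorem metric_smul_op_smul (a b : Space q) (t : Omega11 q) :
    metric q (a • op b • t) = toExt q a * metric q t * toExt q b := by
  rw [metric_smul, metric_op_smul, mul_assoc]

theorem toExtOmega1_add (ω η : Omega1 q) :
    toExtOmega1 q (ω + η) = toExtOmega1 q ω + toExtOmega1 q η := by
  funext j
  simp [toExtOmega1, Forms.add_apply]

theorem toExtOmega1_smul (b : Space q) (ω : Omega1 q) :
    toExtOmega1 q (b • ω) = toExt q b • toExtOmega1 q ω := by
  funext j
  simp [toExtOmega1, Forms.smul_apply]

theorem toExtOmega1_xi (i : Idx) : toExtOmega1 q (xi q i) = Forms.xi (twistExt q) i := by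
  funext j
  simp only [toExtOmega1, xi, Forms.xi_apply]
  split_ifs <;> simp

/-- `r² Λ²` commutes with the `ξ^i`: the factors `q⁻²` from `r²` and `q²` from `Λ²` cancel. -/
theorem op_metricFactor_smul_xi (i : Idx) : op (metricFactor q) • Forms.xi (twistExt q) i =
    metricFactor q • Forms.xi (twistExt q) i := by
  have h0 := qval_ne_zero q
  have h : twistExt q (metricFactor q) = Matrix.diagonal fun _ => metricFactor q := by
    have hx : ∀ i, twistExt q (ExtSpace.x q i) = rightMat q (ExtSpace.x q) i := fun i =>
      ExtSpace.lift_x _ _ _ _ i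
    have hd : twistExt q (ExtSpace.dil q) = Matrix.diagonal fun _ => qval q • ExtSpace.dil q :=
      (RingQuot.liftAlgHom_mkAlgHom_apply _ _ _ _).trans (FreeAlgebra.lift_ι_apply _ _)
    have hr : twistExt q (radiusSq q (ExtSpace.x q)) =
        Matrix.diagonal fun _ => (qval q ^ 2)⁻¹ • radiusSq q (ExtSpace.x q) := by
      rw [← radiusSq_rightMat (ExtSpace.isQuantumVector q), Space.map_radiusSq]
      congr 1
      funext i
      exact hx i
    rw [metricFactor, map_mul, map_pow, hr, hd, sq (Matrix.diagonal _),
      Matrix.diagonal_mul_diagonal, Matrix.diagonal_mul_diagonal]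
    congr 1
    funext _
    rw [smul_mul_smul_comm, smul_mul_smul_comm, ← sq, ← sq, inv_mul_cancel₀ (pow_ne_zero 2 h0),
      one_smul]
  funext j
  rw [Forms.op_smul_xi_apply, h, Forms.smul_apply, Forms.xi_apply, Matrix.diagonal_apply]
  by_cases hij : i = j
  · simp [hij]
  · rw [if_neg hij, if_neg (Ne.symm hij), mul_zero]

theorem metric23_smul (b : Space q) (t : Omega111 q) :
    metric23 q (b • t) = toExt q b • metric23 q t := by
  induction t using BTensor.induction with
  | htmul ω u =>
    change op (metric q u) • toExtOmega1 q (b • ω) =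
      toExt q b • op (metric q u) • toExtOmega1 q ω
    rw [toExtOmega1_smul, ← smul_comm (toExt q b)]
  | hadd s t hs ht => rw [smul_add, map_add, hs, ht, map_add, smul_add]

theorem metric23_op_smul (b : Space q) (t : Omega111 q) :
    metric23 q (op b • t) = op (toExt q b) • metric23 q t := by
  induction t using BTensor.induction with
  | htmul ω u =>
    change op (metric q (op b • u)) • toExtOmega1 q ω =
      op (toExt q b) • op (metric q u) • toExtOmega1 q ω
    rw [metric_op_smul, MulOpposite.op_mul, mul_smul]
  | hadd s t hs ht => rw [smul_add, map_add, hs, ht, map_add, smul_add]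

theorem metric23_xixixi (i j k : Idx) : metric23 q (xixixi q i j k) =
    gmat q j k • metricFactor q • Forms.xi (twistExt q) i := by
  change op (metric q (xixi q j k)) • toExtOmega1 q (xi q i) = _
  rw [metric_xixi, toExtOmega1_xi, MulOpposite.op_smul, smul_assoc, op_metricFactor_smul_xi]

/-- The map `g₂₃ σ₁₂ σ₂₃`, which moves a 1-form to the left through `g`. -/
def metricTriple (σ : Flip q) : Omega111 q →ₗ[ℂ] ExtOmega1 q :=
  metric23 q ∘ₗ flip12 σ ∘ₗ flip23 σ

theorem metricTriple_smul (σ : Flip q) (b : Space q) (t : Omega111 q) :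
    metricTriple σ (b • t) = toExt q b • metricTriple σ t := by
  simp only [metricTriple, LinearMap.comp_apply, flip23_smul, flip12_smul, metric23_smul]

theorem metricTriple_op_smul (σ : Flip q) (b : Space q) (t : Omega111 q) :
    metricTriple σ (op b • t) = op (toExt q b) • metricTriple σ t := by
  simp only [metricTriple, LinearMap.comp_apply, flip23_op_smul, flip12_op_smul, metric23_op_smul]

theorem metricTriple_xixixi {σ : Flip q} {S : Mat9} (hσ : HasCoeff σ S) (i j k : Idx) :
    metricTriple σ (xixixi q i j k) = contr23 S (contr12 S fun h k l => gmat q k l •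
      metricFactor q • Forms.xi (twistExt q) h) i j k := by
  simp only [metricTriple, LinearMap.comp_apply, flip23_xixixi hσ, map_contr23, flip12_xixixi hσ,
    map_contr12, metric23_xixixi]

/-- The covariant derivative of the metric for a connection of Dirac form. -/
theorem metric23_D₂ {C : Connection q} (hC : IsDiracForm C) (ω η : Omega1 q) :
    metric23 q (C.D₂ ω η) =
      -(op (metric q (BTensor.tmul (Space q) ω η)) • toExtOmega1 q (theta q)) +
      metricTriple C.σ
        (BTensor.tmul (Space q) ω (BTensor.tmul (Space q) η (theta q))) := by
  have e1 : BTensor.assoc (Space q) _ _ _ (BTensor.tmul (Space q) (C.D ω) η) =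
      -BTensor.tmul (Space q) (theta q) (BTensor.tmul (Space q) ω η) +
      flip12 C.σ (BTensor.tmul (Space q) ω (BTensor.tmul (Space q) (theta q) η)) := by
    rw [hC, add_tmul, map_add, flip12_tmul]
    congr 1
  have e2 : BTensor.tmul (Space q) ω (C.D η) =
      -BTensor.tmul (Space q) ω (BTensor.tmul (Space q) (theta q) η) +
      flip23 C.σ (BTensor.tmul (Space q) ω (BTensor.tmul (Space q) η (theta q))) := by
    rw [hC, tmul_add]
    congr 1
    exact map_neg (BTensor.tmulBil (Space q) ω) _
  rw [LinearConnection.D₂, e1, e2]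
  simp only [map_add, map_neg, metricTriple, LinearMap.comp_apply]
  change -(op (metric q (BTensor.tmul (Space q) ω η)) • toExtOmega1 q (theta q)) + _ + _ = _
  abel

theorem isMetricCompatibleUpTo_iff {C : Connection q} (hC : IsDiracForm C) {c : ℂ} :
    IsMetricCompatibleUpTo C c ↔ ∀ ω η : Omega1 q, metricTriple C.σ
      (BTensor.tmul (Space q) ω (BTensor.tmul (Space q) η (theta q))) =
        c • (metric q (BTensor.tmul (Space q) ω η) • toExtOmega1 q (theta q)) := by
  simp only [IsMetricCompatibleUpTo, metric23_D₂ hC, add_right_inj]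

theorem isMetricCompatibleUpTo_of_isCoeffCompatible {C : Connection q} (hC : IsDiracForm C)
    {S : Mat9} (hσ : HasCoeff C.σ S) {c : ℂ} (hS : IsCoeffCompatible q S c) :
    IsMetricCompatibleUpTo C c := by
  have key : ∀ (i : Idx) (t : Omega11 q), metricTriple C.σ
      (BTensor.assoc (Space q) _ _ _ (BTensor.tmul (Space q) t (xi q i))) =
        c • (metric q t • toExtOmega1 q (xi q i)) := by
    intro i t
    induction t using Omega11.induction with
    | hxi a b =>
      change metricTriple C.σ (xixixi q a b i) = _
      rw [metricTriple_xixixi hσ, hS.contr, metric_xixi, toExtOmega1_xi, mul_smul, smul_assoc]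
    | hadd s t hs ht => simp only [add_tmul, map_add, hs, ht, add_smul, smul_add]
    | hsmul a t ht =>
      rw [← BTensor.smul_tmul, assoc_smul, metricTriple_smul, ht, metric_smul, mul_smul,
        smul_comm]
  rw [isMetricCompatibleUpTo_iff hC]
  intro ω η
  change metricTriple C.σ (BTensor.assoc (Space q) _ _ _
    (BTensor.tmul (Space q) (BTensor.tmul (Space q) ω η) (theta q))) = _
  generalize BTensor.tmul (Space q) ω η = t
  generalize theta q = ζ
  induction ζ using Omega1.induction generalizing t with
  | hxi i => exact key i t
  | hadd s s' hs hs' =>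
    rw [tmul_add, map_add, map_add, hs, hs', toExtOmega1_add, smul_add, smul_add]
  | hsmul a s hs =>
    rw [← BTensor.smul_tmul_eq, hs, metric_op_smul, toExtOmega1_smul, mul_smul]

/-- Since `ξ^l = [x^l, θ]`, compatibility with the metric can be read off on products `ω ⊗ η ⊗ ξ^l`.
-/
theorem metricTriple_xi_of_isMetricCompatibleUpTo (hq : (q : ℝ) ≠ 1) {C : Connection q}
    (hC : IsDiracForm C) {c : ℂ} (h : IsMetricCompatibleUpTo C c) (ω η : Omega1 q) (l : Idx) :
    metricTriple C.σ (BTensor.tmul (Space q) ω (BTensor.tmul (Space q) η (xi q l))) =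
      c • (metric q (BTensor.tmul (Space q) ω η) • toExtOmega1 q (xi q l)) := by
  rw [isMetricCompatibleUpTo_iff hC] at h
  have e : xi q l + op (Space.x q l) • theta q = Space.x q l • theta q := by
    rw [xi_eq_commutator hq l]
    abel
  have e1 : metricTriple C.σ
      (BTensor.tmul (Space q) ω (BTensor.tmul (Space q) η (Space.x q l • theta q))) =
        c • (metric q (BTensor.tmul (Space q) ω η) • toExtOmega1 q (Space.x q l • theta q)) := by
    rw [← BTensor.smul_tmul_eq, h, ← BTensor.op_smul_tmul, metric_op_smul, toExtOmega1_smul,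
      mul_smul]
  have e2 : metricTriple C.σ
      (BTensor.tmul (Space q) ω (BTensor.tmul (Space q) η (op (Space.x q l) • theta q))) =
        c • (metric q (BTensor.tmul (Space q) ω η) •
          toExtOmega1 q (op (Space.x q l) • theta q)) := by
    rw [← BTensor.op_smul_tmul, ← BTensor.op_smul_tmul, metricTriple_op_smul, h,
      toExtOmega1_op_smul, ← smul_comm c, ← smul_comm (metric q (BTensor.tmul (Space q) ω η))]
  rw [← e, tmul_add, tmul_add, map_add, e2, toExtOmega1_add, smul_add, smul_add] at e1
  exact add_right_cancel e1

end Metric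

/-! ### The two braid matrices as coefficients of flips -/

section Coefficients

variable {q : Param}

theorem inv_smul_braid : (qval q • braid q)⁻¹ = (qval q)⁻¹ • braidInv q := by
  refine Matrix.inv_eq_right_inv ?_
  rw [Matrix.smul_mul, Matrix.mul_smul, braid_mul_braidInv, smul_smul,
    mul_inv_cancel₀ (qval_ne_zero q), one_smul]

theorem IsCentralizing.smul {S : Mat9} (hS : IsCentralizing q S) (z : ℂ) :
    IsCentralizing q (z • S) := by
  intro f
  rw [contr12_smul, contr23_smul, contr12_smul_right, contr23_smul_right, hS]

theorem isCentralizing_braid : IsCentralizing q (braid q) := braid_braidInv_yangBaxter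

theorem isCentralizing_braidInv : IsCentralizing q (braidInv q) := braidInv_yangBaxter

theorem yangBaxter_smul {E : Type} [AddCommGroup E] [Module ℂ E] {S : Mat9}
    (hS : ∀ f : Idx → Idx → Idx → E,
      contr12 S (contr23 S (contr12 S f)) = contr23 S (contr12 S (contr23 S f)))
    (z : ℂ) (f : Idx → Idx → Idx → E) :
    contr12 (z • S) (contr23 (z • S) (contr12 (z • S) f)) =
      contr23 (z • S) (contr12 (z • S) (contr23 (z • S) f)) := by
  simp only [contr12_smul, contr23_smul, contr12_smul_right, contr23_smul_right, hS]

theorem isCoeffCompatible_smul {S : Mat9}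
    (hS : ∀ (u : Idx → ℂ) (i m n : Idx),
      contr23 S (contr12 S fun h k l => gmat q k l • u h) i m n = gmat q i m • u n)
    (z : ℂ) : IsCoeffCompatible q (z • S) (z ^ 2) := by
  refine isCoeffCompatible_of_contr fun u i m n => ?_
  rw [contr12_smul, contr23_smul, contr23_smul_right, smul_smul, ← sq, mul_smul, ← hS]
  rfl

theorem isCoeffCompatible_braid : IsCoeffCompatible q (qval q • braid q) (qval q ^ 2) :=
  isCoeffCompatible_smul crossing_braid _

theorem isCoeffCompatible_braidInv :
    IsCoeffCompatible q ((qval q)⁻¹ • braidInv q) (qval q ^ 2)⁻¹ := by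
  rw [← inv_pow]
  exact isCoeffCompatible_smul crossing_braidInv _

end Coefficients

/-! ### Evaluation at points -/

section Evaluation

variable {q : Param}

theorem sqrtq_add_inv_ne_zero : sqrtq q + (sqrtq q)⁻¹ ≠ 0 := by
  have h : 0 < Real.sqrt (q : ℝ) := Real.sqrt_pos.2 q.2
  have : 0 < Real.sqrt (q : ℝ) + (Real.sqrt (q : ℝ))⁻¹ := by positivity
  unfold sqrtq
  exact_mod_cast this.ne'

/-- Two commuting elements with invertible product give solutions of the quantum space relations
with `x^0 = 0`, because then `r² = (√q + 1/√q) x^- x^+`. -/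
theorem isQuantumVector_of_comm {B : Type} [Ring B] [Algebra ℂ B] {u v ρ : B}
    (huv : u * v = v * u) (h1 : ρ * (u * v) = 1) (h2 : u * v * ρ = 1) :
    IsQuantumVector q ![u, 0, v] ((sqrtq q + (sqrtq q)⁻¹)⁻¹ • ρ) := by
  have hs := sqrtq_add_inv_ne_zero (q := q)
  have hr : radiusSq q ![u, 0, v] = (sqrtq q + (sqrtq q)⁻¹) • (u * v) := by
    simp only [radiusSq, sum_gmat_smul]
    simp only [Matrix.cons_val, mul_zero, add_zero, ← huv]
    module
  refine ⟨comm_of_rels ?_ ?_ ?_, ?_, ?_⟩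
  · simp
  · simp
  · simp [huv]
  · rw [hr, smul_mul_smul_comm, inv_mul_cancel₀ hs, h1, one_smul]
  · rw [hr, smul_mul_smul_comm, mul_inv_cancel₀ hs, h2, one_smul]

/-- The character of the quantum space algebra with `x^- ↦ u`, `x^0 ↦ 0`, `x^+ ↦ 1`. -/
def character (q : Param) (u : ℂˣ) : Space q →ₐ[ℂ] ℂ :=
  Space.lift (isQuantumVector_of_comm (q := q) (u := (u : ℂ)) (v := 1) (ρ := (u : ℂ)⁻¹)
    (mul_comm _ _) (by simp) (by simp))

theorem character_x (u : ℂˣ) (i : Idx) : character q u (Space.x q i) = ![(u : ℂ), 0, 1] i :=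
  Space.lift_x _ i

/-- The linear functional `∑ t_{hk} ξ^h ⊗ ξ^k ↦ ∑ w^{hk} χ(t_{hk})`, with `χ` the character of
parameter `u`. -/
def evalAt (u : ℂˣ) (w : Idx → Idx → ℂ) : Omega11 q →ₗ[ℂ] ℂ :=
  ∑ h, ∑ k,
    w h k • (character q u).toLinearMap ∘ₗ LinearMap.proj k ∘ₗ LinearMap.proj h ∘ₗ coord q

theorem evalAt_apply (u : ℂˣ) (w : Idx → Idx → ℂ) (t : Omega11 q) :
    evalAt u w t = ∑ h, ∑ k, w h k * character q u (coord q t h k) := by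
  simp only [evalAt, LinearMap.sum_apply]
  rfl

theorem evalAt_smul (u : ℂˣ) (w : Idx → Idx → ℂ) (b : Space q) (t : Omega11 q) :
    evalAt u w (b • t) = character q u b * evalAt u w t := by
  simp only [evalAt_apply, coord_smul, map_mul, Finset.mul_sum]
  exact Finset.sum_congr rfl fun h _ => Finset.sum_congr rfl fun k _ => by ring

theorem evalAt_xixi (u : ℂˣ) (w : Idx → Idx → ℂ) (i j : Idx) :
    evalAt u w (xixi q i j) = w i j := by
  simp only [evalAt_apply, coord_xixi, apply_ite, map_one, map_zero, mul_one, mul_zero]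
  rw [Finset.sum_eq_single i (by intro b _ hb; simp [hb]) (by simp),
    Finset.sum_eq_single j (by intro b _ hb; simp [hb]) (by simp), if_pos ⟨rfl, rfl⟩]

theorem evalAt_contr (u : ℂˣ) (w : Idx → Idx → ℂ) (S : Mat9) (i j : Idx) :
    evalAt u w (contr S (xixi q) i j) = contr S w i j := by
  rw [map_contr]
  simp only [evalAt_xixi]

end Evaluation

/-! ### Consequences of right linearity of the flip -/

section RightLinear

variable {q : Param}

/-- In `(ξ^i ⊗ ξ^j) x^m = q⁻² ∑_p x^p (…)` the factor `(…)` is a combination of the `ξ^h ⊗ ξ^k`;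
this is its value under `ξ^h ⊗ ξ^k ↦ w^{hk}`. -/
def rightMul (q : Param) (p m : Idx) (w : Idx → Idx → ℂ) (i j : Idx) : ℂ :=
  contr23 (braidInv q) (contr12 (braidInv q) fun p' l k => if p' = p then w l k else 0) i j m

/-- A flip with complex coefficients `S` is right linear only if `S` commutes with the operators
`rightMul`. -/
theorem contr_rightMul {σ : Flip q} {S : Mat9} (hσ : HasCoeff σ S) (m : Idx)
    (w : Idx → Idx → ℂ) :
    contr S (rightMul q 2 m w) = rightMul q 2 m (contr S w) := by
  have h0 := qval_ne_zero q
  have ev : ∀ (u : ℂˣ) (w : Idx → Idx → ℂ) (i j : Idx),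
      evalAt u w (op (Space.x q m) • xixi q i j) =
      (qval q ^ 2)⁻¹ * ((u : ℂ) * rightMul q 0 m w i j + rightMul q 2 m w i j) := by
    intro u w i j
    have h' : ∀ a b c, evalAt u w (contr12 (braidInv q)
        (fun p l k => Space.x q p • xixi q l k) a b c) = contr12 (braidInv q)
        (fun p l k => ![(u : ℂ), 0, 1] p * w l k) a b c := by
      intro a b c
      simp only [map_contr12, evalAt_smul, character_x, evalAt_xixi]
    rw [op_x_smul_xixi, map_smul, map_contr23]
    simp only [h', smul_eq_mul]
    congr 1
    simp only [rightMul, contr23, contr12, contr, Fin.sum_univ_three, Matrix.cons_val, smul_eq_mul,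
      Fin.reduceEq, if_true, if_false]
    ring
  have key : ∀ (u : ℂˣ) (i j : Idx), contr S (fun a b => (u : ℂ) * rightMul q 0 m w a b +
      rightMul q 2 m w a b) i j = (u : ℂ) * rightMul q 0 m (contr S w) i j +
        rightMul q 2 m (contr S w) i j := by
    intro u i j
    have h := Flip.map_op_smul σ (Space.x q m) (xixi q i j)
    have h1 : ∀ t, evalAt u w (σ.toLinearMap t) = evalAt u (contr S w) t := by
      intro t
      induction t using Omega11.induction with
      | hxi i j => rw [hasCoeff_iff.1 hσ, evalAt_contr, evalAt_xixi]
      | hadd s t hs ht => simp only [map_add, hs, ht]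
      | hsmul a t ht => rw [Flip.map_smul, evalAt_smul, ht, evalAt_smul]
    have h2 := congrArg (evalAt u w) h
    rw [h1, ev, hasCoeff_iff.1 hσ, op_smul_contr, map_contr] at h2
    simp only [ev] at h2
    have h3 : ∀ f : Idx → Idx → ℂ, contr S (fun a b => (qval q ^ 2)⁻¹ * f a b) i j =
        (qval q ^ 2)⁻¹ * contr S f i j := fun f => contr_smul_right _ _ _ _ _
    rw [h3] at h2
    exact (mul_left_cancel₀ (inv_ne_zero (pow_ne_zero 2 h0)) h2).symm
  funext i j
  -- two values of `u` separate the coefficient of `x^+` from that of `x^-`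
  have h1 := key 1 i j
  have h2 := key (Units.mk0 2 two_ne_zero) i j
  simp only [contr, smul_eq_mul, mul_add, Finset.sum_add_distrib, Units.val_one, Units.val_mk0,
    one_mul] at h1 h2 ⊢
  have h3 : ∀ a b, S (i, j) (a, b) * (2 * rightMul q 0 m w a b) =
    2 * (S (i, j) (a, b) * rightMul q 0 m w a b) := by intros; ring
  simp only [h3, ← Finset.mul_sum] at h2
  linear_combination 2 * h1 - h2

end RightLinear

/-! ### Consequences of the vanishing of the torsion -/

section TorsionCoefficients

variable {q : Param}

theorem isCentralizing_one : IsCentralizing q 1 := fun f => by rw [contr12_one, contr23_one]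

theorem IsCentralizing.add {S S' : Mat9} (hS : IsCentralizing q S) (hS' : IsCentralizing q S') :
    IsCentralizing q (S + S') := by
  intro f
  have h12 : ∀ f : Idx → Idx → Idx → Omega11 q, contr12 (S + S') f = contr12 S f + contr12 S' f :=
    fun f => by funext i j k; exact contr_add_left _ _ _ _ _
  have h23 : contr23 (S + S') f = contr23 S f + contr23 S' f := by
    funext i j k; exact contr_add_left _ _ _ _ _
  have ha : ∀ f g : Idx → Idx → Idx → Omega11 q, contr12 (braidInv q) (f + g) =
      contr12 (braidInv q) f + contr12 (braidInv q) g := by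
    intro f g
    funext i j k
    simp only [contr12, contr, Pi.add_apply, smul_add, Finset.sum_add_distrib]
  have hb : ∀ f g : Idx → Idx → Idx → Omega11 q, contr23 (braidInv q) (f + g) =
      contr23 (braidInv q) f + contr23 (braidInv q) g := by
    intro f g
    funext i j k
    simp only [contr23, contr, Pi.add_apply, smul_add, Finset.sum_add_distrib]
  rw [h12, h23, ha, hb, hS, hS']

theorem qval_add_inv_ne_zero : qval q + (qval q)⁻¹ ≠ 0 := by
  have h := q.2
  have : 0 < (q : ℝ) + (q : ℝ)⁻¹ := by positivity
  unfold qval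
  exact_mod_cast this.ne'

theorem qval_add_one_ne_zero : qval q + 1 ≠ 0 := by
  have h := q.2
  have : 0 < (q : ℝ) + 1 := by positivity
  unfold qval
  exact_mod_cast this.ne'

theorem contr_braidInv_avec (a : Fin 3) (i j : Idx) :
    contr (braidInv q) (fun h k => avec q a h k) i j = -qval q * avec q a i j := by
  have h1 := sqrtq_ne_zero q
  have h := @contr_braidInv ℂ _ _ q fun h k => avec q a h k
  obtain ⟨r00, r01, r02, r10, r11, r12, r20, r21, r22⟩ := h
  revert i j
  refine forall_idx (forall_idx ?_ ?_ ?_) (forall_idx ?_ ?_ ?_) (forall_idx ?_ ?_ ?_) <;>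
    simp only [r00, r01, r02, r10, r11, r12, r20, r21, r22, qval_eq] <;>
    clear r00 r01 r02 r10 r11 r12 r20 r21 r22 <;>
    fin_cases a <;> simp [avec, hpar, qval_eq] <;> field_simp <;> ring

/-- The quadratic forms of the defining relations vanish on the sub-bimodule defining the 2-forms,
since it lies in the image of the bimodule map with coefficients `q⁻¹ R̂⁻¹ + 1`, which kills the
antisymmetric part. -/
theorem evalAt_avec_of_mem_wedgeSub (u : ℂˣ) (a : Fin 3) {t : Omega11 q} (ht : t ∈ wedgeSub q) :
    evalAt u (fun h k => avec q a h k) t = 0 := by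
  have h0 := qval_ne_zero q
  set M : Mat9 := (qval q)⁻¹ • braidInv q + 1 with hM
  have hc : IsCentralizing q M := (isCentralizing_braidInv.smul _).add isCentralizing_one
  have hP : ∀ (P : Mat9) (z : ℂ), z ≠ 0 → P * M = z • P → ∀ (b c : Space q) (p : Idx × Idx),
      ∃ t', b • op c • wedgeRel q p P = leftFlip q M t' := by
    intro P z hz hPM b c p
    refine ⟨z⁻¹ • b • op c • wedgeRel q p P, ?_⟩
    have e : leftFlip q M (wedgeRel q p P) = z • wedgeRel q p P := by
      change leftFlip q M (contr P (xixi q) p.1 p.2) = z • contr P (xixi q) p.1 p.2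
      rw [map_contr]
      simp only [leftFlip_xixi]
      change contr P (contr M (xixi q)) _ _ = _
      rw [contr_mul, hPM, contr_smul_left]
    rw [map_smul, leftFlip_smul, leftFlip_op_smul hc, e, smul_comm (op c) z,
      smul_comm b z, inv_smul_smul₀ hz]
  have hkill : ∀ t, evalAt u (fun h k => avec q a h k) (leftFlip q M t) = 0 := by
    intro t
    induction t using Omega11.induction with
    | hxi i j =>
      rw [leftFlip_xixi, evalAt_contr, hM, contr_add_left, contr_smul_left, contr_one,
        contr_braidInv_avec]
      simp only [smul_eq_mul]
      field_simp
      ring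
    | hadd s t hs ht => simp only [map_add, hs, ht, add_zero]
    | hsmul b t ht => rw [leftFlip_smul, evalAt_smul, ht, mul_zero]
  have hle : wedgeSub q ≤ LinearMap.ker (evalAt u (fun h k => avec q a h k)) := by
    refine Submodule.span_le.2 ?_
    have hMS : M = ((qval q ^ 2)⁻¹ + 1) • projS q + (qval q + 1) • projT q := by
      rw [hM]
      simp only [braidInv, projS]
      match_scalars <;> field_simp <;> ring
    have hS2 : projS q * projS q = projS q := by
      simp only [projS, mul_sub, sub_mul, one_mul, mul_one, projA_sq, projT_sq, projA_projT,
        projT_projA]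
      abel
    have hST : projS q * projT q = 0 := by
      simp only [projS, sub_mul, one_mul, projT_sq, projA_projT]
      abel
    have hTS : projT q * projS q = 0 := by
      simp only [projS, mul_sub, mul_one, projT_sq, projT_projA]
      abel
    rintro _ ⟨b, c, p, rfl | rfl⟩
    · obtain ⟨t', h⟩ := hP (projS q) ((qval q ^ 2)⁻¹ + 1) (by
        have := mul_ne_zero (inv_ne_zero h0) (qval_add_inv_ne_zero (q := q))
        intro e
        apply this
        rw [← e]
        field_simp
        ring) (by
        rw [hMS, mul_add, Matrix.mul_smul, Matrix.mul_smul, hS2, hST, smul_zero, add_zero]) b c p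
      rw [h]
      exact hkill t'
    · obtain ⟨t', h⟩ := hP (projT q) (qval q + 1) qval_add_one_ne_zero (by
        rw [hMS, mul_add, Matrix.mul_smul, Matrix.mul_smul, hTS, projT_sq, smul_zero, zero_add])
        b c p
      rw [h]
      exact hkill t'
  exact hle ht

/-- By the right Leibniz rule, the flip is determined by the covariant derivative. -/
theorem flip_xixi_eq (C : Connection q) (i j : Idx) : C.σ.toLinearMap (xixi q i j) =
    C.D (op (Space.x q j) • xi q i) - op (Space.x q j) • C.D (xi q i) := by
  rw [C.leibniz_right, d_x, add_sub_cancel_right]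
  rfl

/-- The flip of a torsion-free connection is `-1` on the antisymmetric part. -/
theorem contr_avec_of_isTorsionFree {C : Connection q} (hC : IsTorsionFree C) {S : Mat9}
    (hσ : HasCoeff C.σ S) (a : Fin 3) (i j : Idx) :
    contr S (fun h k => avec q a h k) i j = -avec q a i j := by
  have hD : ∀ ω, wedge q (C.D ω) = d₁ q ω := fun ω => by
    have := LinearMap.congr_fun hC ω
    exact (sub_eq_zero.1 this).symm
  have h1 : ∀ i, C.D (xi q i) ∈ wedgeSub q := by
    intro i
    have h := d₁_smul_xi q 1 i
    rw [one_smul, d_one] at h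
    rw [← Submodule.Quotient.mk_eq_zero]
    change wedge q (C.D (xi q i)) = 0
    rw [hD, h]
    change wedge q ((BTensor.tmulBil (Space q)).flip (xi q i) 0) = 0
    rw [map_zero, map_zero]
  -- `d(ξ^i x^j)` is computed by moving `x^j` to the left and using `d x^p = ξ^p`
  have h2 : ∀ i j, d₁ q (op (Space.x q j) • xi q i) =
      wedge q (contr ((qval q)⁻¹ • braidInv q) (xixi q) i j) := by
    intro i j
    rw [op_x_smul_xi, contr_smul_left, map_smul, map_smul, map_contr, map_contr]
    simp only [d₁_smul_xi, d_x]
    rfl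
  have h3 : ∀ i j, contr S (xixi q) i j + xixi q i j ∈ wedgeSub q := by
    intro i j
    have e1 : wedge q (contr S (xixi q) i j) =
        wedge q (contr ((qval q)⁻¹ • braidInv q) (xixi q) i j) := by
      rw [← hasCoeff_iff.1 hσ, flip_xixi_eq, map_sub, hD, h2, sub_eq_self]
      exact (Submodule.Quotient.mk_eq_zero _).2 (op_smul_mem_wedgeSub _ (h1 i))
    have e2 : wedge q (contr ((qval q)⁻¹ • braidInv q) (xixi q) i j + xixi q i j) = 0 :=
      (Submodule.Quotient.mk_eq_zero _).2 (isMinusOneOnWedge_braidInv.contr_add_mem i j)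
    rw [← Submodule.Quotient.mk_eq_zero]
    change wedge q _ = 0
    rw [map_add, e1, ← map_add, e2]
  have h := evalAt_avec_of_mem_wedgeSub 1 a (h3 i j)
  rw [map_add, evalAt_contr, evalAt_xixi] at h
  exact eq_neg_of_add_eq_zero_left h

end TorsionCoefficients

/-! ### Classification of the coefficients -/

section Classification

variable {q : Param}

theorem qval_sub_inv_ne_zero (hq : (q : ℝ) ≠ 1) : qval q - (qval q)⁻¹ ≠ 0 := by
  have h0 := qval_ne_zero q
  have : qval q - (qval q)⁻¹ = (qval q)⁻¹ * ((qval q - 1) * (qval q + 1)) := by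
    field_simp
    ring
  rw [this]
  exact mul_ne_zero (inv_ne_zero h0) (mul_ne_zero (qval_sub_one_ne_zero hq) qval_add_one_ne_zero)

/-- A basis of the image of the symmetric trace-free projector. Its elements have the weights `0, …,
4`, and `rightMul q 2 1` takes each of them to a multiple of the next, a nonzero one if `q ≠ 1`. -/
def spinVec (q : Param) : Fin 5 → Matrix Idx Idx ℂ :=
  ![!![1, 0, 0; 0, 0, 0; 0, 0, 0],
    !![0, sqrtq q ^ 2, 0; 1, 0, 0; 0, 0, 0],
    !![0, 0, -sqrtq q ^ 2; 0, sqrtq q + (sqrtq q)⁻¹, 0; -(sqrtq q ^ 2)⁻¹, 0, 0],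
    !![0, 0, 0; 0, 0, sqrtq q ^ 2; 0, 1, 0],
    !![0, 0, 0; 0, 0, 0; 0, 0, 1]]

/-- Right multiplication by `x^+` is diagonal and measures the weight, which is `i + j` for the
component `w^{ij}` (with the indices `-, 0, +` counted as `0, 1, 2`). -/
theorem rightMul_two (w : Idx → Idx → ℂ) (i j : Idx) :
    rightMul q 2 2 w i j = qval q ^ 2 * (qval q)⁻¹ ^ (i.val + j.val) * w i j := by
  have h1 := sqrtq_ne_zero q
  have hR := @contr_braidInv ℂ _ _ q
  simp only [forall_and] at hR
  obtain ⟨-, -, r02, -, -, r12, -, -, r22⟩ := hR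
  revert i j
  refine forall_idx (forall_idx ?_ ?_ ?_) (forall_idx ?_ ?_ ?_) (forall_idx ?_ ?_ ?_) <;>
    simp only [rightMul, contr23, contr12, r02, r12, r22, smul_eq_mul, if_true, qval_eq] <;>
    simp <;> field_simp <;> simp

/-- Right multiplication by `x^0`, taken at `x^+`, raises the weight by one. -/
theorem rightMul_one (w : Idx → Idx → ℂ) :
    rightMul q 2 1 w 0 0 = 0 ∧
    rightMul q 2 1 w 0 1 = (sqrtq q ^ 2 - (sqrtq q ^ 2)⁻¹) * (sqrtq q ^ 3 * w 0 0) ∧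
    rightMul q 2 1 w 0 2 = (sqrtq q ^ 2 - (sqrtq q ^ 2)⁻¹) * (-sqrtq q ^ 2 * w 0 1) ∧
    rightMul q 2 1 w 1 0 = (sqrtq q ^ 2 - (sqrtq q ^ 2)⁻¹) * (sqrtq q * w 0 0) ∧
    rightMul q 2 1 w 1 1 = (sqrtq q ^ 2 - (sqrtq q ^ 2)⁻¹) * (sqrtq q * w 0 1 + sqrtq q * w 1 0) ∧
    rightMul q 2 1 w 1 2 = (sqrtq q ^ 2 - (sqrtq q ^ 2)⁻¹) * (sqrtq q * w 0 2 - w 1 1) ∧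
    rightMul q 2 1 w 2 0 = (sqrtq q ^ 2 - (sqrtq q ^ 2)⁻¹) * (-w 1 0) ∧
    rightMul q 2 1 w 2 1 =
      (sqrtq q ^ 2 - (sqrtq q ^ 2)⁻¹) * ((sqrtq q)⁻¹ * w 2 0 - w 1 1) ∧
    rightMul q 2 1 w 2 2 =
      (sqrtq q ^ 2 - (sqrtq q ^ 2)⁻¹) * (-w 1 2 - (sqrtq q ^ 2)⁻¹ * w 2 1) := by
  have h1 := sqrtq_ne_zero q
  have hR := @contr_braidInv ℂ _ _ q
  simp only [forall_and] at hR
  obtain ⟨-, r01, r02, -, r11, r12, -, r21, r22⟩ := hR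
  refine ⟨?_, ?_, ?_, ?_, ?_, ?_, ?_, ?_, ?_⟩ <;>
    simp only [rightMul, contr23, contr12, r01, r02, r11, r12, r21, r22, smul_eq_mul, if_true,
      Fin.reduceEq, if_false, mul_zero, zero_add, add_zero] <;>
    field_simp <;> ring

/-- The vectors spanning the images of the three projectors span the whole space. -/
theorem mat9_ext {S S' : Mat9}
    (hp : ∀ n i j, contr S (fun h k => spinVec q n h k) i j =
      contr S' (fun h k => spinVec q n h k) i j)
    (ha : ∀ a i j, contr S (fun h k => avec q a h k) i j = contr S' (fun h k => avec q a h k) i j)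
    (hg : ∀ i j, contr S (fun h k => gmat q h k) i j = contr S' (fun h k => gmat q h k) i j) :
    S = S' := by
  have h1 := sqrtq_ne_zero q
  have h2 := one_add_ne_zero q
  have h3 := trace_ne_zero q
  ext ⟨i, j⟩ ⟨k, l⟩
  obtain ⟨z, hz⟩ : ∃ z : Idx → Idx → ℂ, ∀ a b, z a b = S (i, j) (a, b) - S' (i, j) (a, b) :=
    ⟨_, fun _ _ => rfl⟩
  have hsum : ∀ w : Idx → Idx → ℂ, contr S w i j = contr S' w i j →
      ∑ a, ∑ b, z a b * w a b = 0 := by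
    intro w hw
    simp only [hz, sub_mul, Finset.sum_sub_distrib]
    exact sub_eq_zero.2 hw
  have p0 := hsum _ (hp 0 i j)
  have p1 := hsum _ (hp 1 i j)
  have p2 := hsum _ (hp 2 i j)
  have p3 := hsum _ (hp 3 i j)
  have p4 := hsum _ (hp 4 i j)
  have a0 := hsum _ (ha 0 i j)
  have a1 := hsum _ (ha 1 i j)
  have a2 := hsum _ (ha 2 i j)
  have g0 := hsum _ (hg i j)
  simp [Fin.sum_univ_three, spinVec, avec, gmat, hpar, qval_eq] at p0 p1 p2 p3 p4 a0 a1 a2 g0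
  suffices h : ∀ k l, z k l = 0 from sub_eq_zero.1 (hz k l ▸ h k l)
  generalize sqrtq q = s at *
  have z01 : z 0 1 = 0 := (mul_eq_zero_iff_left h2).1 (by linear_combination s ^ 2 * p1 + a0)
  have z10 : z 1 0 = 0 := by linear_combination p1 - s ^ 2 * z01
  have z12 : z 1 2 = 0 := by
    field_simp at a1
    exact (mul_eq_zero_iff_left h2).1 (by linear_combination s ^ 2 * p3 - a1)
  have z21 : z 2 1 = 0 := by linear_combination p3 - s ^ 2 * z12
  field_simp at p2 a2 g0
  have z11 : z 1 1 = s * z 0 2 :=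
    sub_eq_zero.1 ((mul_eq_zero_iff_left h2).1 (by linear_combination s * p2 + a2))
  have z02 : z 0 2 = 0 :=
    (mul_eq_zero_iff_left h3).1 (by linear_combination g0 - s * a2 - s ^ 3 * z11)
  have z20 : z 2 0 = 0 := by linear_combination -p2 + s * (s ^ 2 + 1) * z11 + s ^ 2 * z02
  rw [z02, mul_zero] at z11
  exact forall_idx (forall_idx p0 z01 z02) (forall_idx z10 z11 z12) (forall_idx z20 z21 p4)

theorem inv_qval_pow_injective (hq : (q : ℝ) ≠ 1) :
    Function.Injective fun n : ℕ => (qval q)⁻¹ ^ n := by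
  intro m n h
  have h' : ((q : ℝ)⁻¹) ^ m = ((q : ℝ)⁻¹) ^ n := by
    unfold qval at h
    simp only at h
    exact_mod_cast h
  exact pow_right_injective₀ (inv_pos.2 q.2) (by simpa using hq) h'

/-- A matrix commuting with right multiplication acts by a scalar on the symmetric trace-free
vectors and on `g^{ij}`. -/
theorem exists_contr_spinVec_eq (hq : (q : ℝ) ≠ 1) {S : Mat9}
    (hS : ∀ m w, contr S (rightMul q 2 m w) = rightMul q 2 m (contr S w)) :
    (∃ α : ℂ, ∀ n i j, contr S (fun h k => spinVec q n h k) i j = α * spinVec q n i j) ∧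
    ∃ β : ℂ, ∀ i j, contr S (fun h k => gmat q h k) i j = β * gmat q i j := by
  have h1 := sqrtq_ne_zero q
  have h2 := one_add_ne_zero q
  have h3 := trace_ne_zero q
  have h4 : sqrtq q ^ 2 - (sqrtq q ^ 2)⁻¹ ≠ 0 := by
    rw [← qval_eq]
    exact qval_sub_inv_ne_zero hq
  -- `S` commutes with right multiplication by `x^+`, hence preserves the weight
  have hw : ∀ (n : ℕ) (w : Idx → Idx → ℂ), (∀ i j : Idx, i.val + j.val ≠ n → w i j = 0) →
      ∀ i j : Idx, i.val + j.val ≠ n → contr S w i j = 0 := by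
    intro n w hn i j hij
    have e : rightMul q 2 2 w = fun i j => (qval q ^ 2 * (qval q)⁻¹ ^ n) • w i j := by
      funext i j
      rw [rightMul_two]
      by_cases h : i.val + j.val = n
      · rw [h, smul_eq_mul]
      · rw [hn i j h, mul_zero, smul_zero]
    have h := congrFun (congrFun (hS 2 w) i) j
    rw [e, contr_smul_right, rightMul_two, smul_eq_mul, ← sub_eq_zero, ← sub_mul] at h
    refine (mul_eq_zero.1 h).resolve_left ?_
    rw [← mul_sub]
    exact mul_ne_zero (pow_ne_zero 2 (qval_ne_zero q))
      (sub_ne_zero.2 fun e => hij (inv_qval_pow_injective hq e).symm)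
  -- `S` commutes with right multiplication by `x^0`, hence eigenvectors are raised to eigenvectors
  have hstep : ∀ (α c : ℂ) (p p' : Idx → Idx → ℂ), c ≠ 0 →
      (∀ i j, rightMul q 2 1 p i j = c * p' i j) →
      (∀ i j, contr S p i j = α * p i j) →
      ∀ i j, contr S p' i j = α * p' i j := by
    intro α c p p' hc hr hp i j
    have h := congrFun (congrFun (hS 1 p) i) j
    have e1 : rightMul q 2 1 p = fun i j => c • p' i j := by
      funext i j
      exact hr i j
    have e2 : rightMul q 2 1 (contr S p) i j = α * (c * p' i j) := by
      have : contr S p = fun i j => α * p i j := by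
        funext i j
        exact hp i j
      rw [this, ← hr]
      obtain ⟨r00, r01, r02, r10, r11, r12, r20, r21, r22⟩ := rightMul_one (q := q) p
      obtain ⟨s00, s01, s02, s10, s11, s12, s20, s21, s22⟩ :=
        rightMul_one (q := q) fun i j => α * p i j
      clear * - r00 r01 r02 r10 r11 r12 r20 r21 r22 s00 s01 s02 s10 s11 s12 s20 s21 s22
      revert i j
      refine forall_idx (forall_idx ?_ ?_ ?_) (forall_idx ?_ ?_ ?_) (forall_idx ?_ ?_ ?_) <;>
        simp only [r00, r01, r02, r10, r11, r12, r20, r21, r22, s00, s01, s02, s10, s11, s12,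
          s20, s21, s22] <;> ring
    rw [e1, contr_smul_right, e2, smul_eq_mul] at h
    exact mul_left_cancel₀ hc (by rw [h]; ring)
  have hraise : ∀ (c : ℂ) (p p' : Idx → Idx → ℂ), (0 = c * p' 0 0 ∧
      sqrtq q ^ 3 * p 0 0 = c * p' 0 1 ∧ -sqrtq q ^ 2 * p 0 1 = c * p' 0 2 ∧
      sqrtq q * p 0 0 = c * p' 1 0 ∧ sqrtq q * p 0 1 + sqrtq q * p 1 0 = c * p' 1 1 ∧
      sqrtq q * p 0 2 - p 1 1 = c * p' 1 2 ∧ -p 1 0 = c * p' 2 0 ∧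
      (sqrtq q)⁻¹ * p 2 0 - p 1 1 = c * p' 2 1 ∧
      -p 1 2 - (sqrtq q ^ 2)⁻¹ * p 2 1 = c * p' 2 2) → ∀ i j,
      rightMul q 2 1 p i j = (sqrtq q ^ 2 - (sqrtq q ^ 2)⁻¹) * c * p' i j := by
    rintro c p p' ⟨c00, c01, c02, c10, c11, c12, c20, c21, c22⟩
    obtain ⟨r00, r01, r02, r10, r11, r12, r20, r21, r22⟩ := rightMul_one (q := q) p
    refine forall_idx (forall_idx ?_ ?_ ?_) (forall_idx ?_ ?_ ?_) (forall_idx ?_ ?_ ?_) <;>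
      simp only [r00, r01, r02, r10, r11, r12, r20, r21, r22, c01, c02, c10, c11, c12, c20, c21,
        c22, mul_assoc, ← c00, mul_zero]
  constructor
  · refine ⟨contr S (fun h k => spinVec q 0 h k) 0 0, ?_⟩
    set α := contr S (fun h k => spinVec q 0 h k) 0 0 with hα
    have s0 : ∀ i j, contr S (fun h k => spinVec q 0 h k) i j = α * spinVec q 0 i j := by
      intro i j
      by_cases hij : i = 0 ∧ j = 0
      · rw [hij.1, hij.2, ← hα]
        simp [spinVec]
      · have hne : ∀ i j : Idx, i.val + j.val ≠ 0 → spinVec q 0 i j = 0 := by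
          intro i j h
          fin_cases i <;> fin_cases j <;> simp [spinVec] at h ⊢
        have h0 : i.val + j.val ≠ 0 := fun h =>
          hij ⟨Fin.ext (by simp; omega), Fin.ext (by simp; omega)⟩
        rw [hw 0 _ hne i j h0, hne i j h0, mul_zero]
    have s1 : ∀ i j, contr S (fun h k => spinVec q 1 h k) i j = α * spinVec q 1 i j :=
      hstep α _ (fun h k => spinVec q 0 h k) _ (mul_ne_zero h4 h1) (hraise (sqrtq q) _ _ (by
        simp [spinVec]
        try and_intros
        all_goals (field_simp; try ring))) s0
    have s2 : ∀ i j, contr S (fun h k => spinVec q 2 h k) i j = α * spinVec q 2 i j :=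
      hstep α _ (fun h k => spinVec q 1 h k) _
        (mul_ne_zero h4 (pow_ne_zero 2 h1)) (hraise (sqrtq q ^ 2) _ _ (by
        simp [spinVec]
        try and_intros
        all_goals (field_simp; try ring))) s1
    have s3 : ∀ i j, contr S (fun h k => spinVec q 3 h k) i j = α * spinVec q 3 i j :=
      hstep α _ (fun h k => spinVec q 2 h k) _
        (mul_ne_zero h4 (neg_ne_zero.2 (div_ne_zero h3 (pow_ne_zero 3 h1))))
        (hraise (-((1 + sqrtq q ^ 2 + sqrtq q ^ 4) / sqrtq q ^ 3)) _ _ (by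
        simp [spinVec]
        try and_intros
        all_goals (field_simp; try ring))) s2
    have s4 : ∀ i j, contr S (fun h k => spinVec q 4 h k) i j = α * spinVec q 4 i j :=
      hstep α _ (fun h k => spinVec q 3 h k) _
        (mul_ne_zero h4 (neg_ne_zero.2 (div_ne_zero h2 (pow_ne_zero 2 h1))))
        (hraise (-((1 + sqrtq q ^ 4) / sqrtq q ^ 2)) _ _ (by
        simp [spinVec]
        try and_intros
        all_goals (field_simp; try ring))) s3
    intro n
    fin_cases n
    exacts [s0, s1, s2, s3, s4]
  · -- `g` spans the vectors of weight 2 killed by right multiplication by `x^0`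
    refine ⟨contr S (fun h k => gmat q h k) 1 1, ?_⟩
    have hne : ∀ i j : Idx, i.val + j.val ≠ 2 → gmat q i j = 0 := by
      intro i j h
      fin_cases i <;> fin_cases j <;> simp [gmat] at h ⊢
    have hz := hw 2 _ hne
    have hzero : rightMul q 2 1 (fun h k => gmat q h k) = fun _ _ => 0 := by
      funext i j
      have := hraise 0 (fun h k => gmat q h k) 0 (by simp [gmat, h1]) i j
      rw [this, mul_zero, zero_mul]
    have h := hS 1 fun h k => gmat q h k
    rw [hzero] at h
    set u := contr S fun h k => gmat q h k with hu
    have h' : ∀ i j, rightMul q 2 1 u i j = 0 := by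
      intro i j
      rw [← h]
      simp [contr]
    obtain ⟨-, -, -, -, -, r12, -, r21, -⟩ := rightMul_one (q := q) u
    rw [h', zero_eq_mul, or_iff_right h4] at r12 r21
    refine forall_idx (forall_idx ?_ ?_ ?_) (forall_idx ?_ ?_ ?_) (forall_idx ?_ ?_ ?_)
    · rw [hz 0 0 (by decide), hne 0 0 (by decide), mul_zero]
    · rw [hz 0 1 (by decide), hne 0 1 (by decide), mul_zero]
    · change _ = _ * (sqrtq q)⁻¹
      field_simp
      linear_combination r12
    · rw [hz 1 0 (by decide), hne 1 0 (by decide), mul_zero]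
    · exact (mul_one _).symm
    · rw [hz 1 2 (by decide), hne 1 2 (by decide), mul_zero]
    · change _ = _ * sqrtq q
      field_simp at r21
      linear_combination r21
    · rw [hz 2 1 (by decide), hne 2 1 (by decide), mul_zero]
    · rw [hz 2 2 (by decide), hne 2 2 (by decide), mul_zero]
theorem contr_combination (x y z : ℂ) (f : Idx → Idx → ℂ) (i j : Idx) :
    contr (x • (1 : Mat9) + y • braidInv q + z • capCup q) f i j = x * f i j +
      y * contr (braidInv q) f i j +
      z * (gmat q i j * ((sqrtq q)⁻¹ * f 0 2 + f 1 1 + sqrtq q * f 2 0)) := by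
  rw [contr_add_left, contr_add_left, contr_smul_left, contr_smul_left, contr_smul_left, contr_one,
    contr_capCup, sum_gmat_smul]
  simp only [smul_eq_mul]

theorem contr_braidInv_spinVec (n : Fin 5) (i j : Idx) :
    contr (braidInv q) (fun h k => spinVec q n h k) i j = (qval q)⁻¹ * spinVec q n i j := by
  have h1 := sqrtq_ne_zero q
  have h := @contr_braidInv ℂ _ _ q fun h k => spinVec q n h k
  obtain ⟨r00, r01, r02, r10, r11, r12, r20, r21, r22⟩ := h
  revert i j
  refine forall_idx (forall_idx ?_ ?_ ?_) (forall_idx ?_ ?_ ?_) (forall_idx ?_ ?_ ?_) <;>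
    simp only [r00, r01, r02, r10, r11, r12, r20, r21, r22, qval_eq] <;>
    clear r00 r01 r02 r10 r11 r12 r20 r21 r22 <;>
    fin_cases n <;> simp [spinVec] <;> field_simp <;> ring

theorem contr_braidInv_gmat (i j : Idx) :
    contr (braidInv q) (fun h k => gmat q h k) i j = qval q ^ 2 * gmat q i j := by
  have h1 := sqrtq_ne_zero q
  have h := @contr_braidInv ℂ _ _ q fun h k => gmat q h k
  obtain ⟨r00, r01, r02, r10, r11, r12, r20, r21, r22⟩ := h
  revert i j
  refine forall_idx (forall_idx ?_ ?_ ?_) (forall_idx ?_ ?_ ?_) (forall_idx ?_ ?_ ?_) <;>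
    simp only [r00, r01, r02, r10, r11, r12, r20, r21, r22, qval_eq] <;>
    clear r00 r01 r02 r10 r11 r12 r20 r21 r22 <;>
    simp [gmat] <;> field_simp <;> ring

/-- A matrix acting by scalars on the three spaces of the decomposition, and by `-1` on the
antisymmetric one, is a combination of `1`, `R̂⁻¹` and `g^{ij} g_{kl}`. -/
theorem exists_eq_combination {S : Mat9}
    (hp : ∃ α : ℂ, ∀ n i j, contr S (fun h k => spinVec q n h k) i j = α * spinVec q n i j)
    (ha : ∀ a i j, contr S (fun h k => avec q a h k) i j = -avec q a i j)
    (hg : ∃ β : ℂ, ∀ i j, contr S (fun h k => gmat q h k) i j = β * gmat q i j) :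
    ∃ y z : ℂ, S = (qval q * y - 1) • (1 : Mat9) + y • braidInv q + z • capCup q := by
  have h0 := qval_ne_zero q
  have h1 := sqrtq_ne_zero q
  have h2 := qval_add_inv_ne_zero (q := q)
  have h3 : (sqrtq q)⁻¹ * (sqrtq q)⁻¹ + 1 + sqrtq q * sqrtq q ≠ 0 := by
    have := div_ne_zero (trace_ne_zero q) (pow_ne_zero 2 h1)
    intro e
    apply this
    rw [← e]
    field_simp
  obtain ⟨α, hα⟩ := hp
  obtain ⟨β, hβ⟩ := hg
  obtain ⟨y, hy⟩ : ∃ y, y * (qval q + (qval q)⁻¹) = α + 1 := ⟨_, div_mul_cancel₀ _ h2⟩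
  obtain ⟨z, hz⟩ : ∃ z, z * ((sqrtq q)⁻¹ * (sqrtq q)⁻¹ + 1 + sqrtq q * sqrtq q) =
      β - (qval q * y - 1) - y * qval q ^ 2 := ⟨_, div_mul_cancel₀ _ h3⟩
  refine ⟨y, z, mat9_ext (q := q) ?_ ?_ ?_⟩
  · intro n i j
    have : (sqrtq q)⁻¹ * spinVec q n 0 2 + spinVec q n 1 1 + sqrtq q * spinVec q n 2 0 = 0 := by
      fin_cases n <;> simp [spinVec]
      field_simp
      ring
    rw [hα, contr_combination, contr_braidInv_spinVec, this]
    linear_combination -hy * spinVec q n i j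
  · intro a i j
    have : (sqrtq q)⁻¹ * avec q a 0 2 + avec q a 1 1 + sqrtq q * avec q a 2 0 = 0 := by
      fin_cases a <;> simp [avec, hpar]
      field_simp
      ring
    rw [ha, contr_combination, contr_braidInv_avec, this]
    ring
  · intro i j
    have : (sqrtq q)⁻¹ * gmat q 0 2 + gmat q 1 1 + sqrtq q * gmat q 2 0 =
      (sqrtq q)⁻¹ * (sqrtq q)⁻¹ + 1 + sqrtq q * sqrtq q := rfl
    rw [hβ, contr_combination, contr_braidInv_gmat, this]
    linear_combination -hz * gmat q i j

/-- Compatibility with the metric determines the coefficients. With `x = q y - 1` the coefficient of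
`1`, three of its components give `y (x + z) = 0`, and then either `y = 0`, which contradicts `c >
0`, or one of the two solutions. -/
theorem eq_of_isCoeffCompatible {y z : ℂ} {c : ℝ} (hc : 0 < c)
    (h : IsCoeffCompatible q
      ((qval q * y - 1) • (1 : Mat9) + y • braidInv q + z • capCup q) (c : ℂ)) :
    (qval q * y - 1) • (1 : Mat9) + y • braidInv q + z • capCup q = qval q • braid q ∨
    (qval q * y - 1) • (1 : Mat9) + y • braidInv q + z • capCup q =
      (qval q)⁻¹ • braidInv q := by
  obtain ⟨x, hx⟩ : ∃ x, x = qval q * y - 1 := ⟨_, rfl⟩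
  rw [← hx] at h ⊢
  have h0 := qval_ne_zero q
  have h1 := sqrtq_ne_zero q
  have hR := @contr_braidInv ℂ _ _ q
  simp only [forall_and] at hR
  obtain ⟨r00, r01, r02, r10, r11, r12, r20, r21, r22⟩ := hR
  obtain ⟨g00, g01, g02, g10, g11, g12, g20, g21, g22⟩ := gmat_apply q
  have e1 := h.contr (fun a => if a = 0 then (1 : ℂ) else 0) 0 0 2
  have e2 := h.contr (fun a => if a = 0 then (1 : ℂ) else 0) 0 2 0
  have e3 := h.contr (fun a => if a = 0 then (1 : ℂ) else 0) 2 0 0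
  simp only [contr23, contr12, contr_combination, r00, r01, r02, r10, r11, r12, r20, r21, r22,
    g00, g01, g02, g10, g11, g12, g20, g21, g22, smul_eq_mul, mul_zero, zero_mul, add_zero,
    zero_add, mul_one, one_mul, Fin.reduceEq, if_true, if_false] at e1 e2 e3
  clear r00 r01 r02 r10 r11 r12 r20 r21 r22 g00 g01 g02 g10 g11 g12 g20 g21 g22 h
  have hs := qval_eq q
  field_simp at e1 e2 e3
  have f1 : qval q * x * y + qval q * x * z + qval q ^ 2 * x * z + qval q ^ 2 * x ^ 2 +
      qval q ^ 2 * z ^ 2 + qval q ^ 3 * x * z + qval q ^ 3 * y * z + qval q ^ 4 * x * y +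
      y * z = 0 := by
    rw [hs]; linear_combination e1
  have f2 : 2 * qval q * x * z - qval q * y * z + qval q * y ^ 2 + qval q ^ 2 * x * z +
      qval q ^ 2 * x ^ 2 - qval q ^ 2 * y * z + qval q ^ 2 * z ^ 2 + qval q ^ 3 * x * z +
      qval q ^ 3 * y * z + qval q ^ 4 * x * y + 2 * y * z = qval q * c := by
    rw [hs]; linear_combination e2
  have f3 : qval q * x * z + qval q * y ^ 2 + qval q ^ 2 * x * y + y * z = qval q * c := by
    rw [hs]; linear_combination e3
  have f4 : qval q * (qval q + 1) * (y * (x + z)) = 0 := by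
    linear_combination f1 + f3 - f2
  have f5 : y * (x + z) = 0 :=
    (mul_eq_zero.1 f4).resolve_left (mul_ne_zero h0 qval_add_one_ne_zero)
  rcases mul_eq_zero.1 f5 with hy | hz
  · exfalso
    -- here `c² + (q + 1 + q⁻¹) c + 1 = 0`, which is impossible for positive `c` and `q`
    have hx1 : x = -1 := by rw [hx, hy]; ring
    have hzc : z = -c := by
      refine mul_left_cancel₀ h0 ?_
      rw [hy, hx1] at f3
      linear_combination -f3
    rw [hy, hx1, hzc] at f1
    have f6 : (q : ℝ) * ((q : ℝ) * c + c + q + q * c ^ 2 + (q : ℝ) ^ 2 * c) = 0 := by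
      have : qval q * (qval q * c + c + qval q + qval q * c ^ 2 + qval q ^ 2 * c) = 0 := by
        linear_combination f1
      unfold qval at this
      exact_mod_cast this
    have := q.2
    have : 0 < (q : ℝ) * ((q : ℝ) * c + c + q + q * c ^ 2 + (q : ℝ) ^ 2 * c) := by positivity
    exact this.ne' f6
  · have hz' : z = -x := by linear_combination hz
    have hq1 : qval q ^ 2 - qval q + 1 ≠ 0 := by
      have : 0 < (q : ℝ) ^ 2 - q + 1 := by nlinarith [sq_nonneg ((q : ℝ) - 1 / 2)]
      unfold qval
      exact_mod_cast this.ne'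
    have f6 : x * ((qval q ^ 2 - 1) * y - qval q * x) = 0 := by
      refine (mul_eq_zero.1 ?_).resolve_left hq1
      rw [hz'] at f1
      linear_combination f1
    rcases mul_eq_zero.1 f6 with hx0 | hxy
    · right
      have hy : y = (qval q)⁻¹ := by
        field_simp
        linear_combination hx0 - hx
      rw [hz', hx0, hy, neg_zero, zero_smul, zero_smul, zero_add, add_zero]
    · left
      have hy : y = qval q := by linear_combination -hxy - qval q * hx
      have hx1 : x = qval q ^ 2 - 1 := by rw [hx, hy]; ring
      rw [hz', hx1, hy, braid_eq]
      match_scalars <;> field_simp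

end Classification

/-! ### Uniqueness of the two connections -/

section Uniqueness

variable {q : Param}

/-- The extended algebra is nonzero: it acts on the functions on `ℤ`, with `x^0` acting by `0`, both
`x^-` and `x^+` by multiplication with `n ↦ q^n`, and `Λ` by the shift. -/
instance (q : Param) : Nontrivial (ExtSpace q) := by
  have h0 := qval_ne_zero q
  let m (f : ℤ → ℂ) : Module.End ℂ (ℤ → ℂ) := LinearMap.mulLeft ℂ f
  let sh (k : ℤ) : Module.End ℂ (ℤ → ℂ) := LinearMap.funLeft ℂ ℂ fun n => n - k
  have hmul : ∀ f g : ℤ → ℂ, m f * m g = m (f * g) := fun f g => by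
    refine LinearMap.ext fun v => ?_
    funext n
    simp [m]
  have hone : m 1 = 1 := LinearMap.mulLeft_one ℂ _
  have hsh : ∀ k l, sh k * sh l = sh (k + l) := fun k l => by
    refine LinearMap.ext fun v => ?_
    funext n
    simp [sh, LinearMap.funLeft_apply, sub_sub]
  have hsh0 : sh 0 = 1 := by
    refine LinearMap.ext fun v => ?_
    funext n
    simp [sh, LinearMap.funLeft_apply]
  have hv : IsQuantumVector q ![m fun n => qval q ^ n, 0, m fun n => qval q ^ n]
      ((sqrtq q + (sqrtq q)⁻¹)⁻¹ • m fun n => (qval q ^ (2 * n))⁻¹) := by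
    have e : ∀ n : ℤ, qval q ^ n * qval q ^ n = qval q ^ (2 * n) := fun n => by
      rw [← zpow_add₀ h0, two_mul]
    refine isQuantumVector_of_comm rfl ?_ ?_ <;>
    · rw [hmul, hmul, ← hone]
      congr 1
      funext n
      simp [e, zpow_ne_zero _ h0]
  have hl : ∀ i, ![m fun n => qval q ^ n, 0, m fun n => qval q ^ n] i * sh 1 =
      qval q • (sh 1 * ![m fun n => qval q ^ n, 0, m fun n => qval q ^ n] i) := by
    have : (m fun n => qval q ^ n) * sh 1 = qval q • (sh 1 * m fun n => qval q ^ n) := by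
      refine LinearMap.ext fun v => ?_
      funext n
      simp [m, sh, LinearMap.funLeft_apply, zpow_sub₀ h0]
      field_simp
    exact forall_idx this (by simp) this
  have φ : ExtSpace q →ₐ[ℂ] Module.End ℂ (ℤ → ℂ) := ExtSpace.lift hv hl
    (l' := sh (-1)) (by rw [hsh, add_neg_cancel, hsh0]) (by rw [hsh, neg_add_cancel, hsh0])
  exact φ.toRingHom.domain_nontrivial

theorem smul_metricFactor_eq_zero {z : ℂ} (h : z • metricFactor q = 0) : z = 0 := by
  have e : metricFactor q * (ExtSpace.dilInv q ^ 2 * ExtSpace.rinv q) = 1 := by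
    have e1 : ExtSpace.dil q ^ 2 * ExtSpace.dilInv q ^ 2 = 1 := by
      rw [sq, sq, mul_assoc, ← mul_assoc (ExtSpace.dil q) (ExtSpace.dilInv q),
        ExtSpace.dil_mul_dilInv, one_mul, ExtSpace.dil_mul_dilInv]
    rw [metricFactor, mul_assoc, ← mul_assoc (ExtSpace.dil q ^ 2), e1, one_mul,
      (ExtSpace.isQuantumVector q).mul_inv]
  have h' := congrArg (· * (ExtSpace.dilInv q ^ 2 * ExtSpace.rinv q)) h
  simp only [smul_mul_assoc, e, zero_mul] at h'
  exact (smul_eq_zero.1 h').resolve_right one_ne_zero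

/-- The converse of `isMetricCompatibleUpTo_of_isCoeffCompatible`; it uses that `r² Λ²` is not a
zero divisor. -/
theorem isCoeffCompatible_of_isMetricCompatibleUpTo (hq : (q : ℝ) ≠ 1) {C : Connection q}
    (hC : IsDiracForm C) {S : Mat9} (hσ : HasCoeff C.σ S) {c : ℂ}
    (h : IsMetricCompatibleUpTo C c) : IsCoeffCompatible q S c := by
  intro i a m n
  have e := metricTriple_xi_of_isMetricCompatibleUpTo hq hC h (xi q i) (xi q m) n
  change metricTriple C.σ (xixixi q i m n) = c • (metric q (xixi q i m) • toExtOmega1 q (xi q n))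
    at e
  rw [metricTriple_xixixi hσ, contr23_contr12_gmat, metric_xixi, toExtOmega1_xi] at e
  have e' := congrFun e a
  simp only [Forms.sum_apply, Forms.complex_smul_apply, Forms.smul_apply, Forms.xi_apply,
    mul_ite, mul_one, mul_zero, smul_ite, smul_zero, Finset.sum_ite_eq, Finset.mem_univ, if_true]
    at e'
  rw [← sub_eq_zero]
  refine smul_metricFactor_eq_zero (q := q) ?_
  rw [sub_smul, e', sub_eq_zero]
  by_cases han : a = n
  · rw [if_pos han, if_pos han.symm, mul_one, mul_smul]
  · rw [if_neg han, if_neg (Ne.symm han), mul_zero, mul_zero, zero_smul]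

/-- Right linearity of the flip, vanishing torsion and compatibility with the metric leave only two
possibilities for its coefficients. -/
theorem coeff_eq_of_isMetricCompatibleUpTo (hq : (q : ℝ) ≠ 1) {C : Connection q}
    (hC : IsDiracForm C) (hT : IsTorsionFree C) {S : Mat9} (hσ : HasCoeff C.σ S) {c : ℝ}
    (hc : 0 < c) (h : IsMetricCompatibleUpTo C (c : ℂ)) :
    S = qval q • braid q ∨ S = (qval q)⁻¹ • braidInv q := by
  obtain ⟨hp, hg⟩ := exists_contr_spinVec_eq hq (contr_rightMul hσ)
  obtain ⟨y, z, rfl⟩ := exists_eq_combination hp (contr_avec_of_isTorsionFree hT hσ) hg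
  exact eq_of_isCoeffCompatible hc (isCoeffCompatible_of_isMetricCompatibleUpTo hq hC hσ h)

/-- The flip of a connection is determined by the covariant derivative, and the two flips act
differently on `ξ^- ⊗ ξ^-`. -/
theorem D_ne_of_hasCoeff (hq : (q : ℝ) ≠ 1) {C C' : Connection q}
    (h : HasCoeff C.σ (qval q • braid q)) (h' : HasCoeff C'.σ ((qval q)⁻¹ • braidInv q)) :
    C.D ≠ C'.D := by
  intro e
  have h0 := qval_ne_zero q
  have h1 : C.σ.toLinearMap (xixi q 0 0) = C'.σ.toLinearMap (xixi q 0 0) := by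
    rw [flip_xixi_eq, flip_xixi_eq, e]
  rw [hasCoeff_iff.1 h, hasCoeff_iff.1 h'] at h1
  have h2 := congrArg (evalAt 1 fun h k => spinVec q 0 h k) h1
  rw [evalAt_contr, evalAt_contr, contr_smul_left, contr_smul_left, contr_braid,
    contr_braidInv_spinVec, ← qval_eq] at h2
  simp [spinVec, gmat] at h2
  have h3 := mul_ne_zero (qval_sub_inv_ne_zero hq) (qval_add_inv_ne_zero (q := q))
  apply h3
  linear_combination h2

end Uniqueness
end

end QEuclid

theorem mainTheorem1 (q : Param) (hq : (q : ℝ) ≠ 1) :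
    (∀ f : Space q, d q f = -(op f • theta q - f • theta q)) ∧
    coOmega1 q (theta q) = (1 : FunSO q) ⊗ₜ[ℂ] theta q ∧
    (∀ (a b : Space q) (t : Omega11 q),
      metric q (a • op b • t) = toExt q a * metric q t * toExt q b) ∧
    ∃ C₁ C₂ : Connection q,
      C₁.D ≠ C₂.D ∧
      HasCoeff C₁.σ (qval q • braid q) ∧
      HasCoeff C₂.σ (qval q • braid q)⁻¹ ∧
      (∀ C : Connection q, C = C₁ ∨ C = C₂ →
        IsDiracForm C ∧
        IsTorsionFree C ∧
        IsBraid C.σ ∧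
        IsSOInvariant C ∧
        (∀ σ : Flip q,
          (∀ i j, σ.toLinearMap (xixi q i j) = C.σ.toLinearMap (xixi q i j)) → σ = C.σ)) ∧
      IsMetricCompatibleUpTo C₁ (qval q ^ 2) ∧
      IsMetricCompatibleUpTo C₂ (qval q ^ 2)⁻¹ ∧
      IsCoeffCompatible q (qval q • braid q) (qval q ^ 2) ∧
      IsCoeffCompatible q (qval q • braid q)⁻¹ (qval q ^ 2)⁻¹ ∧
      (∀ C : Connection q,
        IsDiracForm C →
        IsTorsionFree C →
        (∃ S : Mat9, HasCoeff C.σ S) →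
        (∃ c : ℝ, 0 < c ∧ IsMetricCompatibleUpTo C (c : ℂ)) →
        C = C₁ ∨ C = C₂) := by
  have hc₁ := isCentralizing_braid.smul (q := q) (qval q)
  have hc₂ := isCentralizing_braidInv.smul (q := q) (qval q)⁻¹
  have hS₁ := flipOf_hasCoeff hc₁
  have hS₂ := flipOf_hasCoeff hc₂
  have hd := diracConnection_isDiracForm hq
  have hex : ∀ C : Connection q, IsDiracForm C → ∀ {S : Mat9} (hS : IsCentralizing q S),
      HasCoeff C.σ S → C = diracConnection hq (flipOf hS) := fun C hC S hS hσ =>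
    connection_ext_of_isDiracForm hC (hd _)
      (Flip.ext_xixi fun i j => (hσ i j).trans (flipOf_hasCoeff hS i j).symm)
  rw [inv_smul_braid]
  refine ⟨fun f => ?_, coOmega1_theta, metric_smul_op_smul, diracConnection hq (flipOf hc₁),
    diracConnection hq (flipOf hc₂), D_ne_of_hasCoeff hq hS₁ hS₂, hS₁, hS₂, ?_,
    isMetricCompatibleUpTo_of_isCoeffCompatible (hd _) hS₁ isCoeffCompatible_braid,
    isMetricCompatibleUpTo_of_isCoeffCompatible (hd _) hS₂ isCoeffCompatible_braidInv,
    isCoeffCompatible_braid, isCoeffCompatible_braidInv, ?_⟩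
  · rw [d_eq_commutator hq, neg_sub]
  · rintro C (rfl | rfl)
    · exact ⟨hd _, isTorsionFree_of_isMinusOneOnWedge (hd _) hS₁ isMinusOneOnWedge_braid,
        isBraid_of_yangBaxter hS₁ (yangBaxter_smul braid_yangBaxter _),
        isSOInvariant_of_intertwines (hd _) hS₁ ((intertwines_braid q).smul _),
        fun _ h => Flip.ext_xixi h⟩
    · exact ⟨hd _, isTorsionFree_of_isMinusOneOnWedge (hd _) hS₂ isMinusOneOnWedge_braidInv,
        isBraid_of_yangBaxter hS₂ (yangBaxter_smul braidInv_yangBaxter _),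
        isSOInvariant_of_intertwines (hd _) hS₂ ((intertwines_braidInv q).smul _),
        fun _ h => Flip.ext_xixi h⟩
  · rintro C hC hT ⟨S, hσ⟩ ⟨c, hc, h⟩
    rcases coeff_eq_of_isMetricCompatibleUpTo hq hC hT hσ hc h with rfl | rfl
    · exact Or.inl (hex C hC hc₁ hσ)
    · exact Or.inr (hex C hC hc₂ hσ)
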